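/- Let $g$ be a Lorentzian metric of signature $(-,+,+,+)$ on an oriented coordinate domain $\Omega\subset\mathbb R^4$ which is the Kerr solution with parameters ${\rm m}>0$ and ${\rm a}\ge 0$. That is, there is a smooth map $\varphi=(t,r,\theta,\phi):\Omega\to\mathbb R^4$ with invertible differential, whose values satisfy $r^2+{\rm a}^2\cos^2\theta\ne0$, $r^2-2{\rm m}r+{\rm a}^2\neq0$ and $\sin\theta\ne0$, such that $g$ is the pull-back by $\varphi$ of the Kerr metric of mass ${\rm m}$ and angular momentum (per unit mass) ${\rm a}$ in Boyer--Lindquist coordinates. Let $\partial_t$ be the corresponding stationary Killing vector. Let $W$ be the Weyl tensor of $g$, $\eta$ the metric volume element, $G=\frac12 g\wedge g$, i.e. $G_{abcd}=g_{ac}g_{bd}-g_{ad}g_{bc}$. For double 2-forms let $(P\circ Q)^{ab}{}_{cd}=\frac12P^{ab}{}_{mn}Q^{mn}{}_{cd}$, ${\rm Tr}\,P=\frac12P^{ab}{}_{ab}$, $*W=\eta\circ W$ and, for vectors $u,v$, $P(u,v)_{ab}=P_{ambn}u^mv^n$. Put $$A=\tfrac12{\rm Tr}\,W^2,\quad B=\tfrac12{\rm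 Tr}(W\circ *W),\quad D=\tfrac12{\rm Tr}\,W^3,\quad E=\tfrac12{\rm Tr}(W^2\circ *W),$$ $$\alpha=-\frac{AD+BE}{A^2+B^2},\quad \beta=\frac{AE-BD}{A^2+B^2},\quad R=\frac{A\,dA+B\,dB}{3(A^2+B^2)},\quad \Theta=\frac{B\,dA-A\,dB}{3(A^2+B^2)},$$ $$T=\frac\beta\alpha,\quad K=\frac{2(R,\Theta)}{R^2-\Theta^2},\quad \lambda=\frac{K(KT+1)}{K^2-3KT-2},\quad \sigma=\frac{2\alpha}{3\lambda^2-1}-\frac{R^2-\Theta^2}{4(\lambda^2-1)},$$ $$Q=\beta W+\alpha *W,\qquad \Pi=\alpha W-\beta *W-(\alpha^2+\beta^2)G,$$ $$\Xi=\frac{1}{(1-\lambda^2)\sqrt{A^2+B^2}}\bigl[\Pi(R,R)-\Pi(\Theta,\Theta)+Q(R,\Theta)+Q(\Theta,R)\bigr].$$ All the denominators $A^2+B^2$, $\alpha$, $R^2-\Theta^2$, $K^2-3KT-2$, $\lambda^2-1$, $3\lambda^2-1$ are nonzero at a point of $\Omega$ if and only if, at that point, $r\ne0$, $r^2\ne3{\rm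 a}^2\cos^2\theta$, $r^2\neq{\rm a}^2\cos^2\theta$ and $r^2-2{\rm m}r+{\rm a}^2\cos^2\theta\ne0$. At every such point $\sigma>0$, the radicand below is non-negative, and $${\rm m}=\frac{|\alpha|}{\sigma\sqrt\sigma\,|3\lambda^2-1|},\qquad {\rm a}=\frac{1}{2\sigma(1+\lambda^2)}\bigl[\lambda(R,\Theta)+\Theta^2+4\sigma\lambda^2\bigr]^{1/2}.$$ At every such point there are vectors $x$ with $\Xi(x)\ne0$, where $\Xi(x)^a=\Xi^a{}_bx^b$. For each of them $\Xi(x,x)>0$ and, with the real cube root, $$\xi=\Bigl(\frac{1-3\lambda^2}{\alpha}\Bigr)^{1/3}\frac{\Xi(x)}{\sqrt{\Xi(x,x)}}$$ is the stationary Killing vector, up to a constant factor: $\xi=-\,{\rm sgn}(r)\,{\rm sgn}\bigl(g(\partial_t,x)\bigr)\,\sqrt2\,{\rm m}^{-1/3}\,\partial_t$. In particular, if $x$ is a continuous vector field on $\Omega$, then the field $\xi$ satisfies the Killing equation at every such point where $\Xi(x)\neq0$. -/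

import Mathlib

open scoped ContDiff

noncomputable section

namespace WeylKerr

/-! ### Tensors in a coordinate domain of `ℝ⁴`

A coordinate point or a tangent vector is a function `Fin 4 → ℝ`; a metric is given by its
component matrix at each point. Tensors of rank two and four are given by their covariant
components, covectors by their components. -/

/-- Points of a coordinate domain, and components of tangent vectors and covectors. -/
abbrev Coord := Fin 4 → ℝ

/-- Components `g_{ab}(x)` of a metric tensor field. -/
abbrev MetricField := Coord → Matrix (Fin 4) (Fin 4) ℝ

/-- Components `T_{abcd}` of a covariant tensor of rank four at a point. -/
abbrev Tensor4 := Fin 4 → Fin 4 → Fin 4 → Fin 4 → ℝ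

/-- The partial derivative `∂_i f` at `x`. -/
def pd (i : Fin 4) (f : Coord → ℝ) (x : Coord) : ℝ := fderiv ℝ f x (Pi.single i 1)

/-- Christoffel symbols `Γ^a_{bc}` of the Levi-Civita connection. -/
def christoffel (g : MetricField) (a b c : Fin 4) (x : Coord) : ℝ :=
  (1 / 2) * ∑ d, (g x)⁻¹ a d *
    (pd b (fun y => g y d c) x + pd c (fun y => g y d b) x - pd d (fun y => g y b c) x)

/-- Riemann tensor `R^a_{bcd} = ∂_c Γ^a_{bd} - ∂_d Γ^a_{bc} + Γ^a_{ce} Γ^e_{bd} - Γ^a_{de} Γ^e_{bc}`. -/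
def riemannUp (g : MetricField) (x : Coord) (a b c d : Fin 4) : ℝ :=
  pd c (christoffel g a b d) x - pd d (christoffel g a b c) x
    + ∑ e, (christoffel g a c e x * christoffel g e b d x
      - christoffel g a d e x * christoffel g e b c x)

/-- Covariant Riemann tensor `R_{abcd}`. -/
def riemann (g : MetricField) (x : Coord) : Tensor4 := fun a b c d =>
  ∑ e, g x a e * riemannUp g x e b c d

/-- Ricci tensor `R_{bd} = R^a_{bad}`. -/
def ricci (g : MetricField) (x : Coord) (b d : Fin 4) : ℝ := ∑ a, riemannUp g x a b a d

/-- Scalar curvature. -/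
def scalarCurv (g : MetricField) (x : Coord) : ℝ := ∑ a, ∑ b, (g x)⁻¹ a b * ricci g x a b

/-- The metric on 2-forms, `G = ½ g ∧ g`, that is `G_{abcd} = g_{ac} g_{bd} - g_{ad} g_{bc}`. -/
def metricG (g : MetricField) (x : Coord) : Tensor4 := fun a b c d =>
  g x a c * g x b d - g x a d * g x b c

/-- The Weyl tensor `W_{abcd}`. -/
def weyl (g : MetricField) (x : Coord) : Tensor4 := fun a b c d =>
  riemann g x a b c d
    - (1 / 2) * (g x a c * ricci g x b d - g x a d * ricci g x b c
        + g x b d * ricci g x a c - g x b c * ricci g x a d)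
    + (scalarCurv g x / 6) * metricG g x a b c d

/-- The Levi-Civita symbol, with `ε_{0123} = 1`. -/
def leviCivita (a b c d : Fin 4) : ℝ :=
  ((1 : Matrix (Fin 4) (Fin 4) ℝ).submatrix ![a, b, c, d] id).det

/-- The metric volume element `η`; the sign `o` is the orientation of the space-time relative to
the coordinates. -/
def volumeElt (g : MetricField) (o : ℤˣ) (x : Coord) : Tensor4 := fun a b c d =>
  ((o : ℤ) : ℝ) * √|(g x).det| * leviCivita a b c d

/-- Composition `P ∘ Q` of double 2-forms as endomorphisms of the bivectors,
`(P ∘ Q)_{abcd} = ½ P_{abmn} Q^{mn}_{cd}`. -/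
def comp (g : MetricField) (x : Coord) (P Q : Tensor4) : Tensor4 := fun a b c d =>
  (1 / 2) * ∑ m, ∑ n, ∑ k, ∑ l, P a b m n * (g x)⁻¹ m k * (g x)⁻¹ n l * Q k l c d

/-- Trace `Tr P = ½ P^{ab}_{ab}` of a double 2-form as an endomorphism of the bivectors. -/
def trace2 (g : MetricField) (x : Coord) (P : Tensor4) : ℝ :=
  (1 / 2) * ∑ a, ∑ b, ∑ c, ∑ d, (g x)⁻¹ a c * (g x)⁻¹ b d * P a b c d

/-- The dual `*W = η ∘ W` of the Weyl tensor. -/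
def weylDual (g : MetricField) (o : ℤˣ) (x : Coord) : Tensor4 :=
  comp g x (volumeElt g o x) (weyl g x)

/-- Contravariant components of a covector. -/
def raise (g : MetricField) (x : Coord) (u : Coord) : Coord := fun a => ∑ b, (g x)⁻¹ a b * u b

/-- Metric product `(u, v)` of two covectors. -/
def coprod (g : MetricField) (x : Coord) (u v : Coord) : ℝ := ∑ a, ∑ b, (g x)⁻¹ a b * u a * v b

/-- Metric product `(u, v)` of two vectors. -/
def vecprod (g : MetricField) (x : Coord) (u v : Coord) : ℝ := ∑ a, ∑ b, g x a b * u a * v b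

/-- For a double 2-form `P` and covectors `u`, `v`, the 2-tensor
`P(u, v)_{ab} = P_{ambn} u^m v^n`. -/
def act (g : MetricField) (x : Coord) (P : Tensor4) (u v : Coord) (a b : Fin 4) : ℝ :=
  ∑ m, ∑ n, P a m b n * raise g x u m * raise g x v n

/-! ### Weyl concomitants -/

/-- `A = ½ Tr W²`. -/
def invA (g : MetricField) (x : Coord) : ℝ :=
  (1 / 2) * trace2 g x (comp g x (weyl g x) (weyl g x))

/-- `B = ½ Tr (W ∘ *W)`. -/
def invB (g : MetricField) (o : ℤˣ) (x : Coord) : ℝ :=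
  (1 / 2) * trace2 g x (comp g x (weyl g x) (weylDual g o x))

/-- `D = ½ Tr W³`. -/
def invD (g : MetricField) (x : Coord) : ℝ :=
  (1 / 2) * trace2 g x (comp g x (comp g x (weyl g x) (weyl g x)) (weyl g x))

/-- `E = ½ Tr (W² ∘ *W)`. -/
def invE (g : MetricField) (o : ℤˣ) (x : Coord) : ℝ :=
  (1 / 2) * trace2 g x (comp g x (comp g x (weyl g x) (weyl g x)) (weylDual g o x))

/-- `α = - (A D + B E) / (A² + B²)`. -/
def invAlpha (g : MetricField) (o : ℤˣ) (x : Coord) : ℝ :=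
  -((invA g x * invD g x + invB g o x * invE g o x) / (invA g x ^ 2 + invB g o x ^ 2))

/-- `β = (A E - B D) / (A² + B²)`. -/
def invBeta (g : MetricField) (o : ℤˣ) (x : Coord) : ℝ :=
  (invA g x * invE g o x - invB g o x * invD g x) / (invA g x ^ 2 + invB g o x ^ 2)

/-- The 1-form `R = (A dA + B dB) / (3 (A² + B²))`. -/
def formR (g : MetricField) (o : ℤˣ) (x : Coord) : Coord := fun i =>
  (invA g x * pd i (invA g) x + invB g o x * pd i (invB g o) x)
    / (3 * (invA g x ^ 2 + invB g o x ^ 2))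

/-- The 1-form `Θ = (B dA - A dB) / (3 (A² + B²))`. -/
def formTheta (g : MetricField) (o : ℤˣ) (x : Coord) : Coord := fun i =>
  (invB g o x * pd i (invA g) x - invA g x * pd i (invB g o) x)
    / (3 * (invA g x ^ 2 + invB g o x ^ 2))

/-- `R² = (R, R)`. -/
def sqR (g : MetricField) (o : ℤˣ) (x : Coord) : ℝ := coprod g x (formR g o x) (formR g o x)

/-- `Θ² = (Θ, Θ)`. -/
def sqTheta (g : MetricField) (o : ℤˣ) (x : Coord) : ℝ :=
  coprod g x (formTheta g o x) (formTheta g o x)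

/-- `(R, Θ)`. -/
def prodRTheta (g : MetricField) (o : ℤˣ) (x : Coord) : ℝ :=
  coprod g x (formR g o x) (formTheta g o x)

/-- `K = 2 (R, Θ) / (R² - Θ²)`. -/
def invK (g : MetricField) (o : ℤˣ) (x : Coord) : ℝ :=
  2 * prodRTheta g o x / (sqR g o x - sqTheta g o x)

/-- `T = β / α`. -/
def invT (g : MetricField) (o : ℤˣ) (x : Coord) : ℝ := invBeta g o x / invAlpha g o x

/-- `λ = K (K T + 1) / (K² - 3 K T - 2)`. -/
def invLambda (g : MetricField) (o : ℤˣ) (x : Coord) : ℝ :=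
  invK g o x * (invK g o x * invT g o x + 1)
    / (invK g o x ^ 2 - 3 * invK g o x * invT g o x - 2)

/-- `σ = 2 α / (3 λ² - 1) - (R² - Θ²) / (4 (λ² - 1))`. -/
def invSigma (g : MetricField) (o : ℤˣ) (x : Coord) : ℝ :=
  2 * invAlpha g o x / (3 * invLambda g o x ^ 2 - 1)
    - (sqR g o x - sqTheta g o x) / (4 * (invLambda g o x ^ 2 - 1))

/-- `Q = β W + α *W`. -/
def tensorQ (g : MetricField) (o : ℤˣ) (x : Coord) : Tensor4 := fun a b c d =>
  invBeta g o x * weyl g x a b c d + invAlpha g o x * weylDual g o x a b c d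

/-- `Π = α W - β *W - (α² + β²) G`. -/
def tensorPi (g : MetricField) (o : ℤˣ) (x : Coord) : Tensor4 := fun a b c d =>
  invAlpha g o x * weyl g x a b c d - invBeta g o x * weylDual g o x a b c d
    - (invAlpha g o x ^ 2 + invBeta g o x ^ 2) * metricG g x a b c d

/-- `Ξ = [Π(R,R) - Π(Θ,Θ) + Q(R,Θ) + Q(Θ,R)] / ((1 - λ²) √(A² + B²))`. -/
def tensorXi (g : MetricField) (o : ℤˣ) (x : Coord) (a b : Fin 4) : ℝ :=
  (1 / ((1 - invLambda g o x ^ 2) * √(invA g x ^ 2 + invB g o x ^ 2))) *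
    (act g x (tensorPi g o x) (formR g o x) (formR g o x) a b
      - act g x (tensorPi g o x) (formTheta g o x) (formTheta g o x) a b
      + act g x (tensorQ g o x) (formR g o x) (formTheta g o x) a b
      + act g x (tensorQ g o x) (formTheta g o x) (formR g o x) a b)

/-- The vector `Ξ(v)^a = Ξ^a_b v^b`. -/
def xiVec (g : MetricField) (o : ℤˣ) (x : Coord) (v : Coord) : Coord :=
  raise g x (fun b => ∑ c, tensorXi g o x b c * v c)

/-- The scalar `Ξ(v, v) = Ξ_{ab} v^a v^b`. -/
def xiQuad (g : MetricField) (o : ℤˣ) (x : Coord) (v : Coord) : ℝ :=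
  ∑ a, ∑ b, tensorXi g o x a b * v a * v b

/-- The real cube root. -/
def cbrt (s : ℝ) : ℝ := Real.sign s * |s| ^ ((1 : ℝ) / 3)

/-- The vector `((1 - 3 λ²) / α)^{1/3} Ξ(v) / √Ξ(v, v)`. -/
def killingVec (g : MetricField) (o : ℤˣ) (x : Coord) (v : Coord) : Coord :=
  (cbrt ((1 - 3 * invLambda g o x ^ 2) / invAlpha g o x) / √(xiQuad g o x v)) • xiVec g o x v

/-- The radicand `λ (R, Θ) + Θ² + 4 σ λ²`. -/
def radicand (g : MetricField) (o : ℤˣ) (x : Coord) : ℝ :=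
  invLambda g o x * prodRTheta g o x + sqTheta g o x
    + 4 * invSigma g o x * invLambda g o x ^ 2

/-- All denominators in the definitions of the invariants are nonzero at `x`. -/
structure Regular (g : MetricField) (o : ℤˣ) (x : Coord) : Prop where
  sq_ne : invA g x ^ 2 + invB g o x ^ 2 ≠ 0
  alpha_ne : invAlpha g o x ≠ 0
  diff_ne : sqR g o x - sqTheta g o x ≠ 0
  den_ne : invK g o x ^ 2 - 3 * invK g o x * invT g o x - 2 ≠ 0
  lambda_ne : invLambda g o x ^ 2 - 1 ≠ 0
  lambda_ne_third : 3 * invLambda g o x ^ 2 - 1 ≠ 0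

/-- The vector field `ξ` satisfies the Killing equation `(L_ξ g)_{ab} = 0` at `x`. -/
def IsKillingAt (g : MetricField) (ξ : Coord → Coord) (x : Coord) : Prop :=
  DifferentiableAt ℝ ξ x ∧ ∀ a b : Fin 4,
    ∑ c, (ξ x c * pd c (fun y => g y a b) x + g x c b * pd a (fun y => ξ y c) x
      + g x a c * pd b (fun y => ξ y c) x) = 0

/-! ### The Kerr metric -/

/-- The Kerr metric of mass `m` and angular momentum (per unit mass) `a` in Boyer-Lindquist
coordinates `(t, r, θ, φ)`. -/
def kerrBL (m a : ℝ) : MetricField := fun q =>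
  let r := q 1
  let s := Real.sin (q 2)
  let S := r ^ 2 + a ^ 2 * Real.cos (q 2) ^ 2
  let Δ := r ^ 2 - 2 * m * r + a ^ 2
  !![-(1 - 2 * m * r / S), 0, 0, -(2 * m * a * r * s ^ 2 / S);
     0, S / Δ, 0, 0;
     0, 0, S, 0;
     -(2 * m * a * r * s ^ 2 / S), 0, 0, (r ^ 2 + a ^ 2 + 2 * m * a ^ 2 * r * s ^ 2 / S) * s ^ 2]

/-- The Boyer-Lindquist coordinate domain: away from the ring singularity, the horizons and the
axis. -/
def domainBL (m a : ℝ) : Set Coord :=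
  {q | q 1 ^ 2 + a ^ 2 * Real.cos (q 2) ^ 2 ≠ 0 ∧ q 1 ^ 2 - 2 * m * q 1 + a ^ 2 ≠ 0 ∧
    Real.sin (q 2) ≠ 0}

/-- The Jacobian matrix of `φ` at `x`. -/
def jacobian (φ : Coord → Coord) (x : Coord) : Matrix (Fin 4) (Fin 4) ℝ :=
  Matrix.of fun i j => fderiv ℝ φ x (Pi.single j 1) i

/-- The metric `g` on the coordinate domain `Ω` (with arbitrary coordinates) is the Kerr solution
of mass `m` and angular momentum `a`, and `φ` is the transition to Boyer-Lindquist coordinates. -/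
structure IsKerr (m a : ℝ) (Ω : Set Coord) (φ : Coord → Coord) (g : MetricField) : Prop where
  mass_pos : 0 < m
  ang_nonneg : 0 ≤ a
  isOpen : IsOpen Ω
  smooth : ContDiffOn ℝ ∞ φ Ω
  det_ne : ∀ x ∈ Ω, (jacobian φ x).det ≠ 0
  mapsTo : Set.MapsTo φ Ω (domainBL m a)
  metric_eq : ∀ x ∈ Ω, g x = (jacobian φ x).transpose * kerrBL m a (φ x) * jacobian φ x

/-- The stationary vector field `∂/∂t` of the Kerr solution (`t` the Boyer-Lindquist time),
expressed in the coordinates of `Ω`. -/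
def stationaryField (φ : Coord → Coord) (x : Coord) : Coord :=
  (jacobian φ x)⁻¹.mulVec (Pi.single 0 1)

end WeylKerr

end

open WeylKerr

/-!
The proof rests on a complex description of the algebra of double 2-forms in the Carter coframe.

In the coordinates `(t, r, y, φ)` with `y = cos θ` and with `S = r² + a² y²`,
`Δ = r² - 2 m r + a²`, the coframe
`e⁰ = dt - a (1 - y²) dφ`, `e¹ = (S / Δ) dr`, `e² = (S / (1 - y²)) dy`, `e³ = -a dt + (r² + a²) dφ`
has rational components, and in it the Kerr metric is `diag (-p, p, q, q)` with `p = Δ / S` and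
`q = (1 - y²) / S`. No square root and no sign of `Δ` enters, so all the regions of the space-time
are treated at once. The Levi-Civita connection forms of this coframe are written down explicitly;
that they are the right ones is `kerr_compat` and `kerr_torsion`, and `kerr_curvForm` computes their
curvature. Cartan's structure equations (`MovingFrame.riemann_eq`) turn this into the Riemann tensor,
and since moving frames can be pulled back (`MovingFrame.pullback`, `curvForm_pullConn`), the result
holds in the arbitrary coordinates of `Ω`: the metric is Ricci-flat, and its Weyl tensor is
`biForm p q ![-2 ψ, ψ, ψ] E E` with `ψ = -m / (r + i a y)³`.

The double 2-forms `biForm p q z E E` are those which are diagonal on the self-dual bivectors of the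
coframe, with complex eigenvalues `z`. They compose by multiplication of the eigenvalues, their trace
is `2 Re (z₀ + z₁ + z₂)`, the metric on 2-forms is `z = 1`, and the volume element is
`z = s i`, with a sign `s` which is locally constant (`IsFrame.comp_biForm`, `IsFrame.trace2_biForm`,
`IsFrame.metricG_eq`, `IsFrame.volumeElt_eq`). Therefore `A`, `B`, `D`, `E` are real and imaginary
parts of `ψ²` and `ψ³`, which gives `α = Re ψ` and `β = s Im ψ`. The 1-forms `R` and `Θ` are the real
and imaginary parts of `(1/3) d log ψ² = -2 d(r + i a y) / (r + i a y)`, up to the sign `s`.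

The rest is rational algebra in `r` and `τ = s a y`, where `S = r² + τ²`: one finds
`λ = τ / r` and `σ = r² / S²`, and the denominators are controlled by `r`, `r² - 3 τ²`, `r² - τ²` and
`r² - 2 m r + τ²`. In the same way `Π` and `Q` have the eigenvalues `-3 |ψ|² (1, 0, 0)` and
`s i |ψ|² (-2, 1, 1)`, and `Ξ = 2 σ η ⊗ η`, where `η = -(p e⁰ + a q e³)` is metrically equivalent
to `∂_t` (`IsKerr.tensorXi_eq`). Hence `Ξ(x)` is a multiple of `∂_t`, and the normalization is an
identity between real cube roots.

The Killing equation for `∂_t` holds because the components of the metric do not depend on `t`. Near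
a given point the signs of `r` and of `g(∂_t, x)` are constant, so `ξ` agrees there with a constant
multiple of `∂_t`, even though `x` is only continuous.
-/

noncomputable section

namespace WeylKerr

/-! ### Matrix-valued functions and their partial derivatives -/

/-- The entrywise partial derivative of a matrix-valued function. -/
def pdMat (c : Fin 4) (M : MetricField) (x : Coord) : Matrix (Fin 4) (Fin 4) ℝ :=
  Matrix.of fun i j => pd c (fun y => M y i j) x

/-- Entrywise smoothness of a matrix-valued function on a set. -/
def SmoothOn (M : MetricField) (U : Set Coord) : Prop :=
  ∀ i j, ContDiffOn ℝ ∞ (fun y => M y i j) U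

theorem pd_congr {f f' : Coord → ℝ} {x : Coord} (h : f =ᶠ[nhds x] f') (c : Fin 4) :
    pd c f x = pd c f' x := by
  unfold pd; rw [h.fderiv_eq]

theorem pd_add {f f' : Coord → ℝ} {x : Coord} (hf : DifferentiableAt ℝ f x)
    (hf' : DifferentiableAt ℝ f' x) (c : Fin 4) :
    pd c (fun y => f y + f' y) x = pd c f x + pd c f' x := by
  unfold pd; rw [fderiv_fun_add hf hf']; rfl

theorem pd_mul {f f' : Coord → ℝ} {x : Coord} (hf : DifferentiableAt ℝ f x)
    (hf' : DifferentiableAt ℝ f' x) (c : Fin 4) :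
    pd c (fun y => f y * f' y) x = pd c f x * f' x + f x * pd c f' x := by
  unfold pd; rw [fderiv_fun_mul hf hf']
  simp only [add_apply, smul_apply, smul_eq_mul]
  ring

theorem pd_sum {ι : Type*} {s : Finset ι} {f : ι → Coord → ℝ} {x : Coord}
    (hf : ∀ i ∈ s, DifferentiableAt ℝ (f i) x) (c : Fin 4) :
    pd c (fun y => ∑ i ∈ s, f i y) x = ∑ i ∈ s, pd c (f i) x := by
  unfold pd; rw [fderiv_fun_sum hf]; simp

theorem contDiffOn_pd {f : Coord → ℝ} {U : Set Coord} (hU : IsOpen U) (hf : ContDiffOn ℝ ∞ f U)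
    (c : Fin 4) : ContDiffOn ℝ ∞ (pd c f) U :=
  (hf.fderiv_of_isOpen hU le_rfl).clm_apply contDiffOn_const

theorem pd_comm {f : Coord → ℝ} {U : Set Coord} (hU : IsOpen U) (hf : ContDiffOn ℝ ∞ f U)
    {x : Coord} (hx : x ∈ U) (c d : Fin 4) : pd c (pd d f) x = pd d (pd c f) x := by
  have hfx : ContDiffAt ℝ ∞ f x := hf.contDiffAt (hU.mem_nhds hx)
  have hsymm : IsSymmSndFDerivAt ℝ f x := hfx.isSymmSndFDerivAt
    (by simpa using WithTop.coe_le_coe.2 (le_top (a := (2 : ℕ∞))))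
  have hd : DifferentiableAt ℝ (fderiv ℝ f) x :=
    ((hf.fderiv_of_isOpen hU (m := ∞) le_rfl).differentiableOn (by simp)).differentiableAt
      (hU.mem_nhds hx)
  have key : ∀ i j : Fin 4,
      pd i (pd j f) x = fderiv ℝ (fderiv ℝ f) x (Pi.single i 1) (Pi.single j 1) := by
    intro i j
    unfold pd
    rw [fderiv_clm_apply hd (differentiableAt_const _)]
    simp
  rw [key, key]
  exact hsymm _ _

namespace SmoothOn

variable {M N : MetricField} {U : Set Coord}

theorem differentiableAt (hU : IsOpen U) (hM : SmoothOn M U) {x : Coord} (hx : x ∈ U)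
    (i j : Fin 4) : DifferentiableAt ℝ (fun y => M y i j) x :=
  ((hM i j).differentiableOn (by simp)).differentiableAt (hU.mem_nhds hx)

theorem mul (hM : SmoothOn M U) (hN : SmoothOn N U) : SmoothOn (fun x => M x * N x) U := by
  intro i j
  simp only [Matrix.mul_apply]
  exact ContDiffOn.sum fun k _ => (hM i k).mul (hN k j)

theorem add (hM : SmoothOn M U) (hN : SmoothOn N U) : SmoothOn (fun x => M x + N x) U :=
  fun i j => (hM i j).add (hN i j)

theorem pdMat (hU : IsOpen U) (hM : SmoothOn M U) (c : Fin 4) : SmoothOn (pdMat c M) U :=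
  fun i j => contDiffOn_pd hU (hM i j) c

theorem det (hM : SmoothOn M U) : ContDiffOn ℝ ∞ (fun x => (M x).det) U := by
  simp only [Matrix.det_apply]
  refine ContDiffOn.sum fun σ _ => ?_
  simp only [Units.smul_def, zsmul_eq_mul]
  exact contDiffOn_const.mul (contDiffOn_prod fun i _ => hM _ _)

theorem inv (hM : SmoothOn M U) (hdet : ∀ x ∈ U, (M x).det ≠ 0) :
    SmoothOn (fun x => (M x)⁻¹) U := by
  intro i j
  have h : ∀ x, (M x)⁻¹ i j = (M x).det⁻¹ * ((M x).updateRow j (Pi.single i 1)).det := by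
    intro x
    rw [Matrix.inv_def, Matrix.smul_apply, Matrix.adjugate_apply, Ring.inverse_eq_inv', smul_eq_mul]
  simp only [h]
  refine (hM.det.inv hdet).mul (SmoothOn.det fun k l => ?_)
  by_cases hk : k = j
  · subst hk
    simpa using contDiffOn_const
  · simpa [Matrix.updateRow_ne hk] using hM k l

end SmoothOn

theorem pdMat_congr {M N : MetricField} {x : Coord} (h : M =ᶠ[nhds x] N) (c : Fin 4) :
    pdMat c M x = pdMat c N x := by
  ext i j
  exact pd_congr (h.mono fun y hy => by rw [hy]) c

theorem pdMat_transpose (M : MetricField) (x : Coord) (c : Fin 4) :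
    pdMat c (fun y => (M y).transpose) x = (pdMat c M x).transpose := rfl

theorem pdMat_mul {M N : MetricField} {x : Coord}
    (hM : ∀ i j, DifferentiableAt ℝ (fun y => M y i j) x)
    (hN : ∀ i j, DifferentiableAt ℝ (fun y => N y i j) x) (c : Fin 4) :
    pdMat c (fun y => M y * N y) x = pdMat c M x * N x + M x * pdMat c N x := by
  ext i j
  simp only [pdMat, Matrix.mul_apply, Matrix.of_apply, Matrix.add_apply]
  rw [pd_sum (f := fun k y => M y i k * N y k j) (fun k _ => (hM i k).mul (hN k j)),
    ← Finset.sum_add_distrib]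
  exact Finset.sum_congr rfl fun k _ => pd_mul (hM i k) (hN k j) c

theorem pdMat_add {M N : MetricField} {x : Coord}
    (hM : ∀ i j, DifferentiableAt ℝ (fun y => M y i j) x)
    (hN : ∀ i j, DifferentiableAt ℝ (fun y => N y i j) x) (c : Fin 4) :
    pdMat c (fun y => M y + N y) x = pdMat c M x + pdMat c N x := by
  ext i j
  exact pd_add (hM i j) (hN i j) c

theorem pdMat_comm {M : MetricField} {U : Set Coord} (hU : IsOpen U) (hM : SmoothOn M U)
    {x : Coord} (hx : x ∈ U) (c d : Fin 4) : pdMat c (pdMat d M) x = pdMat d (pdMat c M) x := by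
  ext i j
  exact pd_comm hU (hM i j) hx c d

/-! ### Cartan's structure equations -/

/-- A moving coframe `E` (the rows of `E x` are the 1-forms of the coframe) in which the metric has
components `h`, together with its Levi-Civita connection forms: `Γ c x` is the matrix of the
connection in the direction of the `c`-th coordinate. The last two fields say that the connection
is metric and torsion-free. -/
structure MovingFrame (U : Set Coord) (g E h : MetricField) (Γ : Fin 4 → MetricField) :
    Prop where
  isOpen : IsOpen U
  smooth_E : SmoothOn E U
  smooth_h : SmoothOn h U
  smooth_conn : ∀ c, SmoothOn (Γ c) U
  det_E : ∀ x ∈ U, (E x).det ≠ 0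
  det_h : ∀ x ∈ U, (h x).det ≠ 0
  symm_h : ∀ x ∈ U, (h x).transpose = h x
  metric_eq : ∀ x ∈ U, g x = (E x).transpose * h x * E x
  compat : ∀ x ∈ U, ∀ c, pdMat c h x = h x * Γ c x + (Γ c x).transpose * h x
  torsion : ∀ x ∈ U, ∀ b c i, (pdMat b E x + Γ b x * E x) i c = (pdMat c E x + Γ c x * E x) i b

/-- The curvature 2-form `∂_c Γ_d - ∂_d Γ_c + [Γ_c, Γ_d]` of connection forms. -/
def curvForm (Γ : Fin 4 → MetricField) (c d : Fin 4) (x : Coord) : Matrix (Fin 4) (Fin 4) ℝ :=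
  pdMat c (Γ d) x - pdMat d (Γ c) x + Γ c x * Γ d x - Γ d x * Γ c x

namespace MovingFrame

variable {U : Set Coord} {g E h : MetricField} {Γ : Fin 4 → MetricField}

theorem symm_g (F : MovingFrame U g E h Γ) {x : Coord} (hx : x ∈ U) :
    (g x).transpose = g x := by
  rw [F.metric_eq x hx]
  simp only [Matrix.transpose_mul, Matrix.transpose_transpose, F.symm_h x hx, Matrix.mul_assoc]

theorem det_g (F : MovingFrame U g E h Γ) {x : Coord} (hx : x ∈ U) : (g x).det ≠ 0 := by
  rw [F.metric_eq x hx, Matrix.det_mul, Matrix.det_mul, Matrix.det_transpose]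
  exact mul_ne_zero (mul_ne_zero (F.det_E x hx) (F.det_h x hx)) (F.det_E x hx)

/-- The connection with connection forms `Γ` in the coframe `E`, written in the coordinate frame:
the gauge transform of `Γ` by `E`, as a matrix for each direction. -/
def coordConn (E : MetricField) (Γ : Fin 4 → MetricField) (c : Fin 4) : MetricField :=
  fun x => (E x)⁻¹ * (pdMat c E x + Γ c x * E x)

theorem mul_coordConn (F : MovingFrame U g E h Γ) {x : Coord} (hx : x ∈ U) (c : Fin 4) :
    E x * coordConn E Γ c x = pdMat c E x + Γ c x * E x :=
  Matrix.mul_nonsing_inv_cancel_left _ _ (F.det_E x hx).isUnit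

/-- The connection `coordConn` is torsion-free. -/
theorem coordConn_symm (F : MovingFrame U g E h Γ) {x : Coord} (hx : x ∈ U) (a b c : Fin 4) :
    coordConn E Γ b x a c = coordConn E Γ c x a b := by
  simp only [coordConn, Matrix.mul_apply]
  exact Finset.sum_congr rfl fun i _ => by rw [F.torsion x hx b c i]

theorem smooth_coordConn (F : MovingFrame U g E h Γ) (c : Fin 4) :
    SmoothOn (coordConn E Γ c) U :=
  (F.smooth_E.inv F.det_E).mul ((F.smooth_E.pdMat F.isOpen c).add ((F.smooth_conn c).mul F.smooth_E))

/-- The connection `coordConn` is metric. -/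
theorem pdMat_metric (F : MovingFrame U g E h Γ) {x : Coord} (hx : x ∈ U) (c : Fin 4) :
    pdMat c g x = (coordConn E Γ c x).transpose * g x + g x * coordConn E Γ c x := by
  have hE := F.smooth_E.differentiableAt F.isOpen hx
  have hh := F.smooth_h.differentiableAt F.isOpen hx
  have h1 : g =ᶠ[nhds x] fun y => ((E y).transpose * h y) * E y :=
    Filter.eventually_of_mem (F.isOpen.mem_nhds hx) F.metric_eq
  have hC := F.mul_coordConn hx c
  have hC' := congrArg Matrix.transpose hC
  rw [Matrix.transpose_mul] at hC'
  have hEh : SmoothOn (fun y => (E y).transpose * h y) U :=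
    SmoothOn.mul (fun i j => F.smooth_E j i) F.smooth_h
  rw [pdMat_congr h1, pdMat_mul (hEh.differentiableAt F.isOpen hx) hE,
    pdMat_mul (M := fun y => (E y).transpose) (fun i j => hE j i) hh, pdMat_transpose,
    F.compat x hx c, F.metric_eq x hx]
  have e1 : (coordConn E Γ c x).transpose * ((E x).transpose * h x * E x)
      = ((coordConn E Γ c x).transpose * (E x).transpose) * (h x * E x) := by
    simp only [Matrix.mul_assoc]
  have e2 : (E x).transpose * h x * E x * coordConn E Γ c x
      = (E x).transpose * h x * (E x * coordConn E Γ c x) := by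
    simp only [Matrix.mul_assoc]
  rw [e1, e2, hC, hC', Matrix.transpose_add, Matrix.transpose_mul]
  noncomm_ring

/-- The Levi-Civita connection is the only metric and torsion-free connection. -/
theorem christoffel_eq (F : MovingFrame U g E h Γ) {x : Coord} (hx : x ∈ U) (a b c : Fin 4) :
    christoffel g a b c x = coordConn E Γ b x a c := by
  have hpd : ∀ i j k, pd i (fun y => g y j k) x
      = ∑ e, coordConn E Γ i x e j * g x e k + ∑ e, g x j e * coordConn E Γ i x e k := by
    intro i j k
    have := congrFun (congrFun (F.pdMat_metric hx i) j) k
    simpa [pdMat, Matrix.mul_apply] using this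
  have hs : ∀ i j, g x i j = g x j i := fun i j => congrFun (congrFun (F.symm_g hx) j) i
  have hsum : ∀ d, pd b (fun y => g y d c) x + pd c (fun y => g y d b) x
      - pd d (fun y => g y b c) x = 2 * (g x * coordConn E Γ b x) d c := by
    intro d
    have e1 : ∑ e, coordConn E Γ d x e b * g x e c = ∑ e, coordConn E Γ b x e d * g x e c :=
      Finset.sum_congr rfl fun e _ => by rw [F.coordConn_symm hx]
    have e2 : ∑ e, g x b e * coordConn E Γ d x e c = ∑ e, coordConn E Γ c x e d * g x e b :=
      Finset.sum_congr rfl fun e _ => by rw [F.coordConn_symm hx e d c, hs, mul_comm]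
    have e3 : ∑ e, g x d e * coordConn E Γ c x e b = ∑ e, g x d e * coordConn E Γ b x e c :=
      Finset.sum_congr rfl fun e _ => by rw [F.coordConn_symm hx e c b]
    rw [hpd, hpd, hpd, e1, e2, e3, Matrix.mul_apply]
    ring
  have hmul : (g x)⁻¹ * (g x * coordConn E Γ b x) = coordConn E Γ b x :=
    Matrix.nonsing_inv_mul_cancel_left _ _ (F.det_g hx).isUnit
  have hac := congrFun (congrFun hmul a) c
  rw [Matrix.mul_apply] at hac
  simp only [christoffel, hsum, ← hac, Finset.mul_sum]
  exact Finset.sum_congr rfl fun d _ => by ring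

/-- Cartan's second structure equation: the curvature of the metric is the curvature of the
connection forms of any moving frame. -/
theorem mul_riemannUp (F : MovingFrame U g E h Γ) {x : Coord} (hx : x ∈ U) (c d : Fin 4) :
    E x * Matrix.of (fun a b => riemannUp g x a b c d) = curvForm Γ c d x * E x := by
  set C := coordConn E Γ with hCdef
  have hR : Matrix.of (fun a b => riemannUp g x a b c d)
      = pdMat c (C d) x - pdMat d (C c) x + C c x * C d x - C d x * C c x := by
    have hp : ∀ i a b e, pd i (christoffel g a b e) x = pd i (fun y => C e y a b) x := by
      intro i a b e
      refine pd_congr (Filter.eventually_of_mem (F.isOpen.mem_nhds hx) fun y hy => ?_) i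
      rw [F.christoffel_eq hy, F.coordConn_symm hy]
    have hc : ∀ a b e, christoffel g a b e x = C b x a e := fun a b e => F.christoffel_eq hx a b e
    have hc' : ∀ a b e, christoffel g a b e x = C e x a b := fun a b e => by
      rw [hc, hCdef, F.coordConn_symm hx]
    ext a b
    simp only [Matrix.of_apply, riemannUp, Matrix.sub_apply, Matrix.add_apply, Matrix.mul_apply,
      pdMat, hp, Finset.sum_sub_distrib]
    have hs : ∀ i j, ∑ e, christoffel g a i e x * christoffel g e b j x
        = ∑ e, C i x a e * C j x e b := fun i j =>
      Finset.sum_congr rfl fun e _ => by rw [hc a i e, hc' e b j]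
    rw [hs, hs]
    ring
  have hE := F.smooth_E.differentiableAt F.isOpen hx
  -- The derivative of `E C_j = ∂_j E + Γ_j E`; the second derivatives of `E` cancel when
  -- the curvature is antisymmetrized.
  have hdiff : ∀ i j, pdMat i E x * C j x + E x * pdMat i (C j) x
      = pdMat i (pdMat j E) x + (pdMat i (Γ j) x * E x + Γ j x * pdMat i E x) := by
    intro i j
    have hCj := (F.smooth_coordConn j).differentiableAt F.isOpen hx
    have hconnj := (F.smooth_conn j).differentiableAt F.isOpen hx
    have hev : (fun y => E y * C j y) =ᶠ[nhds x] fun y => pdMat j E y + Γ j y * E y :=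
      Filter.eventually_of_mem (F.isOpen.mem_nhds hx) fun y hy => F.mul_coordConn hy j
    rw [← pdMat_mul hE hCj, pdMat_congr hev, pdMat_add
      ((F.smooth_E.pdMat F.isOpen j).differentiableAt F.isOpen hx)
      (((F.smooth_conn j).mul F.smooth_E).differentiableAt F.isOpen hx), pdMat_mul hconnj hE]
  have hcd := hdiff c d
  have hdc := hdiff d c
  rw [pdMat_comm F.isOpen F.smooth_E hx d c] at hdc
  have hc := F.mul_coordConn hx c
  have hd := F.mul_coordConn hx d
  rw [← hCdef] at hc hd
  have h1 : E x * pdMat c (C d) x = pdMat c (pdMat d E) x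
      + (pdMat c (Γ d) x * E x + Γ d x * pdMat c E x) - pdMat c E x * C d x := by
    rw [← hcd]; abel
  have h2 : E x * pdMat d (C c) x = pdMat c (pdMat d E) x
      + (pdMat d (Γ c) x * E x + Γ c x * pdMat d E x) - pdMat d E x * C c x := by
    rw [← hdc]; abel
  have h3 : E x * (C c x * C d x) = pdMat c E x * C d x
      + Γ c x * (pdMat d E x + Γ d x * E x) := by
    rw [← Matrix.mul_assoc, hc, Matrix.add_mul, Matrix.mul_assoc, hd]
  have h4 : E x * (C d x * C c x) = pdMat d E x * C c x
      + Γ d x * (pdMat c E x + Γ c x * E x) := by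
    rw [← Matrix.mul_assoc, hd, Matrix.add_mul, Matrix.mul_assoc, hc]
  rw [hR, Matrix.mul_sub, Matrix.mul_add, Matrix.mul_sub, h1, h2, h3, h4, curvForm]
  noncomm_ring

theorem riemann_eq (F : MovingFrame U g E h Γ) {x : Coord} (hx : x ∈ U) (a b c d : Fin 4) :
    riemann g x a b c d = ((E x).transpose * (h x * curvForm Γ c d x) * E x) a b := by
  have h1 : riemann g x a b c d = (g x * Matrix.of (fun a b => riemannUp g x a b c d)) a b := by
    simp [riemann, Matrix.mul_apply]
  rw [h1, F.metric_eq x hx, Matrix.mul_assoc, F.mul_riemannUp hx c d]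
  simp only [Matrix.mul_assoc]

end MovingFrame

/-! ### Change of coordinates -/

theorem jacobian_apply {φ : Coord → Coord} {x : Coord} (hφ : DifferentiableAt ℝ φ x)
    (i j : Fin 4) : jacobian φ x i j = pd j (fun y => φ y i) x := by
  have : HasFDerivAt (fun y => φ y i) _ x := hasFDerivAt_pi'.1 hφ.hasFDerivAt i
  unfold pd
  rw [this.fderiv]
  rfl

theorem pd_comp {φ : Coord → Coord} {f : Coord → ℝ} {x : Coord}
    (hf : DifferentiableAt ℝ f (φ x)) (hφ : DifferentiableAt ℝ φ x) (c : Fin 4) :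
    pd c (fun y => f (φ y)) x = ∑ k, jacobian φ x k c * pd k f (φ x) := by
  have h : fderiv ℝ (fun y => f (φ y)) x = (fderiv ℝ f (φ x)).comp (fderiv ℝ φ x) :=
    fderiv_comp x hf hφ
  unfold pd
  rw [h, ContinuousLinearMap.comp_apply]
  conv_lhs => rw [pi_eq_sum_univ' (fderiv ℝ φ x (Pi.single c 1))]
  rw [map_sum]
  refine Finset.sum_congr rfl fun k _ => ?_
  rw [map_smul, smul_eq_mul]
  rfl

theorem pdMat_comp {φ : Coord → Coord} {M : MetricField} {x : Coord}
    (hM : ∀ i j, DifferentiableAt ℝ (fun y => M y i j) (φ x)) (hφ : DifferentiableAt ℝ φ x)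
    (c : Fin 4) :
    pdMat c (fun y => M (φ y)) x = ∑ k, jacobian φ x k c • pdMat k M (φ x) := by
  ext i j
  simp only [pdMat, Matrix.of_apply, Matrix.sum_apply, Matrix.smul_apply, smul_eq_mul]
  exact pd_comp (hM i j) hφ c

section Pullback

variable {U V : Set Coord} {φ : Coord → Coord}

theorem smoothOn_jacobian (hU : IsOpen U) (hφ : ContDiffOn ℝ ∞ φ U) :
    SmoothOn (jacobian φ) U := by
  intro i j
  refine (contDiffOn_pd hU (contDiffOn_pi.1 hφ i) j).congr fun x hx => ?_
  exact jacobian_apply ((hφ.differentiableOn (by simp)).differentiableAt (hU.mem_nhds hx)) i j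

theorem SmoothOn.comp {M : MetricField} (hM : SmoothOn M V) (hφ : ContDiffOn ℝ ∞ φ U)
    (hmaps : Set.MapsTo φ U V) : SmoothOn (fun x => M (φ x)) U :=
  fun i j => (hM i j).comp hφ hmaps

/-- The Jacobian matrix is closed: the Hessian of each component of `φ` is symmetric. -/
theorem pd_jacobian_comm (hU : IsOpen U) (hφ : ContDiffOn ℝ ∞ φ U) {x : Coord} (hx : x ∈ U)
    (i b c : Fin 4) :
    pd b (fun y => jacobian φ y i c) x = pd c (fun y => jacobian φ y i b) x := by
  have h : ∀ j, (fun y => jacobian φ y i j) =ᶠ[nhds x] pd j (fun y => φ y i) := fun j =>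
    Filter.eventually_of_mem (hU.mem_nhds hx) fun y hy =>
      jacobian_apply ((hφ.differentiableOn (by simp)).differentiableAt (hU.mem_nhds hy)) i j
  rw [pd_congr (h c), pd_congr (h b), pd_comm hU (contDiffOn_pi.1 hφ i) hx]

/-- Pull-back of connection forms. -/
def pullConn (φ : Coord → Coord) (Γ : Fin 4 → MetricField) (c : Fin 4) : MetricField :=
  fun x => ∑ k, jacobian φ x k c • Γ k (φ x)

theorem smoothOn_pullConn {Γ : Fin 4 → MetricField} (hU : IsOpen U) (hφ : ContDiffOn ℝ ∞ φ U)
    (hmaps : Set.MapsTo φ U V) (hΓ : ∀ c, SmoothOn (Γ c) V) (c : Fin 4) :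
    SmoothOn (pullConn φ Γ c) U := by
  intro i j
  simp only [pullConn, Matrix.sum_apply, Matrix.smul_apply, smul_eq_mul]
  exact ContDiffOn.sum fun k _ => (smoothOn_jacobian hU hφ k c).mul ((hΓ k).comp hφ hmaps i j)

/-- Moving frames and their Levi-Civita connection forms pull back under local diffeomorphisms. -/
theorem MovingFrame.pullback {g E h : MetricField} {Γ : Fin 4 → MetricField}
    (F : MovingFrame V g E h Γ) (hU : IsOpen U) (hφ : ContDiffOn ℝ ∞ φ U)
    (hdet : ∀ x ∈ U, (jacobian φ x).det ≠ 0) (hmaps : Set.MapsTo φ U V) {g' : MetricField}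
    (hg' : ∀ x ∈ U, g' x = (jacobian φ x).transpose * g (φ x) * jacobian φ x) :
    MovingFrame U g' (fun x => E (φ x) * jacobian φ x) (fun x => h (φ x)) (pullConn φ Γ) where
  isOpen := hU
  smooth_E := (F.smooth_E.comp hφ hmaps).mul (smoothOn_jacobian hU hφ)
  smooth_h := F.smooth_h.comp hφ hmaps
  smooth_conn := smoothOn_pullConn hU hφ hmaps F.smooth_conn
  det_E x hx := by
    rw [Matrix.det_mul]
    exact mul_ne_zero (F.det_E _ (hmaps hx)) (hdet x hx)
  det_h x hx := F.det_h _ (hmaps hx)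
  symm_h x hx := F.symm_h _ (hmaps hx)
  metric_eq x hx := by
    rw [hg' x hx, F.metric_eq _ (hmaps hx), Matrix.transpose_mul]
    simp only [Matrix.mul_assoc]
  compat x hx c := by
    have hφx := (hφ.differentiableOn (by simp)).differentiableAt (hU.mem_nhds hx)
    rw [pdMat_comp (F.smooth_h.differentiableAt F.isOpen (hmaps hx)) hφx]
    simp only [F.compat _ (hmaps hx), pullConn, Matrix.transpose_sum, Matrix.transpose_smul,
      Finset.mul_sum, Finset.sum_mul, Matrix.mul_smul, Matrix.smul_mul, smul_add,
      Finset.sum_add_distrib]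
  torsion x hx b c i := by
    have hφx := (hφ.differentiableOn (by simp)).differentiableAt (hU.mem_nhds hx)
    have hE := F.smooth_E.differentiableAt F.isOpen (hmaps hx)
    have hJ := (smoothOn_jacobian hU hφ).differentiableAt hU hx
    have key : ∀ b c, (pdMat b (fun x => E (φ x) * jacobian φ x) x
          + pullConn φ Γ b x * (E (φ x) * jacobian φ x)) i c
        = ∑ k, ∑ l, jacobian φ x k b * ((pdMat k E (φ x) + Γ k (φ x) * E (φ x)) i l
            * jacobian φ x l c)
          + ∑ l, E (φ x) i l * pd b (fun y => jacobian φ y l c) x := by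
      intro b c
      rw [pdMat_mul ((F.smooth_E.comp hφ hmaps).differentiableAt hU hx) hJ, pdMat_comp hE hφx,
        add_right_comm, ← Matrix.mul_assoc, ← Matrix.add_mul, pullConn, Finset.sum_mul,
        ← Finset.sum_add_distrib]
      simp only [Matrix.smul_mul, ← smul_add, Finset.sum_mul]
      rw [Matrix.add_apply, Matrix.sum_apply]
      refine congrArg₂ (· + ·) (Finset.sum_congr rfl fun k _ => ?_) ?_
      · rw [Matrix.smul_apply, Matrix.mul_apply, smul_eq_mul, Finset.mul_sum]
      · rw [Matrix.mul_apply]; rfl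
    rw [key, key, Finset.sum_comm]
    refine congrArg₂ (· + ·) (Finset.sum_congr rfl fun k _ => Finset.sum_congr rfl fun l _ => ?_)
      (Finset.sum_congr rfl fun l _ => ?_)
    · rw [F.torsion _ (hmaps hx) l k i]; ring
    · rw [pd_jacobian_comm hU hφ hx]

/-- The curvature form of the pulled-back connection is the pull-back of the curvature form. -/
theorem curvForm_pullConn {Γ : Fin 4 → MetricField} (hU : IsOpen U) (hV : IsOpen V)
    (hφ : ContDiffOn ℝ ∞ φ U) (hmaps : Set.MapsTo φ U V) (hΓ : ∀ c, SmoothOn (Γ c) V)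
    {x : Coord} (hx : x ∈ U) (c d : Fin 4) :
    curvForm (pullConn φ Γ) c d x
      = ∑ k, ∑ l, (jacobian φ x k c * jacobian φ x l d) • curvForm Γ k l (φ x) := by
  have hφx := (hφ.differentiableOn (by simp)).differentiableAt (hU.mem_nhds hx)
  have hJ := (smoothOn_jacobian hU hφ).differentiableAt hU hx
  have hpd : ∀ c d, pdMat c (pullConn φ Γ d) x
      = ∑ l, pd c (fun y => jacobian φ y l d) x • Γ l (φ x)
        + ∑ k, ∑ l, (jacobian φ x k c * jacobian φ x l d) • pdMat k (Γ l) (φ x) := by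
    intro c d
    ext i j
    have hterm : ∀ l : Fin 4, pd c (fun y => jacobian φ y l d * Γ l (φ y) i j) x
        = pd c (fun y => jacobian φ y l d) x * Γ l (φ x) i j
          + ∑ k, jacobian φ x k c * jacobian φ x l d * pd k (fun y => Γ l y i j) (φ x) := by
      intro l
      rw [pd_mul (hJ l d) (((hΓ l).comp hφ hmaps).differentiableAt hU hx i j),
        pd_comp ((hΓ l).differentiableAt hV (hmaps hx) i j) hφx, Finset.mul_sum]
      congr 1
      exact Finset.sum_congr rfl fun k _ => by ring
    simp only [pdMat, pullConn, Matrix.of_apply, Matrix.add_apply, Matrix.sum_apply,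
      Matrix.smul_apply, smul_eq_mul]
    rw [pd_sum (f := fun l y => jacobian φ y l d * Γ l (φ y) i j) fun l _ =>
      (hJ l d).mul (((hΓ l).comp hφ hmaps).differentiableAt hU hx i j),
      Finset.sum_congr rfl fun l _ => hterm l, Finset.sum_add_distrib,
      Finset.sum_comm (s := Finset.univ) (t := Finset.univ) (f := fun l k =>
        jacobian φ x k c * jacobian φ x l d * pd k (fun y => Γ l y i j) (φ x))]
  have hmul : ∀ c d, pullConn φ Γ c x * pullConn φ Γ d x
      = ∑ k, ∑ l, (jacobian φ x k c * jacobian φ x l d) • (Γ k (φ x) * Γ l (φ x)) := by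
    intro c d
    simp only [pullConn, Finset.sum_mul_sum, smul_mul_smul_comm]
  have hswap : ∀ (f : Fin 4 → Fin 4 → Matrix (Fin 4) (Fin 4) ℝ),
      ∑ k, ∑ l, (jacobian φ x k d * jacobian φ x l c) • f k l
        = ∑ k, ∑ l, (jacobian φ x k c * jacobian φ x l d) • f l k := by
    intro f
    rw [Finset.sum_comm]
    exact Finset.sum_congr rfl fun k _ => Finset.sum_congr rfl fun l _ => by rw [mul_comm]
  rw [curvForm, hpd, hpd, hmul, hmul, hswap, hswap]
  simp only [pd_jacobian_comm hU hφ hx _ d c, curvForm, smul_sub, smul_add,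
    Finset.sum_sub_distrib, Finset.sum_add_distrib]
  abel

end Pullback

/-! ### The Carter coframe of the Kerr metric -/

/-- `1 / (r² + a² y²)`, as a function of the coordinates `(t, r, y, φ)`, `y = cos θ`. -/
def invS (a : ℝ) (q : Coord) : ℝ := (q 1 ^ 2 + a ^ 2 * q 2 ^ 2)⁻¹

/-- `1 / (r² - 2 m r + a²)`. -/
def invDelta (m a : ℝ) (q : Coord) : ℝ := (q 1 ^ 2 - 2 * m * q 1 + a ^ 2)⁻¹

/-- `1 / (1 - y²)`. -/
def invY (q : Coord) : ℝ := (1 - q 2 ^ 2)⁻¹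

/-- The domain of the coordinates `(t, r, y, φ)`, `y = cos θ`. -/
def kerrDomain (m a : ℝ) : Set Coord :=
  {q | q 1 ^ 2 + a ^ 2 * q 2 ^ 2 ≠ 0 ∧ q 1 ^ 2 - 2 * m * q 1 + a ^ 2 ≠ 0 ∧ 1 - q 2 ^ 2 ≠ 0}

/-- The Carter coframe in the coordinates `(t, r, y, φ)`. It is not normalized: this keeps its
components rational, whatever the sign of `r² - 2 m r + a²`. -/
def kerrE (m a : ℝ) : MetricField := fun q =>
  !![1, 0, 0, -(a * (1 - q 2 ^ 2));
     0, (q 1 ^ 2 + a ^ 2 * q 2 ^ 2) * invDelta m a q, 0, 0;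
     0, 0, (q 1 ^ 2 + a ^ 2 * q 2 ^ 2) * invY q, 0;
     -a, 0, 0, q 1 ^ 2 + a ^ 2]

/-- The square norm `p = Δ / S` of the vector dual to `e¹`, and minus that of the vector dual to
`e⁰`. -/
def kerrP (m a : ℝ) (q : Coord) : ℝ := (q 1 ^ 2 - 2 * m * q 1 + a ^ 2) * invS a q

/-- The common square norm `q = (1 - y²) / S` of the vectors dual to `e²` and `e³`. -/
def kerrQ (a : ℝ) (q : Coord) : ℝ := (1 - q 2 ^ 2) * invS a q

/-- The components `diag (-p, p, q, q)` of the Kerr metric in the Carter coframe. -/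
def kerrH (m a : ℝ) : MetricField := fun q =>
  !![-((q 1 ^ 2 - 2 * m * q 1 + a ^ 2) * invS a q), 0, 0, 0;
     0, (q 1 ^ 2 - 2 * m * q 1 + a ^ 2) * invS a q, 0, 0;
     0, 0, (1 - q 2 ^ 2) * invS a q, 0;
     0, 0, 0, (1 - q 2 ^ 2) * invS a q]

/-- The Levi-Civita connection forms of the Carter coframe in the direction `∂_t`. -/
def kerrConnT (m a : ℝ) : MetricField := fun q =>
  !![0, m * (q 1 ^ 2 - a ^ 2 * q 2 ^ 2) * invS a q ^ 2, 0, 0;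
     m * (q 1 ^ 2 - a ^ 2 * q 2 ^ 2) * invS a q ^ 2, 0, 0, 0;
     0, 0, 0, -(2 * m * a * q 1 * q 2 * invS a q ^ 2);
     0, 0, 2 * m * a * q 1 * q 2 * invS a q ^ 2, 0]

/-- The Levi-Civita connection forms of the Carter coframe in the direction `∂_r`. -/
def kerrConnR (m a : ℝ) : MetricField := fun q =>
  !![(q 1 - m) * invDelta m a q - q 1 * invS a q, 0, 0,
      -(a * q 1 * (1 - q 2 ^ 2) * invS a q * invDelta m a q);
     0, (q 1 - m) * invDelta m a q - q 1 * invS a q,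
      a ^ 2 * q 2 * (1 - q 2 ^ 2) * invS a q * invDelta m a q, 0;
     0, -(a ^ 2 * q 2 * invS a q), -(q 1 * invS a q), 0;
     -(a * q 1 * invS a q), 0, 0, -(q 1 * invS a q)]

/-- The Levi-Civita connection forms of the Carter coframe in the direction `∂_y`. -/
def kerrConnY (m a : ℝ) : MetricField := fun q =>
  !![-(a ^ 2 * q 2 * invS a q), 0, 0, -(a * q 2 * invS a q);
     0, -(a ^ 2 * q 2 * invS a q), -(q 1 * invS a q), 0;
     0, q 1 * (q 1 ^ 2 - 2 * m * q 1 + a ^ 2) * invS a q * invY q,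
      -(q 2 * invY q) - a ^ 2 * q 2 * invS a q, 0;
     -(a * q 2 * (q 1 ^ 2 - 2 * m * q 1 + a ^ 2) * invS a q * invY q), 0, 0,
      -(q 2 * invY q) - a ^ 2 * q 2 * invS a q]

/-- The Levi-Civita connection forms of the Carter coframe in the direction `∂_φ`. -/
def kerrConnPhi (m a : ℝ) : MetricField := fun q =>
  !![0, -(a * (1 - q 2 ^ 2) * ((q 1 - m) * invS a q + 2 * m * q 1 ^ 2 * invS a q ^ 2)),
      a * q 2 * (1 - q 2 ^ 2) * invS a q, 0;
     -(a * (1 - q 2 ^ 2) * ((q 1 - m) * invS a q + 2 * m * q 1 ^ 2 * invS a q ^ 2)), 0, 0,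
      -(q 1 * (1 - q 2 ^ 2) * invS a q);
     a * q 2 * (q 1 ^ 2 - 2 * m * q 1 + a ^ 2) * invS a q, 0, 0,
      q 2 * (q 1 ^ 2 + a ^ 2) * invS a q
        + 2 * m * a ^ 2 * q 1 * q 2 * (1 - q 2 ^ 2) * invS a q ^ 2;
     0, q 1 * (q 1 ^ 2 - 2 * m * q 1 + a ^ 2) * invS a q,
      -(q 2 * (q 1 ^ 2 + a ^ 2) * invS a q
        + 2 * m * a ^ 2 * q 1 * q 2 * (1 - q 2 ^ 2) * invS a q ^ 2), 0]

/-- The Levi-Civita connection forms of the Carter coframe. -/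
def kerrConn (m a : ℝ) : Fin 4 → MetricField :=
  ![kerrConnT m a, kerrConnR m a, kerrConnY m a, kerrConnPhi m a]

variable {m a : ℝ}

theorem isOpen_kerrDomain : IsOpen (kerrDomain m a) := by
  refine (isOpen_ne_fun (by fun_prop) (by fun_prop)).inter
    ((isOpen_ne_fun (by fun_prop) (by fun_prop)).inter (isOpen_ne_fun (by fun_prop) (by fun_prop)))

/-- The function `f` of `(t, r, y, φ)` is smooth on `D`, depends only on `r` and `y` there, and its
partial derivatives with respect to `r` and `y` are `fr` and `fy`. -/
structure HasPD (D : Set Coord) (f fr fy : Coord → ℝ) : Prop where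
  smooth : ContDiffOn ℝ ∞ f D
  isOpen : IsOpen D
  pd : ∀ q ∈ D, ∀ c, pd c f q = ![0, fr q, fy q, 0] c

namespace HasPD

variable {D : Set Coord} {f fr fy g gr gy : Coord → ℝ}

theorem differentiableAt (hf : HasPD D f fr fy) {q : Coord} (hq : q ∈ D) :
    DifferentiableAt ℝ f q :=
  (hf.smooth.differentiableOn (by simp)).differentiableAt (hf.isOpen.mem_nhds hq)

theorem const (hD : IsOpen D) (k : ℝ) : HasPD D (fun _ => k) (fun _ => 0) (fun _ => 0) where
  smooth := contDiffOn_const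
  isOpen := hD
  pd q _ c := by fin_cases c <;> simp [WeylKerr.pd]

theorem coord_r (hD : IsOpen D) : HasPD D (fun q => q 1) (fun _ => 1) (fun _ => 0) where
  smooth := by fun_prop
  isOpen := hD
  pd q _ c := by
    have : HasFDerivAt (fun q : Coord => q 1) (ContinuousLinearMap.proj (R := ℝ) 1) q :=
      hasFDerivAt_apply 1 q
    unfold WeylKerr.pd
    rw [this.fderiv]
    fin_cases c <;> simp

theorem coord_y (hD : IsOpen D) : HasPD D (fun q => q 2) (fun _ => 0) (fun _ => 1) where
  smooth := by fun_prop
  isOpen := hD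
  pd q _ c := by
    have : HasFDerivAt (fun q : Coord => q 2) (ContinuousLinearMap.proj (R := ℝ) 2) q :=
      hasFDerivAt_apply 2 q
    unfold WeylKerr.pd
    rw [this.fderiv]
    fin_cases c <;> simp

theorem add (hf : HasPD D f fr fy) (hg : HasPD D g gr gy) :
    HasPD D (fun q => f q + g q) (fun q => fr q + gr q) (fun q => fy q + gy q) where
  smooth := hf.smooth.add hg.smooth
  isOpen := hf.isOpen
  pd q hq c := by
    rw [pd_add (hf.differentiableAt hq) (hg.differentiableAt hq), hf.pd q hq, hg.pd q hq]
    fin_cases c <;> simp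

theorem mul (hf : HasPD D f fr fy) (hg : HasPD D g gr gy) :
    HasPD D (fun q => f q * g q) (fun q => fr q * g q + f q * gr q)
      (fun q => fy q * g q + f q * gy q) where
  smooth := hf.smooth.mul hg.smooth
  isOpen := hf.isOpen
  pd q hq c := by
    rw [pd_mul (hf.differentiableAt hq) (hg.differentiableAt hq), hf.pd q hq, hg.pd q hq]
    fin_cases c <;> simp

theorem neg (hf : HasPD D f fr fy) : HasPD D (fun q => -f q) (fun q => -fr q) (fun q => -fy q) := by
  simpa using (const hf.isOpen (-1)).mul hf

theorem sub (hf : HasPD D f fr fy) (hg : HasPD D g gr gy) :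
    HasPD D (fun q => f q - g q) (fun q => fr q - gr q) (fun q => fy q - gy q) := by
  simpa only [sub_eq_add_neg] using hf.add hg.neg

theorem sq (hf : HasPD D f fr fy) :
    HasPD D (fun q => f q ^ 2) (fun q => 2 * f q * fr q) (fun q => 2 * f q * fy q) := by
  have h := hf.mul hf
  simp only [← _root_.sq, mul_comm (fr _) (f _), mul_comm (fy _) (f _), ← two_mul,
    ← mul_assoc] at h
  exact h

theorem inv (hf : HasPD D f fr fy) (h0 : ∀ q ∈ D, f q ≠ 0) :
    HasPD D (fun q => (f q)⁻¹) (fun q => -(fr q * (f q)⁻¹ ^ 2))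
      (fun q => -(fy q * (f q)⁻¹ ^ 2)) where
  smooth := hf.smooth.inv h0
  isOpen := hf.isOpen
  pd q hq c := by
    have hd : fderiv ℝ (fun q => (f q)⁻¹) q = _ :=
      ((hasDerivAt_inv (h0 q hq)).comp_hasFDerivAt q (hf.differentiableAt hq).hasFDerivAt).fderiv
    have h1 : WeylKerr.pd c (fun q => (f q)⁻¹) q = -((f q)⁻¹ ^ 2 * WeylKerr.pd c f q) := by
      unfold WeylKerr.pd
      rw [hd]
      simp
    rw [h1, hf.pd q hq]
    fin_cases c <;> simp [mul_comm]

/-! The following three lemmas are for goals in which `f` and `g` are explicit expressions: a proof of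
`HasPD` found by the combinators above determines the partial derivatives by unification, and it
remains to prove an algebraic identity. -/

theorem add_eq_add (hf : HasPD D f fr fy) (hg : HasPD D g gr gy) {q : Coord} (hq : q ∈ D)
    {c d : Fin 4} {x y : ℝ}
    (h : ![0, fr q, fy q, 0] c + x = ![0, gr q, gy q, 0] d + y) :
    WeylKerr.pd c f q + x = WeylKerr.pd d g q + y := by
  rw [hf.pd q hq, hg.pd q hq, h]

theorem pd_eq (hf : HasPD D f fr fy) {q : Coord} (hq : q ∈ D) {c : Fin 4} {y : ℝ}
    (h : ![0, fr q, fy q, 0] c = y) : WeylKerr.pd c f q = y := by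
  rw [hf.pd q hq, h]

theorem curv_eq (hf : HasPD D f fr fy) (hg : HasPD D g gr gy) {q : Coord} (hq : q ∈ D)
    {c d : Fin 4} {w x y z : ℝ}
    (h : w * (![0, fr q, fy q, 0] c - ![0, gr q, gy q, 0] d + x - y) = z) :
    w * (WeylKerr.pd c f q - WeylKerr.pd d g q + x - y) = z := by
  rw [hf.pd q hq, hg.pd q hq, h]

end HasPD

theorem hasPD_invS : HasPD (kerrDomain m a) (invS a) (fun q => -(2 * q 1 * invS a q ^ 2))
    (fun q => -(2 * a ^ 2 * q 2 * invS a q ^ 2)) := by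
  have hD := isOpen_kerrDomain (m := m) (a := a)
  have h := (((HasPD.coord_r hD).sq.add
    ((HasPD.const hD (a ^ 2)).mul (HasPD.coord_y hD).sq))).inv fun q hq => hq.1
  convert h using 2 <;> simp only [invS] <;> ring

theorem hasPD_invDelta : HasPD (kerrDomain m a) (invDelta m a)
    (fun q => -(2 * (q 1 - m) * invDelta m a q ^ 2)) (fun _ => 0) := by
  have hD := isOpen_kerrDomain (m := m) (a := a)
  have h := (((HasPD.coord_r hD).sq.sub
    ((HasPD.const hD (2 * m)).mul (HasPD.coord_r hD))).add (HasPD.const hD (a ^ 2))).inv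
      fun q hq => hq.2.1
  convert h using 2 <;> first | rfl | (simp only [invDelta]; ring) | ring

theorem hasPD_invY : HasPD (kerrDomain m a) invY (fun _ => 0)
    (fun q => 2 * q 2 * invY q ^ 2) := by
  have hD := isOpen_kerrDomain (m := m) (a := a)
  have h := ((HasPD.const hD 1).sub (HasPD.coord_y hD).sq).inv fun q hq => hq.2.2
  convert h using 2 <;> first | rfl | (simp only [invY]; ring) | ring

theorem smoothOn_kerrE : SmoothOn (kerrE m a) (kerrDomain m a) := by
  have hD := isOpen_kerrDomain (m := m) (a := a)
  intro i j
  fin_cases i <;> fin_cases j <;> simp only [kerrE, Fin.zero_eta, Fin.mk_one, Fin.reduceFinMk,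
    Matrix.of_apply, Matrix.cons_val] <;>
  exact HasPD.smooth (by
    repeat' first
      | exact .const hD _ | exact .coord_r hD | exact .coord_y hD | exact hasPD_invS
      | exact hasPD_invDelta | exact hasPD_invY | apply HasPD.neg | apply HasPD.sub
      | apply HasPD.add | apply HasPD.sq | apply HasPD.mul)

theorem smoothOn_kerrH : SmoothOn (kerrH m a) (kerrDomain m a) := by
  have hD := isOpen_kerrDomain (m := m) (a := a)
  intro i j
  fin_cases i <;> fin_cases j <;> simp only [kerrH, Fin.zero_eta, Fin.mk_one, Fin.reduceFinMk,
    Matrix.of_apply, Matrix.cons_val] <;>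
  exact HasPD.smooth (by
    repeat' first
      | exact .const hD _ | exact .coord_r hD | exact .coord_y hD | exact hasPD_invS
      | exact hasPD_invDelta | exact hasPD_invY | apply HasPD.neg | apply HasPD.sub
      | apply HasPD.add | apply HasPD.sq | apply HasPD.mul)

theorem smoothOn_kerrConn (c : Fin 4) : SmoothOn (kerrConn m a c) (kerrDomain m a) := by
  have hD := isOpen_kerrDomain (m := m) (a := a)
  intro i j
  fin_cases c <;> fin_cases i <;> fin_cases j <;>
  simp only [kerrConn, kerrConnT, kerrConnR, kerrConnY, kerrConnPhi, Fin.zero_eta, Fin.mk_one,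
    Fin.reduceFinMk, Matrix.of_apply, Matrix.cons_val] <;>
  exact HasPD.smooth (by
    repeat' first
      | exact .const hD _ | exact .coord_r hD | exact .coord_y hD | exact hasPD_invS
      | exact hasPD_invDelta | exact hasPD_invY | apply HasPD.neg | apply HasPD.sub
      | apply HasPD.add | apply HasPD.sq | apply HasPD.mul)

/-- Names a denominator, so that `field_simp` treats it as an atom and does not expand it; the
equation `t = s` is used afterwards. -/
theorem exists_eq_inv {s : ℝ} (hs : s ≠ 0) : ∃ t : ℝ, t ≠ 0 ∧ t = s ∧ s⁻¹ = t⁻¹ :=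
  ⟨s, hs, rfl, rfl⟩

/-- The connection forms `kerrConn` are metric. -/
theorem kerr_compat {q : Coord} (hq : q ∈ kerrDomain m a) (c : Fin 4) :
    pdMat c (kerrH m a) q
      = kerrH m a q * kerrConn m a c q + (kerrConn m a c q).transpose * kerrH m a q := by
  have hD := isOpen_kerrDomain (m := m) (a := a)
  obtain ⟨S, hS, hS', invS_eq⟩ := exists_eq_inv hq.1
  obtain ⟨Δ, hΔ, hΔ', invDelta_eq⟩ := exists_eq_inv hq.2.1
  obtain ⟨Y, hY, hY', invY_eq⟩ := exists_eq_inv hq.2.2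
  change invS a q = S⁻¹ at invS_eq
  change invDelta m a q = Δ⁻¹ at invDelta_eq
  change invY q = Y⁻¹ at invY_eq
  ext i j
  fin_cases i <;> fin_cases j <;> simp only [pdMat, kerrH, Fin.zero_eta, Fin.mk_one,
    Fin.reduceFinMk, Matrix.of_apply, Matrix.cons_val, Matrix.add_apply, Matrix.mul_apply,
    Matrix.transpose_apply, Fin.sum_univ_four, zero_mul, mul_zero, add_zero, zero_add] <;>
  refine HasPD.pd_eq (D := kerrDomain m a) (by
    repeat' first
      | exact .const hD _ | exact .coord_r hD | exact .coord_y hD | exact hasPD_invS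
      | exact hasPD_invDelta | exact hasPD_invY | apply HasPD.neg | apply HasPD.sub
      | apply HasPD.add | apply HasPD.sq | apply HasPD.mul) hq ?_ <;>
  fin_cases c
  all_goals simp only [kerrConn, kerrConnT, kerrConnR, kerrConnY, kerrConnPhi, Fin.zero_eta,
    Fin.mk_one, Fin.reduceFinMk, Matrix.of_apply, Matrix.cons_val, zero_mul, mul_zero, add_zero,
    zero_add, sub_zero, mul_one]
  all_goals simp only [invS_eq, invDelta_eq, invY_eq]
  all_goals try field_simp
  all_goals try simp only [hS', hΔ', hY']
  all_goals try ring

/-- The connection forms `kerrConn` are torsion-free. -/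
theorem kerr_torsion {q : Coord} (hq : q ∈ kerrDomain m a) (b c i : Fin 4) :
    (pdMat b (kerrE m a) q + kerrConn m a b q * kerrE m a q) i c
      = (pdMat c (kerrE m a) q + kerrConn m a c q * kerrE m a q) i b := by
  have hD := isOpen_kerrDomain (m := m) (a := a)
  obtain ⟨S, hS, hS', invS_eq⟩ := exists_eq_inv hq.1
  obtain ⟨Δ, hΔ, hΔ', invDelta_eq⟩ := exists_eq_inv hq.2.1
  obtain ⟨Y, hY, hY', invY_eq⟩ := exists_eq_inv hq.2.2
  change invS a q = S⁻¹ at invS_eq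
  change invDelta m a q = Δ⁻¹ at invDelta_eq
  change invY q = Y⁻¹ at invY_eq
  fin_cases i <;> fin_cases b <;> fin_cases c <;> try rfl
  all_goals simp only [pdMat, kerrE, Fin.zero_eta, Fin.mk_one, Fin.reduceFinMk, Matrix.of_apply,
    Matrix.cons_val, Matrix.add_apply]
  all_goals refine HasPD.add_eq_add (D := kerrDomain m a) (by
    repeat' first
      | exact .const hD _ | exact .coord_r hD | exact .coord_y hD | exact hasPD_invS
      | exact hasPD_invDelta | exact hasPD_invY | apply HasPD.neg | apply HasPD.sub
      | apply HasPD.add | apply HasPD.sq | apply HasPD.mul) (by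
    repeat' first
      | exact .const hD _ | exact .coord_r hD | exact .coord_y hD | exact hasPD_invS
      | exact hasPD_invDelta | exact hasPD_invY | apply HasPD.neg | apply HasPD.sub
      | apply HasPD.add | apply HasPD.sq | apply HasPD.mul) hq ?_
  all_goals simp only [Matrix.mul_apply, Fin.sum_univ_four, kerrConn, kerrConnT, kerrConnR,
    kerrConnY, kerrConnPhi, Matrix.of_apply, Matrix.cons_val, zero_mul, mul_zero, add_zero,
    zero_add, neg_zero, sub_zero, mul_one]
  all_goals simp only [invS_eq, invDelta_eq, invY_eq]
  all_goals field_simp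
  all_goals simp only [hS', hΔ', hY']
  all_goals ring

/-! ### Double 2-forms in a frame -/

/-- The 2-form `e^i ∧ e^j` of the coframe `E`. -/
def twoForm (i j : Fin 4) (E : Matrix (Fin 4) (Fin 4) ℝ) : Matrix (Fin 4) (Fin 4) ℝ :=
  Matrix.of fun a b => E i a * E j b - E i b * E j a

/-- The 2-forms `e⁰ ∧ e¹`, `e⁰ ∧ e²`, `e⁰ ∧ e³`. -/
def uForm (A : Fin 3) (E : Matrix (Fin 4) (Fin 4) ℝ) : Matrix (Fin 4) (Fin 4) ℝ :=
  twoForm 0 (![1, 2, 3] A) E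

/-- The 2-forms `e² ∧ e³`, `e³ ∧ e¹`, `e¹ ∧ e²`, which are the Hodge duals of the forms `uForm` up to
factors. -/
def vForm (A : Fin 3) (E : Matrix (Fin 4) (Fin 4) ℝ) : Matrix (Fin 4) (Fin 4) ℝ :=
  twoForm (![2, 3, 1] A) (![3, 1, 2] A) E

/-- Minus the inverse square norms of the forms `uForm`. -/
def uWeight (p q : ℝ) : Fin 3 → ℝ := ![p ^ 2, p * q, p * q]

/-- The inverse square norms of the forms `vForm`. -/
def vWeight (p q : ℝ) : Fin 3 → ℝ := ![q ^ 2, p * q, p * q]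

/-- The double 2-form which acts on the `A`-th self-dual bivector of the coframe with the complex
eigenvalue `z A`: the real part of `z A` multiplies the metric on the span of `uForm A` and `vForm A`,
and the imaginary part multiplies the Hodge dual. The first pair of indices refers to the coframe `E`
and the second pair to `E'`, so that the two pairs can be transformed independently; the tensor
proper has `E = E'`. -/
def biForm (p q : ℝ) (z : Fin 3 → ℂ) (E E' : Matrix (Fin 4) (Fin 4) ℝ) : Tensor4 :=
  fun a b c d => ∑ A,
    ((z A).re * (vWeight p q A * vForm A E a b * vForm A E' c d
        - uWeight p q A * uForm A E a b * uForm A E' c d)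
      + (z A).im * (p * q) * (uForm A E a b * vForm A E' c d + vForm A E a b * uForm A E' c d))

/-- The Weyl scalar `ψ = -m / (r + i a y)³`; the Weyl tensor of the Kerr metric has the eigenvalues
`-2 ψ`, `ψ`, `ψ`. -/
def kerrPsi (m a : ℝ) (q : Coord) : ℂ := -(m : ℂ) / ((q 1 : ℂ) + (a * q 2 : ℝ) * Complex.I) ^ 3

variable {m a : ℝ}

theorem kerrPsi_eq {q : Coord} (hq : q ∈ kerrDomain m a) : kerrPsi m a q
    = ⟨-(m * (q 1 ^ 3 - 3 * q 1 * (a * q 2) ^ 2) * invS a q ^ 3),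
      m * (3 * q 1 ^ 2 * (a * q 2) - (a * q 2) ^ 3) * invS a q ^ 3⟩ := by
  obtain ⟨S, hS, hS', invS_eq⟩ := exists_eq_inv hq.1
  change invS a q = S⁻¹ at invS_eq
  have hw : ((q 1 : ℂ) + (a * q 2 : ℝ) * Complex.I) ≠ 0 := by
    intro h0
    have h1 := congrArg Complex.normSq h0
    rw [Complex.normSq_add_mul_I, map_zero] at h1
    exact hS (by rw [hS']; linear_combination h1)
  rw [kerrPsi, div_eq_iff (pow_ne_zero 3 hw), invS_eq]
  apply Complex.ext
  · simp only [pow_succ, pow_zero, one_mul, Complex.mul_re, Complex.mul_im, Complex.add_re,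
      Complex.add_im, Complex.ofReal_re, Complex.ofReal_im, Complex.I_re, Complex.I_im,
      Complex.neg_re]
    field_simp
    rw [hS']
    ring
  · simp only [pow_succ, pow_zero, one_mul, Complex.mul_re, Complex.mul_im, Complex.add_re,
      Complex.add_im, Complex.ofReal_re, Complex.ofReal_im, Complex.I_re, Complex.I_im,
      Complex.neg_im]
    field_simp
    ring

theorem kerrPsi_re {q : Coord} (hq : q ∈ kerrDomain m a) : (kerrPsi m a q).re
    = -(m * (q 1 ^ 3 - 3 * q 1 * (a * q 2) ^ 2) * invS a q ^ 3) := by rw [kerrPsi_eq hq]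

theorem kerrPsi_im {q : Coord} (hq : q ∈ kerrDomain m a) : (kerrPsi m a q).im
    = m * (3 * q 1 ^ 2 * (a * q 2) - (a * q 2) ^ 3) * invS a q ^ 3 := by rw [kerrPsi_eq hq]

set_option maxHeartbeats 4000000 in
theorem kerr_curvForm_of_lt {q : Coord} (hq : q ∈ kerrDomain m a) {k l : Fin 4} (hkl : k < l)
    (i j : Fin 4) :
    (kerrH m a q * curvForm (kerrConn m a) k l q) i j
      = biForm (kerrP m a q) (kerrQ a q) ![-2 * kerrPsi m a q, kerrPsi m a q, kerrPsi m a q]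
          1 (kerrE m a q) i j k l := by
  have hD := isOpen_kerrDomain (m := m) (a := a)
  obtain ⟨S, hS, hS', invS_eq⟩ := exists_eq_inv hq.1
  obtain ⟨Δ, hΔ, hΔ', invDelta_eq⟩ := exists_eq_inv hq.2.1
  obtain ⟨Y, hY, hY', invY_eq⟩ := exists_eq_inv hq.2.2
  change invS a q = S⁻¹ at invS_eq
  change invDelta m a q = Δ⁻¹ at invDelta_eq
  change invY q = Y⁻¹ at invY_eq
  have hx := kerrPsi_re hq
  have hy := kerrPsi_im hq
  have hx2 : (-2 * kerrPsi m a q).re = -2 * (kerrPsi m a q).re := by simp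
  have hy2 : (-2 * kerrPsi m a q).im = -2 * (kerrPsi m a q).im := by simp
  have hmul : ∀ M : Matrix (Fin 4) (Fin 4) ℝ, (kerrH m a q * M) i j = kerrH m a q i i * M i j := by
    intro M
    rw [Matrix.mul_apply, Finset.sum_eq_single i _ (by simp)]
    intro k _ hk
    fin_cases i <;> fin_cases k <;> first | exact absurd rfl hk | simp [kerrH]
  rw [hmul, curvForm]
  fin_cases k <;> fin_cases l <;> try exact absurd hkl (by decide)
  all_goals fin_cases i <;> fin_cases j
  all_goals clear hmul hkl
  all_goals simp only [pdMat, Matrix.add_apply, Matrix.sub_apply, kerrConn, kerrConnT, kerrConnR,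
    kerrConnY, kerrConnPhi, Fin.zero_eta, Fin.mk_one, Fin.reduceFinMk, Matrix.of_apply,
    Matrix.cons_val]
  all_goals refine HasPD.curv_eq (D := kerrDomain m a) (by
    repeat' first
      | exact .const hD _ | exact .coord_r hD | exact .coord_y hD | exact hasPD_invS
      | exact hasPD_invDelta | exact hasPD_invY | apply HasPD.neg | apply HasPD.sub
      | apply HasPD.add | apply HasPD.sq | apply HasPD.mul) (by
    repeat' first
      | exact .const hD _ | exact .coord_r hD | exact .coord_y hD | exact hasPD_invS
      | exact hasPD_invDelta | exact hasPD_invY | apply HasPD.neg | apply HasPD.sub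
      | apply HasPD.add | apply HasPD.sq | apply HasPD.mul) hq ?_
  all_goals simp only [biForm, Fin.sum_univ_three, uForm, vForm, twoForm, uWeight, vWeight,
    Matrix.of_apply, Matrix.cons_val, Matrix.one_apply, Matrix.mul_apply, Fin.sum_univ_four,
    kerrE, kerrH, hx2, hy2, hx, hy, kerrP, kerrQ, Fin.reduceEq, reduceIte, mul_zero, zero_mul,
    add_zero, zero_add, sub_zero, zero_sub, mul_one, one_mul, neg_zero, invS_eq,
    invDelta_eq, invY_eq]
  all_goals try field_simp
  all_goals try simp only [hS', hΔ', hY']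
  all_goals try ring

theorem curvForm_swap (Γ : Fin 4 → MetricField) (c d : Fin 4) (x : Coord) :
    curvForm Γ d c x = -curvForm Γ c d x := by
  simp only [curvForm]
  abel

theorem twoForm_swap (i j a b : Fin 4) (E : Matrix (Fin 4) (Fin 4) ℝ) :
    twoForm i j E b a = -twoForm i j E a b := by
  simp only [twoForm, Matrix.of_apply]
  ring

theorem biForm_swap (p q : ℝ) (z : Fin 3 → ℂ) (E E' : Matrix (Fin 4) (Fin 4) ℝ)
    (a b c d : Fin 4) : biForm p q z E E' a b d c = -biForm p q z E E' a b c d := by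
  simp only [biForm, ← Finset.sum_neg_distrib, uForm, vForm, twoForm_swap _ _ c d]
  exact Finset.sum_congr rfl fun A _ => by ring

/-- The curvature forms of the Carter coframe. The first pair of indices refers to the coframe and
the second to the coordinates, so that the coframes in `biForm` are `1` and `kerrE`. -/
theorem kerr_curvForm {q : Coord} (hq : q ∈ kerrDomain m a) (k l i j : Fin 4) :
    (kerrH m a q * curvForm (kerrConn m a) k l q) i j
      = biForm (kerrP m a q) (kerrQ a q) ![-2 * kerrPsi m a q, kerrPsi m a q, kerrPsi m a q]
          1 (kerrE m a q) i j k l := by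
  have hlt : ∀ {k l : Fin 4}, k < l → _ := fun h => kerr_curvForm_of_lt hq h i j
  rcases lt_trichotomy k l with h | rfl | h
  · exact hlt h
  · have h1 : curvForm (kerrConn m a) k k q = 0 := by simp [curvForm]
    have h2 := biForm_swap (kerrP m a q) (kerrQ a q)
      ![-2 * kerrPsi m a q, kerrPsi m a q, kerrPsi m a q] 1 (kerrE m a q) i j k k
    rw [self_eq_neg] at h2
    rw [h1, h2, Matrix.mul_zero, Matrix.zero_apply]
  · rw [curvForm_swap, biForm_swap, Matrix.mul_neg, Matrix.neg_apply, hlt h]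

theorem kerrP_ne_zero {q : Coord} (hq : q ∈ kerrDomain m a) : kerrP m a q ≠ 0 :=
  mul_ne_zero hq.2.1 (inv_ne_zero hq.1)

theorem kerrQ_ne_zero {q : Coord} (hq : q ∈ kerrDomain m a) : kerrQ a q ≠ 0 :=
  mul_ne_zero hq.2.2 (inv_ne_zero hq.1)

theorem kerrH_eq (q : Coord) : kerrH m a q
    = Matrix.diagonal ![-kerrP m a q, kerrP m a q, kerrQ a q, kerrQ a q] := by
  ext i j
  fin_cases i <;> fin_cases j <;> simp [kerrH, kerrP, kerrQ]

theorem det_kerrE_ne_zero {q : Coord} (hq : q ∈ kerrDomain m a) : (kerrE m a q).det ≠ 0 := by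
  have h : (kerrE m a q).det = (q 1 ^ 2 + a ^ 2 * q 2 ^ 2) * (q 1 ^ 2 + a ^ 2 * q 2 ^ 2)
      * (q 1 ^ 2 + a ^ 2 * q 2 ^ 2) * invDelta m a q * invY q := by
    simp [kerrE, Matrix.det_succ_row_zero, Fin.sum_univ_succ, Fin.succAbove]
    ring
  rw [h]
  exact mul_ne_zero (mul_ne_zero (mul_ne_zero (mul_ne_zero hq.1 hq.1) hq.1)
    (inv_ne_zero hq.2.1)) (inv_ne_zero hq.2.2)

theorem kerr_movingFrame : MovingFrame (kerrDomain m a)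
    (fun q => (kerrE m a q).transpose * kerrH m a q * kerrE m a q) (kerrE m a) (kerrH m a)
    (kerrConn m a) where
  isOpen := isOpen_kerrDomain
  smooth_E := smoothOn_kerrE
  smooth_h := smoothOn_kerrH
  smooth_conn := smoothOn_kerrConn
  det_E _ hq := det_kerrE_ne_zero hq
  det_h q hq := by
    rw [kerrH_eq, Matrix.det_diagonal]
    simp [Fin.prod_univ_four, kerrP_ne_zero hq, kerrQ_ne_zero hq]
  symm_h q _ := by rw [kerrH_eq, Matrix.diagonal_transpose]
  metric_eq _ _ := rfl
  compat _ hq := kerr_compat hq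
  torsion _ hq := kerr_torsion hq

/-! ### The algebra of double 2-forms -/

/-- The matrix of components of the metric in the coframe: `diag (-p, p, q, q)`. -/
def frameMetric (p q : ℝ) : Matrix (Fin 4) (Fin 4) ℝ := Matrix.diagonal ![-p, p, q, q]

/-- At a point, the metric `G` has components `diag (-p, p, q, q)` in the coframe `E`. -/
structure IsFrame (G E : Matrix (Fin 4) (Fin 4) ℝ) (p q : ℝ) : Prop where
  metric_eq : G = E.transpose * frameMetric p q * E
  det_ne : E.det ≠ 0
  p_ne : p ≠ 0
  q_ne : q ≠ 0

/-- The scalar product `½ X_{mn} Y^{mn}` of 2-forms, for the contravariant metric `γ`. -/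
def pairing (γ X Y : Matrix (Fin 4) (Fin 4) ℝ) : ℝ :=
  (1 / 2) * ∑ m, ∑ n, ∑ k, ∑ l, X m n * γ m k * γ n l * Y k l

theorem sum_four_eq_sum_prod (f : Fin 4 → Fin 4 → Fin 4 → Fin 4 → ℝ) :
    ∑ a, ∑ b, ∑ c, ∑ d, f a b c d
      = ∑ i : Fin 4 × Fin 4 × Fin 4 × Fin 4, f i.1 i.2.1 i.2.2.1 i.2.2.2 := by
  simp only [Fintype.sum_prod_type]

section DoubleForms

variable {ι : Type*} [Fintype ι]

/-- The double 2-form `∑ w_{st} b^s ⊗ b^t`. -/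
def doubleForm (b : ι → Matrix (Fin 4) (Fin 4) ℝ) (w : Matrix ι ι ℝ) : Tensor4 :=
  fun i j k l => (fun s => b s i j) ⬝ᵥ w.mulVec (fun t => b t k l)

/-- The Gram matrix of a family of 2-forms. -/
def gram (γ : Matrix (Fin 4) (Fin 4) ℝ) (b : ι → Matrix (Fin 4) (Fin 4) ℝ) : Matrix ι ι ℝ :=
  Matrix.of fun s t => pairing γ (b s) (b t)

theorem comp_doubleForm (g : MetricField) (x : Coord) (b : ι → Matrix (Fin 4) (Fin 4) ℝ)
    (w w' : Matrix ι ι ℝ) :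
    comp g x (doubleForm b w) (doubleForm b w') = doubleForm b (w * gram (g x)⁻¹ b * w') := by
  funext i j k l
  have h : ∀ α β : ι → ℝ, α ⬝ᵥ (gram (g x)⁻¹ b).mulVec β
      = (1 / 2) * ∑ m, ∑ n, ∑ k, ∑ l, (∑ s, α s * b s m n) * (g x)⁻¹ m k * (g x)⁻¹ n l
        * (∑ t, b t k l * β t) := by
    intro α β
    simp only [dotProduct, Matrix.mulVec, gram, pairing, Matrix.of_apply, sum_four_eq_sum_prod,
      Finset.mul_sum, Finset.sum_mul]
    rw [Finset.sum_congr rfl fun s _ => Finset.sum_comm, Finset.sum_comm]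
    refine Finset.sum_congr rfl fun i _ => ?_
    rw [Finset.sum_comm]
    refine Finset.sum_congr rfl fun t _ => Finset.sum_congr rfl fun s _ => by ring
  simp only [doubleForm]
  rw [← Matrix.mulVec_mulVec, ← Matrix.mulVec_mulVec, Matrix.dotProduct_mulVec, h]
  simp only [comp, doubleForm, Matrix.dotProduct_mulVec]
  congr 1
  refine Finset.sum_congr rfl fun m _ => Finset.sum_congr rfl fun n _ =>
    Finset.sum_congr rfl fun k' _ => Finset.sum_congr rfl fun l' _ => ?_
  congr 1
  rw [← Matrix.dotProduct_mulVec]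
  rfl

theorem trace2_doubleForm (g : MetricField) (x : Coord) (b : ι → Matrix (Fin 4) (Fin 4) ℝ)
    (w : Matrix ι ι ℝ) :
    trace2 g x (doubleForm b w) = (w * (gram (g x)⁻¹ b).transpose).trace := by
  simp only [trace2, doubleForm, dotProduct, Matrix.mulVec, gram, pairing, Matrix.of_apply,
    sum_four_eq_sum_prod, Finset.mul_sum, Matrix.trace, Matrix.diag_apply, Matrix.mul_apply,
    Matrix.transpose_apply]
  rw [Finset.sum_comm]
  refine Finset.sum_congr rfl fun s _ => ?_
  rw [Finset.sum_comm]
  exact Finset.sum_congr rfl fun t _ => Finset.sum_congr rfl fun i _ => by ring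

end DoubleForms

/-- The family of 2-forms `u_A`, `v_A`. -/
def formBasis (E : Matrix (Fin 4) (Fin 4) ℝ) :
    Fin 3 ⊕ Fin 3 → Matrix (Fin 4) (Fin 4) ℝ :=
  Sum.elim (fun A => uForm A E) (fun A => vForm A E)

/-- The coefficients of `biForm` with respect to `formBasis`. -/
def biFormCoeff (p q : ℝ) (z : Fin 3 → ℂ) :
    Matrix (Fin 3 ⊕ Fin 3) (Fin 3 ⊕ Fin 3) ℝ :=
  Matrix.fromBlocks (Matrix.diagonal fun A => -((z A).re * uWeight p q A))
    (Matrix.diagonal fun A => (z A).im * (p * q)) (Matrix.diagonal fun A => (z A).im * (p * q))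
    (Matrix.diagonal fun A => (z A).re * vWeight p q A)

theorem biForm_eq_doubleForm (p q : ℝ) (z : Fin 3 → ℂ)
    (E : Matrix (Fin 4) (Fin 4) ℝ) :
    biForm p q z E E = doubleForm (formBasis E) (biFormCoeff p q z) := by
  funext a b c d
  simp only [biForm, doubleForm, formBasis, biFormCoeff, dotProduct, Matrix.mulVec,
    Fintype.sum_sum_type, Sum.elim_inl, Sum.elim_inr, Matrix.fromBlocks_apply₁₁,
    Matrix.fromBlocks_apply₁₂, Matrix.fromBlocks_apply₂₁, Matrix.fromBlocks_apply₂₂,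
    Matrix.diagonal_apply, ite_mul, zero_mul, Finset.sum_ite_eq, Finset.mem_univ, if_true]
  simp only [mul_add, ← Finset.sum_add_distrib]
  exact Finset.sum_congr rfl fun A _ => by ring

/-- The volume element in terms of the coframe: `det E • ε = e⁰ ∧ e¹ ∧ e² ∧ e³`. -/
theorem det_mul_leviCivita (E : Matrix (Fin 4) (Fin 4) ℝ) (a b c d : Fin 4) :
    E.det * leviCivita a b c d = (E.submatrix id ![a, b, c, d]).det := by
  have h : E.submatrix id ![a, b, c, d]
      = E * (((1 : Matrix (Fin 4) (Fin 4) ℝ).submatrix ![a, b, c, d] id)).transpose := by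
    ext i j
    simp only [Matrix.submatrix_apply, Matrix.mul_apply, Matrix.transpose_apply, Matrix.one_apply,
      mul_ite, mul_one, mul_zero, id, Finset.sum_ite_eq, Finset.mem_univ, if_true]
  rw [h, Matrix.det_mul, Matrix.det_transpose, leviCivita]

/-- The orientation of the coframe, as a sign. The factor `p q` compensates for the sign with which
the imaginary eigenvalues enter `biForm`. -/
def frameSign (o : ℤˣ) (E : Matrix (Fin 4) (Fin 4) ℝ) (p q : ℝ) : ℝ :=
  ((o : ℤ) : ℝ) * Real.sign (E.det * p * q)

namespace IsFrame

variable {G E : Matrix (Fin 4) (Fin 4) ℝ} {p q : ℝ}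

theorem frameMetric_mul_inv (F : IsFrame G E p q) :
    frameMetric p q * frameMetric p⁻¹ q⁻¹ = 1 := by
  rw [frameMetric, frameMetric, Matrix.diagonal_mul_diagonal, ← Matrix.diagonal_one]
  congr 1
  ext i
  fin_cases i <;> simp [F.p_ne, F.q_ne]

theorem inv_eq (F : IsFrame G E p q) :
    G⁻¹ = E⁻¹ * frameMetric p⁻¹ q⁻¹ * E⁻¹.transpose := by
  have hE := F.det_ne.isUnit
  have h1 : (frameMetric p q)⁻¹ = frameMetric p⁻¹ q⁻¹ :=
    Matrix.inv_eq_right_inv F.frameMetric_mul_inv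
  rw [F.metric_eq, Matrix.mul_inv_rev, Matrix.mul_inv_rev, h1, Matrix.transpose_nonsing_inv,
    Matrix.mul_assoc]

/-- Contraction of two 1-forms of the coframe. -/
theorem mul_inv_mul (F : IsFrame G E p q) : E * G⁻¹ * E.transpose = frameMetric p⁻¹ q⁻¹ := by
  have hE := F.det_ne.isUnit
  have hE' : IsUnit E.transpose.det := by rwa [Matrix.det_transpose]
  rw [F.inv_eq, Matrix.transpose_nonsing_inv, Matrix.mul_assoc, Matrix.mul_assoc,
    Matrix.nonsing_inv_mul _ hE', Matrix.mul_one, Matrix.mul_nonsing_inv_cancel_left _ _ hE]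

theorem sum_inv (F : IsFrame G E p q) (i k : Fin 4) :
    ∑ a, ∑ b, G⁻¹ a b * E i a * E k b = frameMetric p⁻¹ q⁻¹ i k := by
  rw [← F.mul_inv_mul, Matrix.mul_apply, Finset.sum_comm]
  refine Finset.sum_congr rfl fun b _ => ?_
  rw [Matrix.mul_apply, Finset.sum_mul]
  exact Finset.sum_congr rfl fun a _ => by rw [Matrix.transpose_apply]; ring

theorem det_metric (F : IsFrame G E p q) : G.det = -(E.det * p * q) ^ 2 := by
  rw [F.metric_eq, Matrix.det_mul, Matrix.det_mul, Matrix.det_transpose, frameMetric,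
    Matrix.det_diagonal]
  simp only [Fin.prod_univ_four, Matrix.cons_val]
  ring

theorem det_metric_ne (F : IsFrame G E p q) : G.det ≠ 0 := by
  rw [F.det_metric]
  exact neg_ne_zero.2 (pow_ne_zero 2 (mul_ne_zero (mul_ne_zero F.det_ne F.p_ne) F.q_ne))

theorem metric_apply (F : IsFrame G E p q) (a b : Fin 4) :
    G a b = -p * E 0 a * E 0 b + p * E 1 a * E 1 b + q * E 2 a * E 2 b + q * E 3 a * E 3 b := by
  rw [F.metric_eq, frameMetric, Matrix.mul_apply]
  simp only [Matrix.mul_diagonal, Matrix.transpose_apply, Fin.sum_univ_four,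
    Matrix.cons_val]
  ring

theorem pairing_twoForm (F : IsFrame G E p q) (i j k l : Fin 4) :
    pairing G⁻¹ (twoForm i j E) (twoForm k l E)
      = frameMetric p⁻¹ q⁻¹ i k * frameMetric p⁻¹ q⁻¹ j l
        - frameMetric p⁻¹ q⁻¹ i l * frameMetric p⁻¹ q⁻¹ j k := by
  have h : ∀ i j k l, ∑ m, ∑ n, ∑ m', ∑ n', E i m * E j n * G⁻¹ m m' * G⁻¹ n n' * E k m' * E l n'
      = frameMetric p⁻¹ q⁻¹ i k * frameMetric p⁻¹ q⁻¹ j l := by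
    intro i j k l
    rw [← F.sum_inv i k, ← F.sum_inv j l, Finset.sum_mul_sum]
    refine Finset.sum_congr rfl fun m _ => Finset.sum_congr rfl fun n _ => ?_
    rw [Finset.sum_mul_sum]
    exact Finset.sum_congr rfl fun m' _ => Finset.sum_congr rfl fun n' _ => by ring
  have h2 : pairing G⁻¹ (twoForm i j E) (twoForm k l E) = (1 / 2) *
      ((∑ m, ∑ n, ∑ m', ∑ n', E i m * E j n * G⁻¹ m m' * G⁻¹ n n' * E k m' * E l n')
      - (∑ m, ∑ n, ∑ m', ∑ n', E i m * E j n * G⁻¹ m m' * G⁻¹ n n' * E l m' * E k n')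
      - (∑ m, ∑ n, ∑ m', ∑ n', E j m * E i n * G⁻¹ m m' * G⁻¹ n n' * E k m' * E l n')
      + (∑ m, ∑ n, ∑ m', ∑ n', E j m * E i n * G⁻¹ m m' * G⁻¹ n n' * E l m' * E k n')) := by
    simp only [pairing, sum_four_eq_sum_prod, ← Finset.sum_sub_distrib, ← Finset.sum_add_distrib,
      twoForm, Matrix.of_apply]
    congr 1
    exact Finset.sum_congr rfl fun i _ => by ring
  rw [h2, h, h, h, h]
  ring

theorem gram_formBasis (F : IsFrame G E p q) : gram G⁻¹ (formBasis E)
    = Matrix.fromBlocks (Matrix.diagonal fun A => -(uWeight p q A)⁻¹) 0 0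
        (Matrix.diagonal fun A => (vWeight p q A)⁻¹) := by
  have hp := F.p_ne
  have hq := F.q_ne
  ext s t
  rcases s with A | A <;> rcases t with B | B <;>
    simp only [gram, formBasis, uForm, vForm, Matrix.of_apply, Sum.elim_inl, Sum.elim_inr,
      F.pairing_twoForm, Matrix.fromBlocks_apply₁₁, Matrix.fromBlocks_apply₁₂,
      Matrix.fromBlocks_apply₂₁, Matrix.fromBlocks_apply₂₂] <;>
    fin_cases A <;> fin_cases B <;> simp [frameMetric, uWeight, vWeight]
  all_goals try field_simp

theorem biFormCoeff_mul (F : IsFrame G E p q) (z z' : Fin 3 → ℂ) :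
    biFormCoeff p q z * gram G⁻¹ (formBasis E) * biFormCoeff p q z'
      = biFormCoeff p q (z * z') := by
  have hp := F.p_ne
  have hq := F.q_ne
  rw [F.gram_formBasis]
  simp only [biFormCoeff, Matrix.fromBlocks_multiply, Matrix.diagonal_mul_diagonal, Matrix.mul_zero,
    add_zero, zero_add, Matrix.diagonal_add, Pi.mul_apply, Complex.mul_re, Complex.mul_im]
  congr 2 <;> funext A <;> fin_cases A <;> simp [uWeight, vWeight] <;> field_simp <;> ring

/-- Double 2-forms which are diagonal on the self-dual bivectors compose by multiplication of their
eigenvalues. -/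
theorem comp_biForm {g : MetricField} {x : Coord} (F : IsFrame (g x) E p q) (z z' : Fin 3 → ℂ) :
    comp g x (biForm p q z E E) (biForm p q z' E E) = biForm p q (z * z') E E := by
  simp only [biForm_eq_doubleForm, comp_doubleForm, F.biFormCoeff_mul]

theorem trace2_biForm {g : MetricField} {x : Coord} (F : IsFrame (g x) E p q) (z : Fin 3 → ℂ) :
    trace2 g x (biForm p q z E E) = 2 * (∑ A, z A).re := by
  have hp := F.p_ne
  have hq := F.q_ne
  rw [biForm_eq_doubleForm, trace2_doubleForm, F.gram_formBasis, biFormCoeff,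
    Matrix.fromBlocks_transpose, Matrix.fromBlocks_multiply]
  simp only [Matrix.diagonal_transpose, Matrix.transpose_zero, Matrix.mul_zero, add_zero, zero_add,
    Matrix.diagonal_mul_diagonal, Matrix.trace, Matrix.diag_apply, Fintype.sum_sum_type,
    Matrix.fromBlocks_apply₁₁, Matrix.fromBlocks_apply₂₂, Matrix.diagonal_apply_eq,
    Fin.sum_univ_three, uWeight, vWeight, Matrix.cons_val, Complex.add_re]
  field_simp
  ring

theorem metricG_eq {g : MetricField} {x : Coord} (F : IsFrame (g x) E p q) :
    metricG g x = biForm p q 1 E E := by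
  funext a b c d
  simp only [metricG, F.metric_apply, biForm, Fin.sum_univ_three, uForm, vForm, twoForm, uWeight,
    vWeight, Matrix.cons_val, Matrix.of_apply, Pi.one_apply, Complex.one_re, Complex.one_im]
  ring

theorem frameSign_mul_self (F : IsFrame G E p q) (o : ℤˣ) :
    frameSign o E p q * frameSign o E p q = 1 := by
  have h0 : E.det * p * q ≠ 0 := mul_ne_zero (mul_ne_zero F.det_ne F.p_ne) F.q_ne
  have h1 : ((o : ℤ) : ℝ) * ((o : ℤ) : ℝ) = 1 := by
    rcases Int.units_eq_one_or o with rfl | rfl <;> norm_num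
  have h2 : Real.sign (E.det * p * q) * Real.sign (E.det * p * q) = 1 := by
    rcases Real.sign_apply_eq_of_ne_zero _ h0 with h | h <;> rw [h] <;> norm_num
  rw [frameSign, mul_mul_mul_comm, h1, h2, one_mul]

/-- The volume element acts on the self-dual bivectors as `± i`. -/
theorem volumeElt_eq {g : MetricField} {x : Coord} (F : IsFrame (g x) E p q) (o : ℤˣ) :
    volumeElt g o x = biForm p q (fun _ => frameSign o E p q * Complex.I) E E := by
  funext a b c d
  have h1 : √|(g x).det| = Real.sign (E.det * p * q) * (E.det * p * q) := by
    rw [F.det_metric, abs_neg, abs_of_nonneg (sq_nonneg _), Real.sqrt_sq_eq_abs]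
    rcases lt_trichotomy (E.det * p * q) 0 with h | h | h
    · rw [Real.sign_of_neg h, abs_of_neg h]; ring
    · rw [h]; simp
    · rw [Real.sign_of_pos h, abs_of_pos h]; ring
  have h2 : volumeElt g o x a b c d
      = frameSign o E p q * (p * q) * (E.det * leviCivita a b c d) := by
    rw [volumeElt, h1, frameSign]
    ring
  rw [h2, det_mul_leviCivita]
  simp only [biForm, Fin.sum_univ_three, uForm, vForm, twoForm, Matrix.cons_val, Matrix.of_apply,
    Complex.re_ofReal_mul, Complex.im_ofReal_mul, Complex.I_re, Complex.I_im]
  simp [Matrix.det_succ_row_zero, Fin.sum_univ_succ, Fin.succAbove]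
  ring

theorem contract_twoForm (F : IsFrame G E p q) (i j k l b d : Fin 4) :
    ∑ a, ∑ e, G⁻¹ a e * (twoForm i j E e b * twoForm k l E a d)
      = frameMetric p⁻¹ q⁻¹ k i * E j b * E l d - frameMetric p⁻¹ q⁻¹ l i * E j b * E k d
        - frameMetric p⁻¹ q⁻¹ k j * E i b * E l d + frameMetric p⁻¹ q⁻¹ l j * E i b * E k d := by
  simp only [← F.sum_inv, Finset.sum_mul, ← Finset.sum_sub_distrib, ← Finset.sum_add_distrib,
    twoForm, Matrix.of_apply]
  exact Finset.sum_congr rfl fun a _ => Finset.sum_congr rfl fun e _ => by ring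

/-- The Ricci contraction of `biForm` is a multiple of the metric. -/
theorem contract_biForm (F : IsFrame G E p q) (z : Fin 3 → ℂ) (b d : Fin 4) :
    ∑ a, ∑ e, G⁻¹ a e * biForm p q z E E e b a d = (∑ A, z A).re * G b d := by
  have hp := F.p_ne
  have hq := F.q_ne
  have h : ∀ a e, G⁻¹ a e * biForm p q z E E e b a d = ∑ A,
      ((z A).re * vWeight p q A * (G⁻¹ a e * (vForm A E e b * vForm A E a d))
      - (z A).re * uWeight p q A * (G⁻¹ a e * (uForm A E e b * uForm A E a d))
      + (z A).im * (p * q) * (G⁻¹ a e * (uForm A E e b * vForm A E a d))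
      + (z A).im * (p * q) * (G⁻¹ a e * (vForm A E e b * uForm A E a d))) := by
    intro a e
    rw [biForm, Finset.mul_sum]
    exact Finset.sum_congr rfl fun A _ => by ring
  simp only [h]
  rw [Finset.sum_congr rfl fun a _ => Finset.sum_comm, Finset.sum_comm]
  simp only [Finset.sum_add_distrib, Finset.sum_sub_distrib, ← Finset.mul_sum, uForm, vForm,
    F.contract_twoForm]
  rw [F.metric_apply]
  simp [Fin.sum_univ_three, frameMetric, Matrix.diagonal_apply, uWeight, vWeight]
  field_simp
  ring

theorem ricci_eq {g : MetricField} {x : Coord} (F : IsFrame (g x) E p q) {z : Fin 3 → ℂ}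
    (hz : riemann g x = biForm p q z E E) (b d : Fin 4) :
    ricci g x b d = (∑ A, z A).re * g x b d := by
  rw [← F.contract_biForm z b d, ricci]
  refine Finset.sum_congr rfl fun a _ => ?_
  have h1 : (g x)⁻¹ * (g x * Matrix.of fun e c => riemannUp g x e b c d)
      = Matrix.of fun e c => riemannUp g x e b c d :=
    Matrix.nonsing_inv_mul_cancel_left _ _ F.det_metric_ne.isUnit
  have h2 := congrFun (congrFun h1 a) a
  rw [Matrix.mul_apply] at h2
  rw [← hz]
  simpa [Matrix.mul_apply, riemann] using h2.symm

/-- If the sum of the eigenvalues vanishes, then the metric is Ricci-flat and the Weyl tensor is the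
Riemann tensor. -/
theorem weyl_eq {g : MetricField} {x : Coord} (F : IsFrame (g x) E p q) {z : Fin 3 → ℂ}
    (hz : riemann g x = biForm p q z E E) (hz0 : ∑ A, z A = 0) :
    weyl g x = biForm p q z E E := by
  have h : ∀ b d, ricci g x b d = 0 := fun b d => by
    rw [F.ricci_eq hz, hz0, Complex.zero_re, zero_mul]
  funext a b c d
  simp [weyl, scalarCurv, h, hz]

end IsFrame

/-! ### The Carter coframe on a Kerr space-time -/

theorem sum_twoForm (i j : Fin 4) (E J : Matrix (Fin 4) (Fin 4) ℝ) (c d : Fin 4) :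
    ∑ k, ∑ l, J k c * J l d * twoForm i j E k l = twoForm i j (E * J) c d := by
  have h : ∀ c d, (E * J) i c * (E * J) j d = ∑ k, ∑ l, E i k * J k c * (E j l * J l d) :=
    fun c d => by rw [Matrix.mul_apply, Matrix.mul_apply, Finset.sum_mul_sum]
  simp only [twoForm, Matrix.of_apply]
  rw [h, h, Finset.sum_comm (f := fun k l => E i k * J k d * (E j l * J l c)),
    ← Finset.sum_sub_distrib]
  refine Finset.sum_congr rfl fun k _ => ?_
  rw [← Finset.sum_sub_distrib]
  exact Finset.sum_congr rfl fun l _ => by ring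

theorem sum_biForm_right (p q : ℝ) (z : Fin 3 → ℂ) (E e J : Matrix (Fin 4) (Fin 4) ℝ)
    (a b c d : Fin 4) :
    ∑ k, ∑ l, J k c * J l d * biForm p q z E e a b k l = biForm p q z E (e * J) a b c d := by
  have h : ∀ k l, J k c * J l d * biForm p q z E e a b k l = ∑ A,
      (((z A).re * vWeight p q A * vForm A E a b + (z A).im * (p * q) * uForm A E a b)
          * (J k c * J l d * vForm A e k l)
        + ((z A).im * (p * q) * vForm A E a b - (z A).re * uWeight p q A * uForm A E a b)
          * (J k c * J l d * uForm A e k l)) := by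
    intro k l
    rw [biForm, Finset.mul_sum]
    exact Finset.sum_congr rfl fun A _ => by ring
  simp only [h]
  rw [Finset.sum_congr rfl fun a _ => Finset.sum_comm, Finset.sum_comm, biForm]
  refine Finset.sum_congr rfl fun A _ => ?_
  simp only [Finset.sum_add_distrib, ← Finset.mul_sum, uForm, vForm, sum_twoForm]
  ring

theorem biForm_comm (p q : ℝ) (z : Fin 3 → ℂ) (E E' : Matrix (Fin 4) (Fin 4) ℝ)
    (a b c d : Fin 4) : biForm p q z E E' a b c d = biForm p q z E' E c d a b :=
  Finset.sum_congr rfl fun A _ => by ring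

theorem sum_biForm_left (p q : ℝ) (z : Fin 3 → ℂ) (E e J : Matrix (Fin 4) (Fin 4) ℝ)
    (a b c d : Fin 4) :
    ∑ k, ∑ l, J k a * J l b * biForm p q z e E k l c d = biForm p q z (e * J) E a b c d := by
  rw [biForm_comm, ← sum_biForm_right]
  exact Finset.sum_congr rfl fun k _ => Finset.sum_congr rfl fun l _ => by rw [biForm_comm]

/-- The coordinates `(t, r, cos θ, φ)`, in which the components of the Kerr metric are rational. -/
def kerrMap (φ : Coord → Coord) (x : Coord) : Coord := ![φ x 0, φ x 1, Real.cos (φ x 2), φ x 3]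

/-- The Carter coframe in the coordinates of a Kerr space-time. -/
def carterFrame (m a : ℝ) (φ : Coord → Coord) : MetricField :=
  fun x => kerrE m a (kerrMap φ x) * jacobian (kerrMap φ) x

namespace IsKerr

variable {m a : ℝ} {Ω : Set Coord} {φ : Coord → Coord} {g : MetricField}

theorem mapsTo_kerrMap (hg : IsKerr m a Ω φ g) :
    Set.MapsTo (kerrMap φ) Ω (kerrDomain m a) := by
  intro x hx
  obtain ⟨h1, h2, h3⟩ := hg.mapsTo hx
  refine ⟨h1, h2, ?_⟩
  change 1 - Real.cos (φ x 2) ^ 2 ≠ 0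
  rw [← Real.sin_sq]
  exact pow_ne_zero 2 h3

theorem contDiffOn_kerrMap (hg : IsKerr m a Ω φ g) : ContDiffOn ℝ ∞ (kerrMap φ) Ω := by
  have h := contDiffOn_pi.1 hg.smooth
  refine contDiffOn_pi.2 fun i => ?_
  fin_cases i
  · exact h 0
  · exact h 1
  · exact (h 2).cos
  · exact h 3

theorem differentiableAt (hg : IsKerr m a Ω φ g) {x : Coord} (hx : x ∈ Ω) :
    DifferentiableAt ℝ φ x :=
  (hg.smooth.differentiableOn (by simp)).differentiableAt (hg.isOpen.mem_nhds hx)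

theorem differentiableAt_kerrMap (hg : IsKerr m a Ω φ g) {x : Coord} (hx : x ∈ Ω) :
    DifferentiableAt ℝ (kerrMap φ) x :=
  (hg.contDiffOn_kerrMap.differentiableOn (by simp)).differentiableAt (hg.isOpen.mem_nhds hx)

theorem jacobian_kerrMap (hg : IsKerr m a Ω φ g) {x : Coord} (hx : x ∈ Ω) :
    jacobian (kerrMap φ) x
      = Matrix.diagonal ![1, 1, -Real.sin (φ x 2), 1] * jacobian φ x := by
  ext i j
  rw [jacobian_apply (hg.differentiableAt_kerrMap hx), Matrix.diagonal_mul,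
    jacobian_apply (hg.differentiableAt hx)]
  have h2 : pd j (fun y => Real.cos (φ y 2)) x
      = -Real.sin (φ x 2) * pd j (fun y => φ y 2) x := by
    have hd : DifferentiableAt ℝ (fun y => φ y 2) x :=
      differentiableAt_pi.1 (hg.differentiableAt hx) 2
    unfold pd
    rw [hd.hasFDerivAt.cos.fderiv]
    rfl
  fin_cases i
  · exact (one_mul _).symm
  · exact (one_mul _).symm
  · exact h2
  · exact (one_mul _).symm

/-- The Kerr metric in Boyer-Lindquist coordinates is `diag (-p, p, q, q)` in the Carter coframe. -/
theorem kerrBL_eq {q q' : Coord} (hq' : q' = ![q 0, q 1, Real.cos (q 2), q 3])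
    (hq : q' ∈ kerrDomain m a) :
    kerrBL m a q = (Matrix.diagonal ![1, 1, -Real.sin (q 2), 1]).transpose
      * ((kerrE m a q').transpose * kerrH m a q' * kerrE m a q')
      * Matrix.diagonal ![1, 1, -Real.sin (q 2), 1] := by
  subst hq'
  obtain ⟨S, hS, hS', invS_eq⟩ := exists_eq_inv hq.1
  obtain ⟨Δ, hΔ, hΔ', invDelta_eq⟩ := exists_eq_inv hq.2.1
  obtain ⟨Y, hY, hY', invY_eq⟩ := exists_eq_inv hq.2.2
  set q' : Coord := ![q 0, q 1, Real.cos (q 2), q 3] with hq'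
  change invS a q' = S⁻¹ at invS_eq
  change invDelta m a q' = Δ⁻¹ at invDelta_eq
  change invY q' = Y⁻¹ at invY_eq
  have h1 : q' 1 = q 1 := rfl
  have h2 : q' 2 = Real.cos (q 2) := rfl
  rw [h1, h2] at hS'
  rw [h1] at hΔ'
  rw [h2] at hY'
  have hs : Real.sin (q 2) ^ 2 = Y := by rw [hY', Real.sin_sq]
  rw [Matrix.diagonal_transpose]
  have hkE : kerrE m a q' = !![1, 0, 0, -(a * Y); 0, S * Δ⁻¹, 0, 0; 0, 0, S * Y⁻¹, 0;
      -a, 0, 0, q 1 ^ 2 + a ^ 2] := by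
    rw [kerrE, invDelta_eq, invY_eq, h1, h2, ← hS', ← hY']
  have hkH : kerrH m a q'
      = !![-(Δ * S⁻¹), 0, 0, 0; 0, Δ * S⁻¹, 0, 0; 0, 0, Y * S⁻¹, 0; 0, 0, 0, Y * S⁻¹] := by
    rw [kerrH, invS_eq, h1, h2, ← hΔ', ← hY']
  have hBL : kerrBL m a q = !![-(1 - 2 * m * q 1 / S), 0, 0, -(2 * m * a * q 1 * Y / S);
      0, S / Δ, 0, 0; 0, 0, S, 0;
      -(2 * m * a * q 1 * Y / S), 0, 0,
        (q 1 ^ 2 + a ^ 2 + 2 * m * a ^ 2 * q 1 * Y / S) * Y] := by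
    simp only [kerrBL]
    rw [← hS', ← hΔ', hs]
  rw [hkE, hkH, hBL]
  ext i j
  rw [Matrix.mul_diagonal, Matrix.diagonal_mul]
  fin_cases i <;> fin_cases j <;>
    simp [Matrix.mul_apply, Fin.sum_univ_four]
  · field_simp
    rw [hS', hΔ', hY']
    ring
  · field_simp
    rw [hΔ']
    ring
  · field_simp
  · field_simp
    rw [← hs]
  · field_simp
    rw [hΔ']
    ring
  · field_simp
    rw [hS', hΔ', hY']
    ring

theorem metric_eq_kerrMap (hg : IsKerr m a Ω φ g) {x : Coord} (hx : x ∈ Ω) :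
    g x = (jacobian (kerrMap φ) x).transpose
      * ((kerrE m a (kerrMap φ x)).transpose * kerrH m a (kerrMap φ x) * kerrE m a (kerrMap φ x))
      * jacobian (kerrMap φ) x := by
  rw [hg.metric_eq x hx, hg.jacobian_kerrMap hx, kerrBL_eq rfl (hg.mapsTo_kerrMap hx),
    Matrix.transpose_mul]
  simp only [Matrix.mul_assoc]
  rfl

theorem det_jacobian_kerrMap_ne (hg : IsKerr m a Ω φ g) {x : Coord} (hx : x ∈ Ω) :
    (jacobian (kerrMap φ) x).det ≠ 0 := by
  rw [hg.jacobian_kerrMap hx, Matrix.det_mul, Matrix.det_diagonal]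
  refine mul_ne_zero ?_ (hg.det_ne x hx)
  simpa [Fin.prod_univ_four] using (hg.mapsTo hx).2.2

theorem movingFrame (hg : IsKerr m a Ω φ g) :
    MovingFrame Ω g (carterFrame m a φ) (fun x => kerrH m a (kerrMap φ x))
      (pullConn (kerrMap φ) (kerrConn m a)) :=
  kerr_movingFrame.pullback hg.isOpen hg.contDiffOn_kerrMap
    (fun _ hx => hg.det_jacobian_kerrMap_ne hx) hg.mapsTo_kerrMap
    fun _ hx => hg.metric_eq_kerrMap hx

theorem isFrame (hg : IsKerr m a Ω φ g) {x : Coord} (hx : x ∈ Ω) :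
    IsFrame (g x) (carterFrame m a φ x) (kerrP m a (kerrMap φ x)) (kerrQ a (kerrMap φ x)) where
  metric_eq := by rw [hg.movingFrame.metric_eq x hx, kerrH_eq, frameMetric]
  det_ne := hg.movingFrame.det_E x hx
  p_ne := kerrP_ne_zero (hg.mapsTo_kerrMap hx)
  q_ne := kerrQ_ne_zero (hg.mapsTo_kerrMap hx)

/-- The curvature of a Kerr space-time. -/
theorem riemann_eq (hg : IsKerr m a Ω φ g) {x : Coord} (hx : x ∈ Ω) :
    riemann g x = biForm (kerrP m a (kerrMap φ x)) (kerrQ a (kerrMap φ x))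
      ![-2 * kerrPsi m a (kerrMap φ x), kerrPsi m a (kerrMap φ x), kerrPsi m a (kerrMap φ x)]
      (carterFrame m a φ x) (carterFrame m a φ x) := by
  funext b c d e
  rw [hg.movingFrame.riemann_eq hx, curvForm_pullConn hg.isOpen isOpen_kerrDomain
    hg.contDiffOn_kerrMap hg.mapsTo_kerrMap smoothOn_kerrConn hx]
  have h : ∀ i j, (kerrH m a (kerrMap φ x) * ∑ k, ∑ l, (jacobian (kerrMap φ) x k d
      * jacobian (kerrMap φ) x l e) • curvForm (kerrConn m a) k l (kerrMap φ x)) i j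
      = biForm (kerrP m a (kerrMap φ x)) (kerrQ a (kerrMap φ x))
      ![-2 * kerrPsi m a (kerrMap φ x), kerrPsi m a (kerrMap φ x), kerrPsi m a (kerrMap φ x)]
      1 (carterFrame m a φ x) i j d e := by
    intro i j
    rw [carterFrame, ← sum_biForm_right]
    simp only [Finset.mul_sum, Matrix.mul_smul, Matrix.sum_apply, Matrix.smul_apply, smul_eq_mul,
      kerr_curvForm (hg.mapsTo_kerrMap hx)]
  have h1 := sum_biForm_left (kerrP m a (kerrMap φ x)) (kerrQ a (kerrMap φ x))
    ![-2 * kerrPsi m a (kerrMap φ x), kerrPsi m a (kerrMap φ x), kerrPsi m a (kerrMap φ x)]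
    (carterFrame m a φ x) 1 (carterFrame m a φ x) b c d e
  rw [Matrix.one_mul] at h1
  rw [← h1]
  rw [Matrix.mul_apply, Finset.sum_congr rfl fun j _ => by rw [Matrix.mul_apply]]
  simp only [h, Matrix.transpose_apply, Finset.sum_mul]
  rw [Finset.sum_comm]
  exact Finset.sum_congr rfl fun i _ => Finset.sum_congr rfl fun j _ => by ring

end IsKerr

/-! ### The Weyl invariants of a Kerr space-time -/

/-- The orientation of the Carter coframe, as a sign. -/
def kerrSign (o : ℤˣ) (m a : ℝ) (φ : Coord → Coord) (x : Coord) : ℝ :=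
  frameSign o (carterFrame m a φ x) (kerrP m a (kerrMap φ x)) (kerrQ a (kerrMap φ x))

/-- The double 2-form on a Kerr space-time which acts on the self-dual bivectors with
eigenvalues `z`. -/
def kerrForm (m a : ℝ) (φ : Coord → Coord) (x : Coord) (z : Fin 3 → ℂ) : Tensor4 :=
  biForm (kerrP m a (kerrMap φ x)) (kerrQ a (kerrMap φ x)) z (carterFrame m a φ x)
    (carterFrame m a φ x)

theorem eventually_sign_eq {f : Coord → ℝ} {x : Coord} (hf : ContinuousAt f x) (h0 : f x ≠ 0) :
    ∀ᶠ y in nhds x, Real.sign (f y) = Real.sign (f x) := by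
  rcases lt_or_gt_of_ne h0 with h | h
  · filter_upwards [hf.eventually (gt_mem_nhds h)] with y hy
    rw [Real.sign_of_neg h, Real.sign_of_neg hy]
  · filter_upwards [hf.eventually (lt_mem_nhds h)] with y hy
    rw [Real.sign_of_pos h, Real.sign_of_pos hy]

/-- The complex coordinate `r + i a cos θ`. -/
def kerrW (a : ℝ) (φ : Coord → Coord) (x : Coord) : ℂ :=
  (kerrMap φ x 1 : ℂ) + (a * kerrMap φ x 2 : ℝ) * Complex.I

namespace IsKerr

variable {m a : ℝ} {Ω : Set Coord} {φ : Coord → Coord} {g : MetricField} {x : Coord}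

theorem kerrSign_mul_self (hg : IsKerr m a Ω φ g) (hx : x ∈ Ω) (o : ℤˣ) :
    kerrSign o m a φ x * kerrSign o m a φ x = 1 :=
  (hg.isFrame hx).frameSign_mul_self o

/-- The sign is locally constant, so that it does not contribute to the derivatives of `B`. -/
theorem eventually_kerrSign (hg : IsKerr m a Ω φ g) (hx : x ∈ Ω) (o : ℤˣ) :
    ∀ᶠ y in nhds x, kerrSign o m a φ y = kerrSign o m a φ x := by
  have hE := hg.movingFrame.smooth_E.det
  have hp := hg.movingFrame.smooth_h 1 1
  have hq := hg.movingFrame.smooth_h 2 2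
  have hc := (((hE.mul hp).mul hq).continuousOn).continuousAt (hg.isOpen.mem_nhds hx)
  have F := hg.isFrame hx
  filter_upwards [eventually_sign_eq hc
    (mul_ne_zero (mul_ne_zero F.det_ne F.p_ne) F.q_ne)] with y hy
  exact congrArg (((o : ℤ) : ℝ) * ·) hy

theorem weyl_eq (hg : IsKerr m a Ω φ g) (hx : x ∈ Ω) :
    weyl g x = kerrForm m a φ x
      ![-2 * kerrPsi m a (kerrMap φ x), kerrPsi m a (kerrMap φ x), kerrPsi m a (kerrMap φ x)] :=
  (hg.isFrame hx).weyl_eq (hg.riemann_eq hx) (by simp [Fin.sum_univ_three]; ring)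

theorem comp_kerrForm (hg : IsKerr m a Ω φ g) (hx : x ∈ Ω) (z z' : Fin 3 → ℂ) :
    comp g x (kerrForm m a φ x z) (kerrForm m a φ x z') = kerrForm m a φ x (z * z') :=
  (hg.isFrame hx).comp_biForm z z'

theorem trace2_kerrForm (hg : IsKerr m a Ω φ g) (hx : x ∈ Ω) (z : Fin 3 → ℂ) :
    trace2 g x (kerrForm m a φ x z) = 2 * (∑ A, z A).re :=
  (hg.isFrame hx).trace2_biForm z

theorem weylDual_eq (hg : IsKerr m a Ω φ g) (hx : x ∈ Ω) (o : ℤˣ) :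
    weylDual g o x = kerrForm m a φ x ((fun _ => kerrSign o m a φ x * Complex.I) *
      ![-2 * kerrPsi m a (kerrMap φ x), kerrPsi m a (kerrMap φ x), kerrPsi m a (kerrMap φ x)]) := by
  rw [weylDual, hg.weyl_eq hx, (hg.isFrame hx).volumeElt_eq o]
  exact hg.comp_kerrForm hx _ _

theorem invA_eq (hg : IsKerr m a Ω φ g) (hx : x ∈ Ω) :
    invA g x = 6 * (kerrPsi m a (kerrMap φ x) ^ 2).re := by
  rw [invA, hg.weyl_eq hx, hg.comp_kerrForm hx, hg.trace2_kerrForm hx]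
  simp [Fin.sum_univ_three, pow_two]
  ring

theorem invB_eq (hg : IsKerr m a Ω φ g) (hx : x ∈ Ω) (o : ℤˣ) :
    invB g o x = -6 * kerrSign o m a φ x * (kerrPsi m a (kerrMap φ x) ^ 2).im := by
  rw [invB, hg.weylDual_eq hx, hg.weyl_eq hx, hg.comp_kerrForm hx, hg.trace2_kerrForm hx]
  simp [Fin.sum_univ_three, pow_two]
  ring

theorem invD_eq (hg : IsKerr m a Ω φ g) (hx : x ∈ Ω) :
    invD g x = -6 * (kerrPsi m a (kerrMap φ x) ^ 3).re := by
  rw [invD, hg.weyl_eq hx, hg.comp_kerrForm hx, hg.comp_kerrForm hx, hg.trace2_kerrForm hx]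
  simp [Fin.sum_univ_three, pow_succ]
  ring

theorem invE_eq (hg : IsKerr m a Ω φ g) (hx : x ∈ Ω) (o : ℤˣ) :
    invE g o x = 6 * kerrSign o m a φ x * (kerrPsi m a (kerrMap φ x) ^ 3).im := by
  rw [invE, hg.weylDual_eq hx, hg.weyl_eq hx, hg.comp_kerrForm hx, hg.comp_kerrForm hx,
    hg.trace2_kerrForm hx]
  simp [Fin.sum_univ_three, pow_succ]
  ring

theorem normSq_kerrW (a : ℝ) (φ : Coord → Coord) (x : Coord) : Complex.normSq (kerrW a φ x)
    = kerrMap φ x 1 ^ 2 + a ^ 2 * kerrMap φ x 2 ^ 2 := by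
  rw [kerrW, Complex.normSq_add_mul_I]
  ring

theorem kerrW_ne_zero (hg : IsKerr m a Ω φ g) (hx : x ∈ Ω) : kerrW a φ x ≠ 0 := by
  intro h
  apply (hg.mapsTo_kerrMap hx).1
  rw [← normSq_kerrW, h, map_zero]

theorem kerrPsi_ne_zero (hg : IsKerr m a Ω φ g) (hx : x ∈ Ω) : kerrPsi m a (kerrMap φ x) ≠ 0 :=
  div_ne_zero (neg_ne_zero.2 (Complex.ofReal_ne_zero.2 hg.mass_pos.ne'))
    (pow_ne_zero 3 (hg.kerrW_ne_zero hx))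

theorem sq_add_sq_eq (hg : IsKerr m a Ω φ g) (hx : x ∈ Ω) (o : ℤˣ) :
    invA g x ^ 2 + invB g o x ^ 2 = 36 * Complex.normSq (kerrPsi m a (kerrMap φ x)) ^ 2 := by
  rw [hg.invA_eq hx, hg.invB_eq hx, ← map_pow, Complex.normSq_apply]
  linear_combination 36 * (kerrPsi m a (kerrMap φ x) ^ 2).im ^ 2 * hg.kerrSign_mul_self hx o

theorem invAlpha_eq (hg : IsKerr m a Ω φ g) (hx : x ∈ Ω) (o : ℤˣ) :
    invAlpha g o x = (kerrPsi m a (kerrMap φ x)).re := by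
  have h0 : Complex.normSq (kerrPsi m a (kerrMap φ x)) ≠ 0 := by
    simpa using hg.kerrPsi_ne_zero hx
  have hs := hg.kerrSign_mul_self hx o
  rw [invAlpha, hg.sq_add_sq_eq hx, hg.invA_eq hx, hg.invB_eq hx, hg.invD_eq hx, hg.invE_eq hx,
    ← neg_div, div_eq_iff (by positivity), Complex.normSq_apply]
  simp only [pow_succ, pow_zero, one_mul, Complex.mul_re, Complex.mul_im]
  set u := (kerrPsi m a (kerrMap φ x)).re
  set v := (kerrPsi m a (kerrMap φ x)).im
  linear_combination (36 * (2 * u * v) * (3 * u ^ 2 * v - v ^ 3)) * hs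

theorem invBeta_eq (hg : IsKerr m a Ω φ g) (hx : x ∈ Ω) (o : ℤˣ) :
    invBeta g o x = kerrSign o m a φ x * (kerrPsi m a (kerrMap φ x)).im := by
  have h0 : Complex.normSq (kerrPsi m a (kerrMap φ x)) ≠ 0 := by
    simpa using hg.kerrPsi_ne_zero hx
  rw [invBeta, hg.sq_add_sq_eq hx, hg.invA_eq hx, hg.invB_eq hx, hg.invD_eq hx, hg.invE_eq hx,
    div_eq_iff (by positivity), Complex.normSq_apply]
  simp only [pow_succ, pow_zero, one_mul, Complex.mul_re, Complex.mul_im]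
  ring

/-! ### The 1-forms `R` and `Θ` -/

theorem hasFDerivAt_kerrW (hg : IsKerr m a Ω φ g) (hx : x ∈ Ω) :
    ∃ L : Coord →L[ℝ] ℂ, HasFDerivAt (kerrW a φ) L x ∧
      ∀ b, L (Pi.single b 1) = (jacobian (kerrMap φ) x 1 b : ℂ)
        + (a * jacobian (kerrMap φ) x 2 b : ℝ) * Complex.I := by
  have hd := hg.differentiableAt_kerrMap hx
  have h : ∀ i, HasFDerivAt (fun y => kerrMap φ y i) (fderiv ℝ (fun y => kerrMap φ y i) x) x :=
    fun i => (differentiableAt_pi.1 hd i).hasFDerivAt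
  have h1 := (Complex.ofRealCLM.hasFDerivAt (x := kerrMap φ x 1)).comp x (h 1)
  have h2 := (Complex.ofRealCLM.hasFDerivAt (x := a * kerrMap φ x 2)).comp x ((h 2).const_mul a)
  refine ⟨_, h1.add (h2.mul_const Complex.I), fun b => ?_⟩
  rw [jacobian_apply hd, jacobian_apply hd]
  simp [pd]
  ring

theorem hasFDerivAt_kerrPsi_sq (hg : IsKerr m a Ω φ g) (hx : x ∈ Ω) :
    ∃ L : Coord →L[ℝ] ℂ, HasFDerivAt (fun y => kerrPsi m a (kerrMap φ y) ^ 2) L x ∧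
      ∀ b, L (Pi.single b 1) = kerrPsi m a (kerrMap φ x) ^ 2 *
        (-6 * (((jacobian (kerrMap φ) x 1 b : ℂ)
          + (a * jacobian (kerrMap φ) x 2 b : ℝ) * Complex.I) / kerrW a φ x)) := by
  obtain ⟨L, hL, hLb⟩ := hg.hasFDerivAt_kerrW hx
  have hw := hg.kerrW_ne_zero hx
  have hf : HasDerivAt (fun w : ℂ => (-(m : ℂ) / w ^ 3) ^ 2)
      ((-(m : ℂ) / kerrW a φ x ^ 3) ^ 2 * (-6 / kerrW a φ x)) (kerrW a φ x) := by
    have h := ((hasDerivAt_const (kerrW a φ x) (-(m : ℂ))).div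
      (hasDerivAt_pow 3 (kerrW a φ x)) (pow_ne_zero 3 hw)).pow 2
    refine (h.congr_deriv ?_ :)
    simp only [Pi.div_apply]
    push_cast
    field_simp
    ring
  refine ⟨_, (hf.hasFDerivAt.restrictScalars ℝ).comp x hL, fun b => ?_⟩
  simp only [ContinuousLinearMap.comp_apply, hLb]
  simp [kerrPsi, kerrW]
  ring

theorem pd_invA (hg : IsKerr m a Ω φ g) (hx : x ∈ Ω) (b : Fin 4) :
    pd b (invA g) x = 6 * (kerrPsi m a (kerrMap φ x) ^ 2 *
        (-6 * (((jacobian (kerrMap φ) x 1 b : ℂ)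
          + (a * jacobian (kerrMap φ) x 2 b : ℝ) * Complex.I) / kerrW a φ x))).re := by
  obtain ⟨L, hL, hLb⟩ := hg.hasFDerivAt_kerrPsi_sq hx
  have h : invA g =ᶠ[nhds x] fun y => 6 * (kerrPsi m a (kerrMap φ y) ^ 2).re :=
    Filter.eventually_of_mem (hg.isOpen.mem_nhds hx) fun y hy => hg.invA_eq hy
  have h1 := ((Complex.reCLM.hasFDerivAt (x := kerrPsi m a (kerrMap φ x) ^ 2)).comp x hL).const_mul
    (6 : ℝ)
  rw [pd_congr h, ← hLb]
  unfold pd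
  exact congrArg (fun M : Coord →L[ℝ] ℝ => M (Pi.single b 1)) h1.fderiv

theorem pd_invB (hg : IsKerr m a Ω φ g) (hx : x ∈ Ω) (o : ℤˣ) (b : Fin 4) :
    pd b (invB g o) x = -6 * kerrSign o m a φ x * (kerrPsi m a (kerrMap φ x) ^ 2 *
        (-6 * (((jacobian (kerrMap φ) x 1 b : ℂ)
          + (a * jacobian (kerrMap φ) x 2 b : ℝ) * Complex.I) / kerrW a φ x))).im := by
  obtain ⟨L, hL, hLb⟩ := hg.hasFDerivAt_kerrPsi_sq hx
  have h : invB g o =ᶠ[nhds x]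
      fun y => -6 * kerrSign o m a φ x * (kerrPsi m a (kerrMap φ y) ^ 2).im := by
    filter_upwards [hg.isOpen.mem_nhds hx, hg.eventually_kerrSign hx o] with y hy hs
    rw [hg.invB_eq hy, hs]
  have h1 := ((Complex.imCLM.hasFDerivAt (x := kerrPsi m a (kerrMap φ x) ^ 2)).comp x hL).const_mul
    (-6 * kerrSign o m a φ x)
  rw [pd_congr h, ← hLb]
  unfold pd
  exact congrArg (fun M : Coord →L[ℝ] ℝ => M (Pi.single b 1)) h1.fderiv

theorem jacobian_kerrMap_one (hg : IsKerr m a Ω φ g) (hx : x ∈ Ω) (b : Fin 4) :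
    jacobian (kerrMap φ) x 1 b = kerrP m a (kerrMap φ x) * carterFrame m a φ x 1 b := by
  have h := hg.mapsTo_kerrMap hx
  have h1 := h.1
  have h2 := h.2.1
  have hE : carterFrame m a φ x 1 b = (kerrMap φ x 1 ^ 2 + a ^ 2 * kerrMap φ x 2 ^ 2)
      * invDelta m a (kerrMap φ x) * jacobian (kerrMap φ) x 1 b := by
    simp [carterFrame, kerrE, Matrix.mul_apply, Fin.sum_univ_four]
  rw [hE, kerrP, invDelta, invS]
  generalize kerrMap φ x 1 ^ 2 + a ^ 2 * kerrMap φ x 2 ^ 2 = S at *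
  generalize kerrMap φ x 1 ^ 2 - 2 * m * kerrMap φ x 1 + a ^ 2 = Δ at *
  field_simp

theorem jacobian_kerrMap_two (hg : IsKerr m a Ω φ g) (hx : x ∈ Ω) (b : Fin 4) :
    jacobian (kerrMap φ) x 2 b = kerrQ a (kerrMap φ x) * carterFrame m a φ x 2 b := by
  have h := hg.mapsTo_kerrMap hx
  have h1 := h.1
  have h2 := h.2.2
  have hE : carterFrame m a φ x 2 b = (kerrMap φ x 1 ^ 2 + a ^ 2 * kerrMap φ x 2 ^ 2)
      * invY (kerrMap φ x) * jacobian (kerrMap φ) x 2 b := by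
    simp [carterFrame, kerrE, Matrix.mul_apply, Fin.sum_univ_four]
  rw [hE, kerrQ, invY, invS]
  generalize kerrMap φ x 1 ^ 2 + a ^ 2 * kerrMap φ x 2 ^ 2 = S at *
  generalize 1 - kerrMap φ x 2 ^ 2 = Y at *
  field_simp

/-- `R` is the real part of `(1/3) d log ψ²`, expanded in the Carter coframe. -/
theorem formR_eq (hg : IsKerr m a Ω φ g) (hx : x ∈ Ω) (o : ℤˣ) (b : Fin 4) :
    formR g o x b
      = -2 * (kerrMap φ x 1 * kerrP m a (kerrMap φ x) * invS a (kerrMap φ x))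
          * carterFrame m a φ x 1 b
        + -2 * (a ^ 2 * kerrMap φ x 2 * kerrQ a (kerrMap φ x) * invS a (kerrMap φ x))
          * carterFrame m a φ x 2 b := by
  have h0 : Complex.normSq (kerrPsi m a (kerrMap φ x) ^ 2) ≠ 0 := by
    simpa using hg.kerrPsi_ne_zero hx
  have hs := hg.kerrSign_mul_self hx o
  have hre : formR g o x b = -2 * ((((jacobian (kerrMap φ) x 1 b : ℂ)
          + (a * jacobian (kerrMap φ) x 2 b : ℝ) * Complex.I) / kerrW a φ x)).re := by
    rw [formR, hg.sq_add_sq_eq hx, hg.pd_invA hx, hg.pd_invB hx, hg.invA_eq hx, hg.invB_eq hx,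
      ← map_pow, div_eq_iff (by positivity)]
    generalize ((jacobian (kerrMap φ) x 1 b : ℂ)
          + (a * jacobian (kerrMap φ) x 2 b : ℝ) * Complex.I) / kerrW a φ x = c
    rw [Complex.normSq_apply]
    simp only [Complex.mul_re (_ ^ 2), Complex.mul_im (_ ^ 2)]
    have e1 : (-6 * c).re = -6 * c.re := by simp
    have e2 : (-6 * c).im = -6 * c.im := by simp
    rw [e1, e2]
    set u := (kerrPsi m a (kerrMap φ x) ^ 2).re
    set v := (kerrPsi m a (kerrMap φ x) ^ 2).im
    linear_combination (-216 * v * (u * c.im + v * c.re)) * hs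
  rw [hre, Complex.div_re, normSq_kerrW, hg.jacobian_kerrMap_one hx, hg.jacobian_kerrMap_two hx]
  simp [kerrW, invS]
  ring

/-- `Θ` is, up to the sign `kerrSign`, the imaginary part of `(1/3) d log ψ²`. -/
theorem formTheta_eq (hg : IsKerr m a Ω φ g) (hx : x ∈ Ω) (o : ℤˣ) (b : Fin 4) :
    formTheta g o x b
      = 2 * kerrSign o m a φ x * (a * kerrMap φ x 2 * kerrP m a (kerrMap φ x)
          * invS a (kerrMap φ x)) * carterFrame m a φ x 1 b
        + -2 * kerrSign o m a φ x * (a * kerrMap φ x 1 * kerrQ a (kerrMap φ x)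
          * invS a (kerrMap φ x)) * carterFrame m a φ x 2 b := by
  have h0 : Complex.normSq (kerrPsi m a (kerrMap φ x) ^ 2) ≠ 0 := by
    simpa using hg.kerrPsi_ne_zero hx
  have him : formTheta g o x b = -2 * kerrSign o m a φ x * ((((jacobian (kerrMap φ) x 1 b : ℂ)
          + (a * jacobian (kerrMap φ) x 2 b : ℝ) * Complex.I) / kerrW a φ x)).im := by
    rw [formTheta, hg.sq_add_sq_eq hx, hg.pd_invA hx, hg.pd_invB hx, hg.invA_eq hx,
      hg.invB_eq hx, ← map_pow, div_eq_iff (by positivity)]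
    generalize ((jacobian (kerrMap φ) x 1 b : ℂ)
          + (a * jacobian (kerrMap φ) x 2 b : ℝ) * Complex.I) / kerrW a φ x = c
    rw [Complex.normSq_apply]
    simp only [Complex.mul_re (_ ^ 2), Complex.mul_im (_ ^ 2)]
    have e1 : (-6 * c).re = -6 * c.re := by simp
    have e2 : (-6 * c).im = -6 * c.im := by simp
    rw [e1, e2]
    ring
  rw [him, Complex.div_im, normSq_kerrW, hg.jacobian_kerrMap_one hx, hg.jacobian_kerrMap_two hx]
  simp [kerrW, invS]
  ring

end IsKerr

/-! ### The scalar invariants -/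

theorem IsFrame.coprod_eq {g : MetricField} {x : Coord} {E : Matrix (Fin 4) (Fin 4) ℝ} {p q : ℝ}
    (F : IsFrame (g x) E p q) {u v : Coord} {u₁ u₂ v₁ v₂ : ℝ}
    (hu : ∀ b, u b = u₁ * E 1 b + u₂ * E 2 b) (hv : ∀ b, v b = v₁ * E 1 b + v₂ * E 2 b) :
    coprod g x u v = p⁻¹ * u₁ * v₁ + q⁻¹ * u₂ * v₂ := by
  have h : coprod g x u v = u₁ * v₁ * (∑ a, ∑ b, (g x)⁻¹ a b * E 1 a * E 1 b)
      + u₁ * v₂ * (∑ a, ∑ b, (g x)⁻¹ a b * E 1 a * E 2 b)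
      + u₂ * v₁ * (∑ a, ∑ b, (g x)⁻¹ a b * E 2 a * E 1 b)
      + u₂ * v₂ * (∑ a, ∑ b, (g x)⁻¹ a b * E 2 a * E 2 b) := by
    simp only [coprod, hu, hv, Finset.mul_sum, ← Finset.sum_add_distrib]
    exact Finset.sum_congr rfl fun a _ => Finset.sum_congr rfl fun b _ => by ring
  rw [h]
  simp only [F.sum_inv]
  simp [frameMetric]
  ring

/-- `± a cos θ`, with the sign of the orientation of the Carter coframe. -/
def kerrTau (o : ℤˣ) (m a : ℝ) (φ : Coord → Coord) (x : Coord) : ℝ :=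
  kerrSign o m a φ x * (a * kerrMap φ x 2)

/-- `r² + a² cos² θ`. -/
def kerrS (a : ℝ) (φ : Coord → Coord) (x : Coord) : ℝ :=
  kerrMap φ x 1 ^ 2 + a ^ 2 * kerrMap φ x 2 ^ 2

/-- `(r² - 2 m r + a² cos² θ) / (r² + a² cos² θ)`. -/
def kerrN (m a : ℝ) (φ : Coord → Coord) (x : Coord) : ℝ :=
  (kerrMap φ x 1 ^ 2 - 2 * m * kerrMap φ x 1 + (a * kerrMap φ x 2) ^ 2) / kerrS a φ x

/-- `kerrN` is minus the square norm of `∂_t`. -/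
theorem kerrN_eq (m a : ℝ) (φ : Coord → Coord) (x : Coord) :
    kerrP m a (kerrMap φ x) - a ^ 2 * kerrQ a (kerrMap φ x) = kerrN m a φ x := by
  rw [kerrP, kerrQ, invS, kerrN, kerrS]
  ring

theorem invS_kerrMap (a : ℝ) (φ : Coord → Coord) (x : Coord) :
    invS a (kerrMap φ x) = (kerrS a φ x)⁻¹ := rfl

namespace IsKerr

variable {m a : ℝ} {Ω : Set Coord} {φ : Coord → Coord} {g : MetricField} {x : Coord} {o : ℤˣ}

theorem kerrS_ne_zero (hg : IsKerr m a Ω φ g) (hx : x ∈ Ω) : kerrS a φ x ≠ 0 :=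
  (hg.mapsTo_kerrMap hx).1

theorem kerrS_pos (hg : IsKerr m a Ω φ g) (hx : x ∈ Ω) : 0 < kerrS a φ x :=
  lt_of_le_of_ne (by unfold kerrS; positivity) (hg.kerrS_ne_zero hx).symm

theorem kerrTau_sq (hg : IsKerr m a Ω φ g) (hx : x ∈ Ω) (o : ℤˣ) :
    kerrTau o m a φ x ^ 2 = (a * kerrMap φ x 2) ^ 2 := by
  rw [kerrTau, mul_pow, pow_two (kerrSign o m a φ x), hg.kerrSign_mul_self hx, one_mul]

theorem kerrS_eq (hg : IsKerr m a Ω φ g) (hx : x ∈ Ω) (o : ℤˣ) :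
    kerrS a φ x = kerrMap φ x 1 ^ 2 + kerrTau o m a φ x ^ 2 := by
  rw [hg.kerrTau_sq hx, kerrS, mul_pow]

theorem invAlpha_eq_div (hg : IsKerr m a Ω φ g) (hx : x ∈ Ω) (o : ℤˣ) :
    invAlpha g o x = -(m * kerrMap φ x 1 * (kerrMap φ x 1 ^ 2 - 3 * kerrTau o m a φ x ^ 2)
      / kerrS a φ x ^ 3) := by
  rw [hg.invAlpha_eq hx, kerrPsi_re (hg.mapsTo_kerrMap hx), hg.kerrTau_sq hx, invS_kerrMap]
  ring

theorem invBeta_eq_div (hg : IsKerr m a Ω φ g) (hx : x ∈ Ω) (o : ℤˣ) :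
    invBeta g o x = m * kerrTau o m a φ x * (3 * kerrMap φ x 1 ^ 2 - kerrTau o m a φ x ^ 2)
      / kerrS a φ x ^ 3 := by
  rw [hg.invBeta_eq hx, kerrPsi_im (hg.mapsTo_kerrMap hx), hg.kerrTau_sq hx, invS_kerrMap, kerrTau]
  ring

theorem sqR_eq (hg : IsKerr m a Ω φ g) (hx : x ∈ Ω) (o : ℤˣ) :
    sqR g o x = 4 * (kerrMap φ x 1 ^ 2 * kerrP m a (kerrMap φ x)
      + a ^ 4 * kerrMap φ x 2 ^ 2 * kerrQ a (kerrMap φ x)) / kerrS a φ x ^ 2 := by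
  have hp := (hg.isFrame hx).p_ne
  have hq := (hg.isFrame hx).q_ne
  rw [sqR, (hg.isFrame hx).coprod_eq (hg.formR_eq hx o) (hg.formR_eq hx o), invS, kerrS]
  field_simp
  ring

theorem sqTheta_eq (hg : IsKerr m a Ω φ g) (hx : x ∈ Ω) (o : ℤˣ) :
    sqTheta g o x = 4 * a ^ 2 * (kerrMap φ x 2 ^ 2 * kerrP m a (kerrMap φ x)
      + kerrMap φ x 1 ^ 2 * kerrQ a (kerrMap φ x)) / kerrS a φ x ^ 2 := by
  have hp := (hg.isFrame hx).p_ne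
  have hq := (hg.isFrame hx).q_ne
  have hs : kerrSign o m a φ x ^ 2 = 1 := by rw [pow_two, hg.kerrSign_mul_self hx]
  rw [sqTheta, (hg.isFrame hx).coprod_eq (hg.formTheta_eq hx o) (hg.formTheta_eq hx o), invS, kerrS]
  field_simp
  rw [hs]
  ring

theorem prodRTheta_eq (hg : IsKerr m a Ω φ g) (hx : x ∈ Ω) (o : ℤˣ) :
    prodRTheta g o x
      = -(4 * kerrMap φ x 1 * kerrTau o m a φ x * kerrN m a φ x) / kerrS a φ x ^ 2 := by
  have hp := (hg.isFrame hx).p_ne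
  have hq := (hg.isFrame hx).q_ne
  rw [prodRTheta, (hg.isFrame hx).coprod_eq (hg.formR_eq hx o) (hg.formTheta_eq hx o), invS,
    ← kerrN_eq m a φ x, kerrS, kerrTau]
  field_simp
  ring

theorem sqR_sub_sqTheta (hg : IsKerr m a Ω φ g) (hx : x ∈ Ω) (o : ℤˣ) :
    sqR g o x - sqTheta g o x
      = 4 * (kerrMap φ x 1 ^ 2 - kerrTau o m a φ x ^ 2) * kerrN m a φ x / kerrS a φ x ^ 2 := by
  rw [hg.sqR_eq hx, hg.sqTheta_eq hx, ← kerrN_eq m a φ x, hg.kerrTau_sq hx]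
  ring

/-- The inequalities which hold at the points where all the invariants are defined. -/
structure Generic (o : ℤˣ) (m a : ℝ) (φ : Coord → Coord) (x : Coord) : Prop where
  r_ne : kerrMap φ x 1 ≠ 0
  third_ne : kerrMap φ x 1 ^ 2 - 3 * kerrTau o m a φ x ^ 2 ≠ 0
  diff_ne : kerrMap φ x 1 ^ 2 - kerrTau o m a φ x ^ 2 ≠ 0
  n_ne : kerrN m a φ x ≠ 0

theorem generic_of_regular (hg : IsKerr m a Ω φ g) (hx : x ∈ Ω) (h : Regular g o x) :
    Generic o m a φ x := by
  have h1 := h.alpha_ne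
  have h2 := h.diff_ne
  rw [hg.invAlpha_eq_div hx] at h1
  rw [hg.sqR_sub_sqTheta hx] at h2
  refine ⟨fun h0 => h1 ?_, fun h0 => h1 ?_, fun h0 => h2 ?_, fun h0 => h2 ?_⟩ <;> rw [h0] <;> simp

theorem invK_eq (hg : IsKerr m a Ω φ g) (hx : x ∈ Ω) (h : Generic o m a φ x) :
    invK g o x = -(2 * kerrMap φ x 1 * kerrTau o m a φ x)
      / (kerrMap φ x 1 ^ 2 - kerrTau o m a φ x ^ 2) := by
  have h1 := h.diff_ne
  have h2 := h.n_ne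
  have hS := hg.kerrS_ne_zero hx
  rw [invK, hg.prodRTheta_eq hx, hg.sqR_sub_sqTheta hx]
  field_simp

theorem invT_eq (hg : IsKerr m a Ω φ g) (hx : x ∈ Ω) (h : Generic o m a φ x) :
    invT g o x = -(kerrTau o m a φ x * (3 * kerrMap φ x 1 ^ 2 - kerrTau o m a φ x ^ 2))
      / (kerrMap φ x 1 * (kerrMap φ x 1 ^ 2 - 3 * kerrTau o m a φ x ^ 2)) := by
  have h1 := h.r_ne
  have h2 := h.third_ne
  have hS := hg.kerrS_ne_zero hx
  have hm := hg.mass_pos.ne'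
  rw [invT, hg.invAlpha_eq_div hx, hg.invBeta_eq_div hx]
  field_simp

theorem invLambda_den_eq (hg : IsKerr m a Ω φ g) (hx : x ∈ Ω) (h : Generic o m a φ x) :
    invK g o x ^ 2 - 3 * invK g o x * invT g o x - 2
      = -(2 * kerrS a φ x ^ 2 * kerrMap φ x 1 ^ 2)
        / ((kerrMap φ x 1 ^ 2 - kerrTau o m a φ x ^ 2) ^ 2
          * (kerrMap φ x 1 ^ 2 - 3 * kerrTau o m a φ x ^ 2)) := by
  have h1 := h.r_ne
  have h2 := h.third_ne
  have h3 := h.diff_ne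
  rw [hg.invK_eq hx h, hg.invT_eq hx h, hg.kerrS_eq hx o]
  generalize kerrMap φ x 1 = r at *
  generalize kerrTau o m a φ x = t at *
  generalize hu : r ^ 2 - 3 * t ^ 2 = u at *
  generalize hv : r ^ 2 - t ^ 2 = v at *
  field_simp
  subst hu hv
  ring

theorem invLambda_eq (hg : IsKerr m a Ω φ g) (hx : x ∈ Ω) (h : Generic o m a φ x) :
    invLambda g o x = kerrTau o m a φ x / kerrMap φ x 1 := by
  have h1 := h.r_ne
  have h2 := h.third_ne
  have h3 := h.diff_ne
  have hS := hg.kerrS_ne_zero hx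
  rw [invLambda, hg.invLambda_den_eq hx h, hg.invK_eq hx h, hg.invT_eq hx h]
  rw [hg.kerrS_eq hx o] at *
  generalize kerrMap φ x 1 = r at *
  generalize kerrTau o m a φ x = t at *
  generalize hu : r ^ 2 - 3 * t ^ 2 = u at *
  generalize hv : r ^ 2 - t ^ 2 = v at *
  field_simp
  subst hu hv
  ring

theorem regular_of_generic (hg : IsKerr m a Ω φ g) (hx : x ∈ Ω) (h : Generic o m a φ x) :
    Regular g o x where
  sq_ne := by
    have h0 : Complex.normSq (kerrPsi m a (kerrMap φ x)) ≠ 0 := by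
      simpa using hg.kerrPsi_ne_zero hx
    rw [hg.sq_add_sq_eq hx]
    positivity
  alpha_ne := by
    rw [hg.invAlpha_eq_div hx]
    exact neg_ne_zero.2 (div_ne_zero (mul_ne_zero (mul_ne_zero hg.mass_pos.ne' h.r_ne) h.third_ne)
      (pow_ne_zero 3 (hg.kerrS_ne_zero hx)))
  diff_ne := by
    rw [hg.sqR_sub_sqTheta hx]
    exact div_ne_zero (mul_ne_zero (mul_ne_zero four_ne_zero h.diff_ne) h.n_ne)
      (pow_ne_zero 2 (hg.kerrS_ne_zero hx))
  den_ne := by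
    rw [hg.invLambda_den_eq hx h]
    exact div_ne_zero (neg_ne_zero.2 (mul_ne_zero (mul_ne_zero two_ne_zero
      (pow_ne_zero 2 (hg.kerrS_ne_zero hx))) (pow_ne_zero 2 h.r_ne)))
      (mul_ne_zero (pow_ne_zero 2 h.diff_ne) h.third_ne)
  lambda_ne := by
    have h1 := h.r_ne
    rw [hg.invLambda_eq hx h, div_pow, div_sub_one (pow_ne_zero 2 h1)]
    exact div_ne_zero (fun h0 => h.diff_ne (by linear_combination -h0)) (pow_ne_zero 2 h1)
  lambda_ne_third := by
    have h1 := h.r_ne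
    rw [hg.invLambda_eq hx h, div_pow, ← mul_div_assoc, div_sub_one (pow_ne_zero 2 h1)]
    exact div_ne_zero (fun h0 => h.third_ne (by linear_combination -h0)) (pow_ne_zero 2 h1)

theorem regular_iff (hg : IsKerr m a Ω φ g) (hx : x ∈ Ω) :
    Regular g o x ↔ (φ x 1 ≠ 0 ∧ φ x 1 ^ 2 ≠ 3 * (a * Real.cos (φ x 2)) ^ 2 ∧
        φ x 1 ^ 2 ≠ (a * Real.cos (φ x 2)) ^ 2 ∧
        φ x 1 ^ 2 - 2 * m * φ x 1 + (a * Real.cos (φ x 2)) ^ 2 ≠ 0) := by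
  have ht : kerrTau o m a φ x ^ 2 = (a * Real.cos (φ x 2)) ^ 2 := hg.kerrTau_sq hx o
  have hr : kerrMap φ x 1 = φ x 1 := rfl
  constructor
  · intro h
    have hG := hg.generic_of_regular hx h
    refine ⟨hG.r_ne, ?_, ?_, fun h0 => hG.n_ne ?_⟩
    · rw [← ht]; exact sub_ne_zero.1 hG.third_ne
    · rw [← ht]; exact sub_ne_zero.1 hG.diff_ne
    · exact div_eq_zero_iff.2 (Or.inl h0)
  · rintro ⟨h1, h2, h3, h4⟩
    rw [← ht] at h2 h3
    exact hg.regular_of_generic hx ⟨h1, sub_ne_zero.2 h2, sub_ne_zero.2 h3,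
      div_ne_zero h4 (hg.kerrS_ne_zero hx)⟩

theorem invSigma_eq (hg : IsKerr m a Ω φ g) (hx : x ∈ Ω) (h : Generic o m a φ x) :
    invSigma g o x = kerrMap φ x 1 ^ 2 / kerrS a φ x ^ 2 := by
  have h1 := h.r_ne
  have h2 := h.third_ne
  have h3 := h.diff_ne
  have h2' : 3 * kerrTau o m a φ x ^ 2 - kerrMap φ x 1 ^ 2 ≠ 0 :=
    fun h0 => h2 (by linear_combination -h0)
  have h3' : kerrTau o m a φ x ^ 2 - kerrMap φ x 1 ^ 2 ≠ 0 :=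
    fun h0 => h3 (by linear_combination -h0)
  have hS := hg.kerrS_ne_zero hx
  have e1 : 3 * invLambda g o x ^ 2 - 1
      = (3 * kerrTau o m a φ x ^ 2 - kerrMap φ x 1 ^ 2) / kerrMap φ x 1 ^ 2 := by
    rw [hg.invLambda_eq hx h]
    field_simp
  have e2 : invLambda g o x ^ 2 - 1
      = (kerrTau o m a φ x ^ 2 - kerrMap φ x 1 ^ 2) / kerrMap φ x 1 ^ 2 := by
    rw [hg.invLambda_eq hx h]
    field_simp
  have e3 : 2 * invAlpha g o x / (3 * invLambda g o x ^ 2 - 1)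
      = 2 * m * kerrMap φ x 1 ^ 3 / kerrS a φ x ^ 3 := by
    rw [e1, hg.invAlpha_eq_div hx]
    field_simp
    ring
  have e4 : (sqR g o x - sqTheta g o x) / (4 * (invLambda g o x ^ 2 - 1))
      = -(kerrMap φ x 1 ^ 2 * kerrN m a φ x / kerrS a φ x ^ 2) := by
    rw [e2, hg.sqR_sub_sqTheta hx]
    field_simp
    ring
  rw [invSigma, e3, e4, kerrN, ← hg.kerrTau_sq hx o]
  field_simp
  rw [hg.kerrS_eq hx o]
  ring

theorem invSigma_pos (hg : IsKerr m a Ω φ g) (hx : x ∈ Ω) (h : Generic o m a φ x) :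
    0 < invSigma g o x := by
  have h1 := h.r_ne
  have hS := hg.kerrS_pos hx
  rw [hg.invSigma_eq hx h]
  positivity

theorem sqrt_invSigma (hg : IsKerr m a Ω φ g) (hx : x ∈ Ω) (h : Generic o m a φ x) :
    √(invSigma g o x) = |kerrMap φ x 1| / kerrS a φ x := by
  rw [hg.invSigma_eq hx h, ← div_pow, Real.sqrt_sq_eq_abs, abs_div, abs_of_pos (hg.kerrS_pos hx)]

theorem mass_eq (hg : IsKerr m a Ω φ g) (hx : x ∈ Ω) (h : Generic o m a φ x) :
    m = |invAlpha g o x| /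
      (invSigma g o x * √(invSigma g o x) * |3 * invLambda g o x ^ 2 - 1|) := by
  have hS := hg.kerrS_pos hx
  have hr := abs_ne_zero.2 h.r_ne
  have h2 := abs_ne_zero.2 h.third_ne
  have h3 : 3 * invLambda g o x ^ 2 - 1
      = -((kerrMap φ x 1 ^ 2 - 3 * kerrTau o m a φ x ^ 2) / kerrMap φ x 1 ^ 2) := by
    have h1 := h.r_ne
    rw [hg.invLambda_eq hx h]
    field_simp
    ring
  rw [hg.sqrt_invSigma hx h, hg.invSigma_eq hx h, h3, hg.invAlpha_eq_div hx, abs_neg, abs_neg,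
    abs_div, abs_div, abs_mul, abs_mul, abs_of_pos hg.mass_pos, abs_of_pos (pow_pos hS 3), abs_pow,
    ← sq_abs (kerrMap φ x 1)]
  rw [← sq_abs (kerrMap φ x 1)] at h2
  field_simp

theorem radicand_eq (hg : IsKerr m a Ω φ g) (hx : x ∈ Ω) (h : Generic o m a φ x) :
    radicand g o x = (2 * a / kerrS a φ x) ^ 2 := by
  have h1 := h.r_ne
  have hS := hg.kerrS_ne_zero hx
  have e1 : invLambda g o x * prodRTheta g o x
      = -(4 * (a * kerrMap φ x 2) ^ 2 * kerrN m a φ x) / kerrS a φ x ^ 2 := by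
    rw [hg.invLambda_eq hx h, hg.prodRTheta_eq hx, ← hg.kerrTau_sq hx o]
    field_simp
  have e2 : 4 * invSigma g o x * invLambda g o x ^ 2
      = 4 * (a * kerrMap φ x 2) ^ 2 / kerrS a φ x ^ 2 := by
    rw [hg.invLambda_eq hx h, hg.invSigma_eq hx h, ← hg.kerrTau_sq hx o]
    field_simp
  have e3 : kerrQ a (kerrMap φ x) * kerrS a φ x = 1 - kerrMap φ x 2 ^ 2 := by
    rw [kerrQ, invS]
    exact inv_mul_cancel_right₀ hS _
  rw [radicand, e1, e2, hg.sqTheta_eq hx, ← kerrN_eq m a φ x]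
  field_simp
  rw [kerrS] at e3
  linear_combination (4 * a ^ 2) * e3

theorem ang_eq (hg : IsKerr m a Ω φ g) (hx : x ∈ Ω) (h : Generic o m a φ x) :
    a = √(radicand g o x) / (2 * invSigma g o x * (1 + invLambda g o x ^ 2)) := by
  have h1 := h.r_ne
  have hS := hg.kerrS_pos hx
  have e : 1 + invLambda g o x ^ 2 = kerrS a φ x / kerrMap φ x 1 ^ 2 := by
    rw [hg.invLambda_eq hx h, hg.kerrS_eq hx o]
    field_simp
  rw [hg.radicand_eq hx h, Real.sqrt_sq (div_nonneg (mul_nonneg zero_le_two hg.ang_nonneg) hS.le),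
    hg.invSigma_eq hx h, e]
  field_simp

end IsKerr

/-! ### The tensor `Ξ` -/

theorem biForm_lin (p q : ℝ) (z z' z'' : Fin 3 → ℂ) (E E' : Matrix (Fin 4) (Fin 4) ℝ)
    (c c' c'' : ℝ) (i j k l : Fin 4) :
    c * biForm p q z E E' i j k l + c' * biForm p q z' E E' i j k l
        + c'' * biForm p q z'' E E' i j k l
      = biForm p q ((c : ℂ) • z + (c' : ℂ) • z' + (c'' : ℂ) • z'') E E' i j k l := by
  simp only [biForm, Finset.mul_sum, ← Finset.sum_add_distrib]
  refine Finset.sum_congr rfl fun A _ => ?_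
  simp only [Pi.add_apply, Pi.smul_apply, smul_eq_mul, Complex.add_re, Complex.add_im,
    Complex.re_ofReal_mul, Complex.im_ofReal_mul]
  ring

namespace IsFrame

variable {g : MetricField} {x : Coord} {E : Matrix (Fin 4) (Fin 4) ℝ} {p q : ℝ}

theorem sum_mul_raise (F : IsFrame (g x) E p q) {u : Coord} {u₁ u₂ : ℝ}
    (hu : ∀ b, u b = u₁ * E 1 b + u₂ * E 2 b) (i : Fin 4) :
    ∑ m, E i m * raise g x u m
      = u₁ * frameMetric p⁻¹ q⁻¹ i 1 + u₂ * frameMetric p⁻¹ q⁻¹ i 2 := by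
  simp only [← F.sum_inv, raise, hu, Finset.mul_sum, ← Finset.sum_add_distrib]
  exact Finset.sum_congr rfl fun m _ => Finset.sum_congr rfl fun b _ => by ring

theorem twoForm_raise (F : IsFrame (g x) E p q) {u : Coord} {u₁ u₂ : ℝ}
    (hu : ∀ b, u b = u₁ * E 1 b + u₂ * E 2 b) (i j a : Fin 4) :
    ∑ m, twoForm i j E a m * raise g x u m
      = E i a * (u₁ * frameMetric p⁻¹ q⁻¹ j 1 + u₂ * frameMetric p⁻¹ q⁻¹ j 2)
        - E j a * (u₁ * frameMetric p⁻¹ q⁻¹ i 1 + u₂ * frameMetric p⁻¹ q⁻¹ i 2) := by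
  rw [← F.sum_mul_raise hu, ← F.sum_mul_raise hu, Finset.mul_sum, Finset.mul_sum,
    ← Finset.sum_sub_distrib]
  exact Finset.sum_congr rfl fun m _ => by rw [twoForm, Matrix.of_apply]; ring

/-- The action of a double 2-form on 1-forms in the span of `e¹` and `e²`. This case suffices, since
the concomitants `R` and `Θ` lie in this span. -/
theorem act_biForm (F : IsFrame (g x) E p q) {u v : Coord} {u₁ u₂ v₁ v₂ : ℝ}
    (hu : ∀ b, u b = u₁ * E 1 b + u₂ * E 2 b) (hv : ∀ b, v b = v₁ * E 1 b + v₂ * E 2 b)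
    (z : Fin 3 → ℂ) (a b : Fin 4) :
    act g x (biForm p q z E E) u v a b
      = (z 0).re * (u₂ * v₂ * E 3 a * E 3 b - u₁ * v₁ * E 0 a * E 0 b)
        - (z 0).im * (u₁ * v₂ * E 0 a * E 3 b + u₂ * v₁ * E 3 a * E 0 b)
        + (z 1).re * (q * p⁻¹ * u₁ * v₁ * E 3 a * E 3 b - p * q⁻¹ * u₂ * v₂ * E 0 a * E 0 b)
        + (z 1).im * (u₂ * v₁ * E 0 a * E 3 b + u₁ * v₂ * E 3 a * E 0 b)
        + (z 2).re * (p * q * (E 1 a * (u₂ * q⁻¹) - E 2 a * (u₁ * p⁻¹))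
            * (E 1 b * (v₂ * q⁻¹) - E 2 b * (v₁ * p⁻¹))) := by
  have hp := F.p_ne
  have hq := F.q_ne
  have h : act g x (biForm p q z E E) u v a b = ∑ A,
      ((z A).re * (vWeight p q A * ((∑ m, vForm A E a m * raise g x u m)
            * ∑ n, vForm A E b n * raise g x v n)
          - uWeight p q A * ((∑ m, uForm A E a m * raise g x u m)
            * ∑ n, uForm A E b n * raise g x v n))
        + (z A).im * (p * q) * ((∑ m, uForm A E a m * raise g x u m)
            * (∑ n, vForm A E b n * raise g x v n)
          + (∑ m, vForm A E a m * raise g x u m) * ∑ n, uForm A E b n * raise g x v n)) := by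
    simp only [Finset.sum_mul_sum]
    simp only [act, biForm, Finset.sum_mul, Finset.mul_sum, ← Finset.sum_add_distrib,
      ← Finset.sum_sub_distrib]
    rw [Finset.sum_congr rfl fun m _ => Finset.sum_comm, Finset.sum_comm]
    exact Finset.sum_congr rfl fun A _ => Finset.sum_congr rfl fun m _ =>
      Finset.sum_congr rfl fun n _ => by ring
  rw [h]
  simp only [uForm, vForm, F.twoForm_raise hu, F.twoForm_raise hv, Fin.sum_univ_three]
  simp [frameMetric, uWeight, vWeight]
  field_simp
  ring

end IsFrame

theorem abs_eq_mul_sign (r : ℝ) : |r| = r * Real.sign r := by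
  rcases lt_trichotomy r 0 with h | rfl | h
  · rw [abs_of_neg h, Real.sign_of_neg h, mul_neg_one]
  · simp
  · rw [abs_of_pos h, Real.sign_of_pos h, mul_one]

theorem cbrt_pow_three (t : ℝ) : cbrt (t ^ 3) = t := by
  have h : ∀ s : ℝ, 0 < s → (s ^ 3) ^ ((1 : ℝ) / 3) = s := fun s hs => by
    rw [← Real.rpow_natCast, ← Real.rpow_mul hs.le]
    norm_num
  rcases lt_trichotomy t 0 with ht | rfl | ht
  · rw [cbrt, Real.sign_of_neg (Odd.pow_neg (by decide) ht), abs_pow, h _ (abs_pos.2 ht.ne),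
      abs_of_neg ht]
    ring
  · simp [cbrt]
  · rw [cbrt, Real.sign_of_pos (pow_pos ht 3), abs_pow, h _ (abs_pos.2 ht.ne'), abs_of_pos ht,
      one_mul]

/-- The covector `-(p e⁰ + a q e³)`, which is metrically equivalent to `∂_t`. -/
def kerrKillingForm (m a : ℝ) (φ : Coord → Coord) (x : Coord) : Coord := fun b =>
  -(kerrP m a (kerrMap φ x) * carterFrame m a φ x 0 b
    + a * kerrQ a (kerrMap φ x) * carterFrame m a φ x 3 b)

namespace IsKerr

variable {m a : ℝ} {Ω : Set Coord} {φ : Coord → Coord} {g : MetricField} {x : Coord} {o : ℤˣ}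

theorem jacobian_mulVec_stationaryField (hg : IsKerr m a Ω φ g) (hx : x ∈ Ω) :
    (jacobian (kerrMap φ) x).mulVec (stationaryField φ x) = Pi.single 0 1 := by
  rw [stationaryField, hg.jacobian_kerrMap hx, Matrix.mulVec_mulVec, Matrix.mul_assoc,
    Matrix.mul_nonsing_inv _ (hg.det_ne x hx).isUnit, Matrix.mul_one]
  ext i
  rw [Matrix.mulVec_diagonal]
  fin_cases i <;> simp

theorem carterFrame_mulVec_stationaryField (hg : IsKerr m a Ω φ g) (hx : x ∈ Ω) :
    (carterFrame m a φ x).mulVec (stationaryField φ x) = ![1, 0, 0, -a] := by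
  rw [carterFrame, ← Matrix.mulVec_mulVec, hg.jacobian_mulVec_stationaryField hx,
    Matrix.mulVec_single_one]
  ext i
  fin_cases i <;> rfl

theorem stationaryField_ne_zero (hg : IsKerr m a Ω φ g) (hx : x ∈ Ω) :
    stationaryField φ x ≠ 0 := by
  intro h
  have h1 := congrFun (hg.jacobian_mulVec_stationaryField hx) 0
  simp [h] at h1

theorem mulVec_stationaryField (hg : IsKerr m a Ω φ g) (hx : x ∈ Ω) :
    (g x).mulVec (stationaryField φ x) = kerrKillingForm m a φ x := by
  rw [(hg.isFrame hx).metric_eq, Matrix.mul_assoc, ← Matrix.mulVec_mulVec, ← Matrix.mulVec_mulVec,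
    hg.carterFrame_mulVec_stationaryField hx]
  ext b
  simp [Matrix.mulVec, dotProduct, Fin.sum_univ_four, frameMetric, kerrKillingForm]
  ring

theorem raise_kerrKillingForm (hg : IsKerr m a Ω φ g) (hx : x ∈ Ω) :
    raise g x (kerrKillingForm m a φ x) = stationaryField φ x := by
  change (g x)⁻¹.mulVec _ = _
  rw [← hg.mulVec_stationaryField hx, Matrix.mulVec_mulVec,
    Matrix.nonsing_inv_mul _ (hg.isFrame hx).det_metric_ne.isUnit, Matrix.one_mulVec]

theorem vecprod_stationaryField (hg : IsKerr m a Ω φ g) (hx : x ∈ Ω) (v : Coord) :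
    vecprod g x (stationaryField φ x) v = ∑ b, kerrKillingForm m a φ x b * v b := by
  rw [vecprod, Finset.sum_comm, ← hg.mulVec_stationaryField hx]
  refine Finset.sum_congr rfl fun b _ => ?_
  rw [Matrix.mulVec, dotProduct, Finset.sum_mul]
  refine Finset.sum_congr rfl fun c _ => ?_
  rw [show g x c b = g x b c from congrFun (congrFun (hg.movingFrame.symm_g hx) b) c]

theorem tensorPi_eq (hg : IsKerr m a Ω φ g) (hx : x ∈ Ω) (o : ℤˣ) :
    tensorPi g o x = kerrForm m a φ x
      ![-3 * (Complex.normSq (kerrPsi m a (kerrMap φ x)) : ℝ), 0, 0] := by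
  funext i j k l
  have hs := hg.kerrSign_mul_self hx o
  have h := biForm_lin (kerrP m a (kerrMap φ x)) (kerrQ a (kerrMap φ x))
      ![-2 * kerrPsi m a (kerrMap φ x), kerrPsi m a (kerrMap φ x), kerrPsi m a (kerrMap φ x)]
      ((fun _ => kerrSign o m a φ x * Complex.I) *
      ![-2 * kerrPsi m a (kerrMap φ x), kerrPsi m a (kerrMap φ x), kerrPsi m a (kerrMap φ x)])
      1 (carterFrame m a φ x) (carterFrame m a φ x) (invAlpha g o x) (-invBeta g o x)
      (-(invAlpha g o x ^ 2 + invBeta g o x ^ 2)) i j k l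
  rw [tensorPi, hg.weyl_eq hx, hg.weylDual_eq hx, (hg.isFrame hx).metricG_eq, sub_eq_add_neg,
    sub_eq_add_neg, ← neg_mul, ← neg_mul]
  refine h.trans ?_
  rw [kerrForm]
  congr 1
  rw [hg.invAlpha_eq hx, hg.invBeta_eq hx, Complex.normSq_apply]
  funext A
  clear h
  simp only [Pi.add_apply, Pi.smul_apply, Pi.mul_apply]
  generalize kerrPsi m a (kerrMap φ x) = ζ at *
  generalize kerrSign o m a φ x = s at *
  fin_cases A <;> apply Complex.ext <;> simp [pow_two]
  · linear_combination (-3 * ζ.im * ζ.im) * hs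
  · linear_combination (2 * ζ.im * ζ.re) * hs
  · linear_combination (-ζ.im * ζ.re) * hs
  · linear_combination (-ζ.im * ζ.re) * hs

theorem tensorQ_eq (hg : IsKerr m a Ω φ g) (hx : x ∈ Ω) (o : ℤˣ) :
    tensorQ g o x = kerrForm m a φ x fun A => (kerrSign o m a φ x
      * Complex.normSq (kerrPsi m a (kerrMap φ x)) * ![-2, 1, 1] A : ℝ) * Complex.I := by
  funext i j k l
  have hs := hg.kerrSign_mul_self hx o
  have h := biForm_lin (kerrP m a (kerrMap φ x)) (kerrQ a (kerrMap φ x))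
      ![-2 * kerrPsi m a (kerrMap φ x), kerrPsi m a (kerrMap φ x), kerrPsi m a (kerrMap φ x)]
      ((fun _ => kerrSign o m a φ x * Complex.I) *
      ![-2 * kerrPsi m a (kerrMap φ x), kerrPsi m a (kerrMap φ x), kerrPsi m a (kerrMap φ x)])
      0 (carterFrame m a φ x) (carterFrame m a φ x) (invBeta g o x) (invAlpha g o x) 0 i j k l
  rw [tensorQ, hg.weyl_eq hx, hg.weylDual_eq hx]
  rw [zero_mul, add_zero] at h
  refine h.trans ?_
  rw [kerrForm]
  congr 1
  rw [hg.invAlpha_eq hx, hg.invBeta_eq hx, Complex.normSq_apply]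
  funext A
  clear h
  simp only [Pi.add_apply, Pi.smul_apply, Pi.mul_apply]
  generalize kerrPsi m a (kerrMap φ x) = ζ at *
  generalize kerrSign o m a φ x = s at *
  fin_cases A <;> apply Complex.ext <;> simp <;> ring

/-- The tensor `Ξ` is `2 σ η ⊗ η`, where `η` is metrically equivalent to `∂_t`. -/
theorem tensorXi_eq (hg : IsKerr m a Ω φ g) (hx : x ∈ Ω) (h : Generic o m a φ x) (b c : Fin 4) :
    tensorXi g o x b c
      = 2 * invSigma g o x * kerrKillingForm m a φ x b * kerrKillingForm m a φ x c := by
  have F := hg.isFrame hx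
  have hR := hg.formR_eq hx o
  have hT := hg.formTheta_eq hx o
  have hs := hg.kerrSign_mul_self hx o
  have hr := h.r_ne
  have hd := h.diff_ne
  have hn : Complex.normSq (kerrPsi m a (kerrMap φ x)) ≠ 0 := by
    simpa using hg.kerrPsi_ne_zero hx
  have hsqrt : √(invA g x ^ 2 + invB g o x ^ 2)
      = 6 * Complex.normSq (kerrPsi m a (kerrMap φ x)) := by
    rw [hg.sq_add_sq_eq hx, show (36 : ℝ) = 6 ^ 2 by norm_num, ← mul_pow,
      Real.sqrt_sq (mul_nonneg (by norm_num) (Complex.normSq_nonneg _))]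
  have hl : 1 - invLambda g o x ^ 2
      = (kerrMap φ x 1 ^ 2 - kerrTau o m a φ x ^ 2) / kerrMap φ x 1 ^ 2 := by
    rw [hg.invLambda_eq hx h]
    field_simp
  rw [tensorXi, hg.tensorPi_eq hx, hg.tensorQ_eq hx, hsqrt, hl, hg.invSigma_eq hx h]
  simp only [kerrForm, F.act_biForm hR hR, F.act_biForm hT hT, F.act_biForm hR hT,
    F.act_biForm hT hR]
  have hre : (-3 * (Complex.normSq (kerrPsi m a (kerrMap φ x)) : ℂ)).re
      = -3 * Complex.normSq (kerrPsi m a (kerrMap φ x)) := by simp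
  have him : (-3 * (Complex.normSq (kerrPsi m a (kerrMap φ x)) : ℂ)).im = 0 := by simp
  simp only [Matrix.cons_val, kerrKillingForm, invS_kerrMap, Complex.re_ofReal_mul,
    Complex.im_ofReal_mul, Complex.I_re, Complex.I_im, Complex.zero_re, Complex.zero_im, hre, him]
  have hdiv : ∀ r d S n X Y : ℝ, r ≠ 0 → d ≠ 0 → n ≠ 0 →
      (1 / (d / r ^ 2 * (6 * n))) * (12 * n * d * S⁻¹ ^ 2 * X * Y) = 2 * (r ^ 2 / S ^ 2) * X * Y := by
    intro r d S n X Y h1 h2 h3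
    field_simp
    ring
  rw [← hdiv _ _ _ _ _ _ hr hd hn, kerrTau]
  congr 1
  generalize Complex.normSq (kerrPsi m a (kerrMap φ x)) = n
  generalize kerrSign o m a φ x = s at *
  rcases mul_self_eq_one_iff.1 hs with rfl | rfl <;> ring

theorem xiVec_eq (hg : IsKerr m a Ω φ g) (hx : x ∈ Ω) (h : Generic o m a φ x) (v : Coord) :
    xiVec g o x v = (2 * invSigma g o x * vecprod g x (stationaryField φ x) v)
      • stationaryField φ x := by
  rw [hg.vecprod_stationaryField hx, ← hg.raise_kerrKillingForm hx]
  funext b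
  simp only [xiVec, raise, hg.tensorXi_eq hx h, Pi.smul_apply, smul_eq_mul, Finset.mul_sum]
  refine Finset.sum_congr rfl fun c _ => ?_
  rw [Finset.sum_mul]
  exact Finset.sum_congr rfl fun d _ => by ring

theorem xiQuad_eq (hg : IsKerr m a Ω φ g) (hx : x ∈ Ω) (h : Generic o m a φ x) (v : Coord) :
    xiQuad g o x v = 2 * invSigma g o x * vecprod g x (stationaryField φ x) v ^ 2 := by
  rw [hg.vecprod_stationaryField hx, pow_two, Finset.sum_mul_sum]
  simp only [xiQuad, hg.tensorXi_eq hx h, Finset.mul_sum]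
  exact Finset.sum_congr rfl fun c _ => Finset.sum_congr rfl fun d _ => by ring

theorem xiVec_ne_zero_iff (hg : IsKerr m a Ω φ g) (hx : x ∈ Ω) (h : Generic o m a φ x)
    (v : Coord) : xiVec g o x v ≠ 0 ↔ vecprod g x (stationaryField φ x) v ≠ 0 := by
  rw [hg.xiVec_eq hx h, ne_eq, smul_eq_zero]
  simp [(hg.invSigma_pos hx h).ne', hg.stationaryField_ne_zero hx]

theorem exists_xiVec_ne_zero (hg : IsKerr m a Ω φ g) (hx : x ∈ Ω) (h : Generic o m a φ x) :
    ∃ v : Coord, xiVec g o x v ≠ 0 := by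
  have h0 : kerrKillingForm m a φ x ≠ 0 := fun h0 => hg.stationaryField_ne_zero hx <| by
    rw [← hg.raise_kerrKillingForm hx, h0]
    ext b
    simp [raise]
  obtain ⟨b, hb⟩ := Function.ne_iff.1 h0
  refine ⟨Pi.single b 1, (hg.xiVec_ne_zero_iff hx h _).2 ?_⟩
  rw [hg.vecprod_stationaryField hx]
  simpa [Pi.single_apply] using hb

theorem cbrt_eq (hg : IsKerr m a Ω φ g) (hx : x ∈ Ω) (h : Generic o m a φ x) :
    cbrt ((1 - 3 * invLambda g o x ^ 2) / invAlpha g o x)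
      = -(kerrS a φ x / (m ^ ((1 : ℝ) / 3) * kerrMap φ x 1)) := by
  have h1 := h.r_ne
  have h2 := h.third_ne
  have hS := hg.kerrS_ne_zero hx
  have hμ : (m ^ ((1 : ℝ) / 3)) ^ 3 = m := by
    rw [← Real.rpow_natCast, ← Real.rpow_mul hg.mass_pos.le]
    norm_num
  have hμ0 : m ^ ((1 : ℝ) / 3) ≠ 0 := (Real.rpow_pos_of_pos hg.mass_pos _).ne'
  have e : (1 - 3 * invLambda g o x ^ 2) / invAlpha g o x
      = (-(kerrS a φ x / (m ^ ((1 : ℝ) / 3) * kerrMap φ x 1))) ^ 3 := by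
    have hm := hg.mass_pos.ne'
    have e1 : 1 - 3 * invLambda g o x ^ 2
        = (kerrMap φ x 1 ^ 2 - 3 * kerrTau o m a φ x ^ 2) / kerrMap φ x 1 ^ 2 := by
      rw [hg.invLambda_eq hx h]
      field_simp
    rw [e1, hg.invAlpha_eq_div hx, Odd.neg_pow (by decide), div_pow, mul_pow, hμ]
    field_simp
  rw [e, cbrt_pow_three]

theorem killingVec_eq (hg : IsKerr m a Ω φ g) (hx : x ∈ Ω) (h : Generic o m a φ x) {v : Coord}
    (hv : xiVec g o x v ≠ 0) :
    killingVec g o x v =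
      (-(Real.sign (φ x 1) * Real.sign (vecprod g x (stationaryField φ x) v)) *
        (√2 / m ^ ((1 : ℝ) / 3))) • stationaryField φ x := by
  have h1 := h.r_ne
  have hS := hg.kerrS_pos hx
  have hσ := hg.invSigma_pos hx h
  have hc := (hg.xiVec_ne_zero_iff hx h v).1 hv
  have hμ : m ^ ((1 : ℝ) / 3) ≠ 0 := (Real.rpow_pos_of_pos hg.mass_pos _).ne'
  rw [killingVec, hg.xiVec_eq hx h, hg.xiQuad_eq hx h, smul_smul]
  congr 1
  rw [Real.sqrt_mul (by positivity), Real.sqrt_mul zero_le_two, Real.sqrt_sq_eq_abs]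
  have e1 : 2 * invSigma g o x = √2 * √(invSigma g o x) * (√2 * √(invSigma g o x)) := by
    rw [mul_mul_mul_comm, Real.mul_self_sqrt zero_le_two, Real.mul_self_sqrt hσ.le]
  have e2 : √2 * √(invSigma g o x) ≠ 0 :=
    (mul_pos (Real.sqrt_pos.2 zero_lt_two) (Real.sqrt_pos.2 hσ)).ne'
  have e3 : ∀ t A c : ℝ, A ≠ 0 → c ≠ 0 → t / (A * |c|) * (A * A * c) = t * A * Real.sign c := by
    intro t A c hA hc
    rcases lt_or_gt_of_ne hc with hc' | hc'
    · rw [abs_of_neg hc', Real.sign_of_neg hc']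
      field_simp
    · rw [abs_of_pos hc', Real.sign_of_pos hc']
      field_simp
  rw [e1, e3 _ _ _ e2 hc, hg.cbrt_eq hx h, hg.sqrt_invSigma hx h]
  have e4 : |kerrMap φ x 1| = kerrMap φ x 1 * Real.sign (φ x 1) :=
    (abs_eq_mul_sign _).trans rfl
  rw [e4]
  field_simp

end IsKerr

/-! ### The Killing equation -/

theorem pd_eq_zero_of_invariant {f : Coord → ℝ} {i : Fin 4} {x : Coord}
    (hf : DifferentiableAt ℝ f x) (h : ∀ t : ℝ, f (x + t • Pi.single i 1) = f x) :
    pd i f x = 0 := by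
  rw [pd, ← hf.lineDeriv_eq_fderiv, lineDeriv]
  simp only [h, deriv_const]

/-- If the components of a metric do not depend on the coordinate `φ⁰`, then the corresponding
coordinate field `ξ` is a Killing field. Indeed, `J ξ = e₀` for the Jacobian matrix `J` of `φ`, and
since `J` is closed, this gives `J ∂ξ = -∇_ξ J`. -/
theorem isKillingAt_smul_of_jacobian_mulVec {U V : Set Coord} {φ : Coord → Coord}
    {g k : MetricField} {ξ : Coord → Coord} (hU : IsOpen U) (hV : IsOpen V)
    (hφ : ContDiffOn ℝ ∞ φ U) (hmaps : Set.MapsTo φ U V)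
    (hdet : ∀ x ∈ U, (jacobian φ x).det ≠ 0) (hk : SmoothOn k V)
    (hk0 : ∀ q ∈ V, pdMat 0 k q = 0)
    (hg : ∀ x ∈ U, g x = (jacobian φ x).transpose * k (φ x) * jacobian φ x)
    (hξ : ∀ x ∈ U, (jacobian φ x).mulVec (ξ x) = Pi.single 0 1) (c : ℝ) {x : Coord} (hx : x ∈ U) :
    IsKillingAt g (fun y => c • ξ y) x := by
  have hφx := (hφ.differentiableOn (by simp)).differentiableAt (hU.mem_nhds hx)
  have hJs := smoothOn_jacobian hU hφ
  have hJ := hJs.differentiableAt hU hx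
  have hξd : ∀ i, DifferentiableAt ℝ (fun y => ξ y i) x := by
    intro i
    refine ((hJs.inv hdet).differentiableAt hU hx i 0).congr_of_eventuallyEq ?_
    filter_upwards [hU.mem_nhds hx] with y hy
    have h := congrArg ((jacobian φ y)⁻¹.mulVec) (hξ y hy)
    rw [Matrix.mulVec_mulVec, Matrix.nonsing_inv_mul _ (hdet y hy).isUnit, Matrix.one_mulVec,
      Matrix.mulVec_single_one] at h
    rw [h]
    rfl
  set J := jacobian φ x with hJ_def
  set X : Matrix (Fin 4) (Fin 4) ℝ := Matrix.of fun i b => pd b (fun y => ξ y i) x with hX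
  set D : Matrix (Fin 4) (Fin 4) ℝ := ∑ d, ξ x d • pdMat d (jacobian φ) x with hD
  have hJX : J * X = -D := by
    ext i b
    have h0 : pd b (fun y => ∑ d, jacobian φ y i d * ξ y d) x = 0 := by
      have : (fun y => ∑ d, jacobian φ y i d * ξ y d)
          =ᶠ[nhds x] fun _ => (Pi.single 0 1 : Coord) i := by
        filter_upwards [hU.mem_nhds hx] with y hy
        exact congrFun (hξ y hy) i
      rw [pd_congr this]
      simp [pd]
    rw [pd_sum (f := fun d y => jacobian φ y i d * ξ y d) fun d _ => (hJ i d).mul (hξd d)] at h0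
    simp only [pd_mul (hJ i _) (hξd _), pd_jacobian_comm hU hφ hx i b, Finset.sum_add_distrib] at h0
    have h1 : D i b = ∑ d, pd d (fun y => jacobian φ y i b) x * ξ x d := by
      rw [hD, Matrix.sum_apply]
      exact Finset.sum_congr rfl fun d _ => mul_comm _ _
    rw [Matrix.neg_apply, h1, Matrix.mul_apply]
    exact eq_neg_of_add_eq_zero_right h0
  have hkx := (hk.comp hφ hmaps).differentiableAt hU hx
  have hJt : ∀ i j, DifferentiableAt ℝ (fun y => (jacobian φ y).transpose i j) x :=
    fun i j => hJ j i
  have hJk : ∀ i j, DifferentiableAt ℝ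
      (fun y => ((jacobian φ y).transpose * k (φ y)) i j) x := by
    intro i j
    simp only [Matrix.mul_apply]
    exact DifferentiableAt.fun_sum fun l _ => (hJt i l).mul (hkx l j)
  -- The derivative of the components `k` along `ξ` is `∂₀ k = 0`.
  have hk1 : ∑ d, ξ x d • pdMat d (fun y => k (φ y)) x = 0 := by
    simp only [pdMat_comp (hk.differentiableAt hV (hmaps hx)) hφx, Finset.smul_sum, smul_smul]
    rw [Finset.sum_comm]
    have h : ∀ l, ∑ d, (ξ x d * J l d) = (Pi.single 0 1 : Coord) l := fun l => by
      rw [← hξ x hx]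
      exact Finset.sum_congr rfl fun d _ => mul_comm _ _
    simp only [← Finset.sum_smul, ← hJ_def, h]
    rw [Fintype.sum_eq_single 0 fun l hl => by simp [hl], hk0 _ (hmaps hx), smul_zero]
  have hLie : ∑ d, ξ x d • pdMat d g x = -(X.transpose * g x + g x * X) := by
    have h1 : ∀ d, pdMat d g x = (pdMat d (jacobian φ) x).transpose * k (φ x) * J
        + J.transpose * pdMat d (fun y => k (φ y)) x * J
        + J.transpose * k (φ x) * pdMat d (jacobian φ) x := by
      intro d
      rw [pdMat_congr (Filter.eventually_of_mem (hU.mem_nhds hx) hg), pdMat_mul hJk hJ,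
        pdMat_mul hJt hkx, pdMat_transpose, Matrix.add_mul]
    have h2 : ∑ d, ξ x d • pdMat d g x = D.transpose * k (φ x) * J
        + J.transpose * (∑ d, ξ x d • pdMat d (fun y => k (φ y)) x) * J
        + J.transpose * k (φ x) * D := by
      simp only [h1, hD, Matrix.transpose_sum, Matrix.transpose_smul, Finset.mul_sum,
        Finset.sum_mul, Matrix.mul_smul, Matrix.smul_mul, smul_add, Finset.sum_add_distrib]
    have h3 : D = -(J * X) := by rw [hJX, neg_neg]
    rw [h2, hk1, h3, hg x hx, ← hJ_def, Matrix.transpose_neg, Matrix.transpose_mul]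
    simp only [Matrix.mul_zero, Matrix.zero_mul, add_zero, Matrix.neg_mul, Matrix.mul_neg,
      neg_add, Matrix.mul_assoc]
  refine ⟨differentiableAt_pi.2 fun i => (hξd i).const_mul c, fun i j => ?_⟩
  have h1 := congrFun (congrFun hLie i) j
  have hpd : ∀ d l, pd d (fun y => (c • ξ y) l) x = c * X l d := by
    intro d l
    change fderiv ℝ (fun y => c * ξ y l) x _ = _
    rw [fderiv_const_mul (hξd l)]
    rfl
  simp only [Matrix.sum_apply, Matrix.smul_apply, Matrix.neg_apply, Matrix.add_apply,
    Matrix.mul_apply, Matrix.transpose_apply, smul_eq_mul] at h1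
  simp only [hpd]
  simp only [Pi.smul_apply, smul_eq_mul, Finset.sum_add_distrib]
  have h2 : ∀ d, pdMat d g x i j = pd d (fun y => g y i j) x := fun d => rfl
  simp only [h2] at h1
  have e1 : ∑ d, c * ξ x d * pd d (fun y => g y i j) x
      = c * ∑ d, ξ x d * pd d (fun y => g y i j) x := by
    rw [Finset.mul_sum]; exact Finset.sum_congr rfl fun d _ => by ring
  have e2 : ∑ d, g x d j * (c * X d i) = c * ∑ d, X d i * g x d j := by
    rw [Finset.mul_sum]; exact Finset.sum_congr rfl fun d _ => by ring
  have e3 : ∑ d, g x i d * (c * X d j) = c * ∑ d, g x i d * X d j := by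
    rw [Finset.mul_sum]; exact Finset.sum_congr rfl fun d _ => by ring
  rw [e1, e2, e3, h1]
  ring

theorem isKillingAt_congr {g : MetricField} {ξ ξ' : Coord → Coord} {x : Coord}
    (h : ξ =ᶠ[nhds x] ξ') (hξ' : IsKillingAt g ξ' x) : IsKillingAt g ξ x := by
  refine ⟨hξ'.1.congr_of_eventuallyEq h, fun a b => ?_⟩
  have hpd : ∀ d l, pd d (fun y => ξ y l) x = pd d (fun y => ξ' y l) x := fun d l =>
    pd_congr (h.mono fun y hy => by simp only [hy]) d
  simp only [hpd, h.self_of_nhds]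
  exact hξ'.2 a b

/-- The components of the Kerr metric do not depend on `t`. -/
theorem pdMat_zero_kerr {m a : ℝ} {q : Coord} (hq : q ∈ kerrDomain m a) :
    pdMat 0 (fun q => (kerrE m a q).transpose * kerrH m a q * kerrE m a q) q = 0 := by
  have hs : SmoothOn (fun q => (kerrE m a q).transpose * kerrH m a q * kerrE m a q)
      (kerrDomain m a) :=
    ((show SmoothOn (fun q => (kerrE m a q).transpose) (kerrDomain m a) from
      fun i j => smoothOn_kerrE j i).mul smoothOn_kerrH).mul smoothOn_kerrE
  ext i j
  refine pd_eq_zero_of_invariant (hs.differentiableAt isOpen_kerrDomain hq i j) fun t => ?_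
  have h : ∀ l : Fin 4, l ≠ 0 → (q + t • (Pi.single 0 1 : Coord)) l = q l := fun l hl => by simp [hl]
  simp only [kerrE, kerrH, invS, invDelta, invY, h 1 (by decide), h 2 (by decide)]

namespace IsKerr

variable {m a : ℝ} {Ω : Set Coord} {φ : Coord → Coord} {g : MetricField} {x : Coord} {o : ℤˣ}

theorem isKillingAt_stationaryField (hg : IsKerr m a Ω φ g) (hx : x ∈ Ω) (c : ℝ) :
    IsKillingAt g (fun y => c • stationaryField φ y) x :=
  isKillingAt_smul_of_jacobian_mulVec hg.isOpen isOpen_kerrDomain hg.contDiffOn_kerrMap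
    hg.mapsTo_kerrMap (fun _ hy => hg.det_jacobian_kerrMap_ne hy)
    (((show SmoothOn (fun q => (kerrE m a q).transpose) (kerrDomain m a) from
      fun i j => smoothOn_kerrE j i).mul smoothOn_kerrH).mul smoothOn_kerrE)
    (fun _ hq => pdMat_zero_kerr hq) (fun _ hy => hg.metric_eq_kerrMap hy)
    (fun _ hy => hg.jacobian_mulVec_stationaryField hy) c hx

theorem continuousOn_vecprod (hg : IsKerr m a Ω φ g) {X : Coord → Coord} (hX : ContinuousOn X Ω) :
    ContinuousOn (fun y => vecprod g y (stationaryField φ y) (X y)) Ω := by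
  have hE := hg.movingFrame.smooth_E
  have hp := hg.movingFrame.smooth_h
  have hK : ∀ b, ContinuousOn (fun y => kerrKillingForm m a φ y b) Ω := fun b => by
    have h : ContinuousOn (fun y => -(kerrH m a (kerrMap φ y) 1 1 * carterFrame m a φ y 0 b
        + a * kerrH m a (kerrMap φ y) 2 2 * carterFrame m a φ y 3 b)) Ω :=
      (((hp 1 1).continuousOn.mul (hE 0 b).continuousOn).add
        ((continuousOn_const.mul (hp 2 2).continuousOn).mul (hE 3 b).continuousOn)).neg
    exact h
  refine ContinuousOn.congr (f := fun y => ∑ b, kerrKillingForm m a φ y b * X y b) ?_ fun y hy =>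
    hg.vecprod_stationaryField hy (X y)
  exact continuousOn_finsetSum _ fun b _ => (hK b).mul (continuousOn_pi.1 hX b)

theorem eventually_regular (hg : IsKerr m a Ω φ g) (hx : x ∈ Ω) (h : Regular g o x) :
    ∀ᶠ y in nhds x, Regular g o y := by
  have hc : ∀ i, ContinuousAt (fun y => φ y i) x := fun i =>
    (differentiableAt_pi.1 (hg.differentiableAt hx) i).continuousAt
  obtain ⟨h1, h2, h3, h4⟩ := (hg.regular_iff hx).1 h
  have hcos : ContinuousAt (fun y => (a * Real.cos (φ y 2)) ^ 2) x := by
    have := hc 2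
    fun_prop
  have hr : ContinuousAt (fun y => φ y 1 ^ 2) x := (hc 1).pow 2
  filter_upwards [hg.isOpen.mem_nhds hx, (hc 1).eventually_ne h1,
    (hr.sub (hcos.const_mul 3)).eventually_ne (sub_ne_zero.2 h2),
    (hr.sub hcos).eventually_ne (sub_ne_zero.2 h3),
    ((hr.sub ((hc 1).const_mul (2 * m))).add hcos).eventually_ne h4] with y hy y1 y2 y3 y4
  exact (hg.regular_iff hy).2 ⟨y1, sub_ne_zero.1 y2, sub_ne_zero.1 y3, y4⟩

/-- The field `X` is only continuous, but it enters `killingVec` through a sign only. -/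
theorem isKillingAt_killingVec (hg : IsKerr m a Ω φ g) {X : Coord → Coord}
    (hX : ContinuousOn X Ω) (hx : x ∈ Ω) (h : Regular g o x) (hv : xiVec g o x (X x) ≠ 0) :
    IsKillingAt g (fun y => killingVec g o y (X y)) x := by
  have hG := hg.generic_of_regular hx h
  have hc := (hg.continuousOn_vecprod hX).continuousAt (hg.isOpen.mem_nhds hx)
  have h0 := (hg.xiVec_ne_zero_iff hx hG (X x)).1 hv
  have hr : ContinuousAt (fun y => φ y 1) x :=
    (differentiableAt_pi.1 (hg.differentiableAt hx) 1).continuousAt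
  refine isKillingAt_congr ?_ (hg.isKillingAt_stationaryField hx
    (-(Real.sign (φ x 1) * Real.sign (vecprod g x (stationaryField φ x) (X x))) *
        (√2 / m ^ ((1 : ℝ) / 3))))
  filter_upwards [hg.isOpen.mem_nhds hx, hg.eventually_regular hx h, hc.eventually_ne h0,
    eventually_sign_eq hc h0, eventually_sign_eq hr hG.r_ne] with y hy hyr hy0 hys hyr'
  have hyG := hg.generic_of_regular hy hyr
  rw [hg.killingVec_eq hy hyG ((hg.xiVec_ne_zero_iff hy hyG (X y)).2 hy0), hys, hyr']

end IsKerr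

end WeylKerr

end

theorem proposition4 (m a : ℝ) (Ω : Set Coord) (φ : Coord → Coord) (g : MetricField) (o : ℤˣ)
    (hg : IsKerr m a Ω φ g) :
    -- the invariants are defined exactly at the following points
    (∀ p ∈ Ω, Regular g o p ↔
      (φ p 1 ≠ 0 ∧ φ p 1 ^ 2 ≠ 3 * (a * Real.cos (φ p 2)) ^ 2 ∧
        φ p 1 ^ 2 ≠ (a * Real.cos (φ p 2)) ^ 2 ∧
        φ p 1 ^ 2 - 2 * m * φ p 1 + (a * Real.cos (φ p 2)) ^ 2 ≠ 0)) ∧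
    -- the mass and the angular momentum
    (∀ p ∈ Ω, Regular g o p →
      0 < invSigma g o p ∧
      m = |invAlpha g o p| /
        (invSigma g o p * √(invSigma g o p) * |3 * invLambda g o p ^ 2 - 1|) ∧
      0 ≤ radicand g o p ∧
      a = √(radicand g o p) / (2 * invSigma g o p * (1 + invLambda g o p ^ 2))) ∧
    -- the stationary Killing vector
    (∀ p ∈ Ω, Regular g o p →
      (∃ v : Coord, xiVec g o p v ≠ 0) ∧
      ∀ v : Coord, xiVec g o p v ≠ 0 →
        0 < xiQuad g o p v ∧
        killingVec g o p v =
          (-(Real.sign (φ p 1) * Real.sign (vecprod g p (stationaryField φ p) v)) *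
            (√2 / m ^ ((1 : ℝ) / 3))) • stationaryField φ p) ∧
    (∀ X : Coord → Coord, ContinuousOn X Ω → ∀ p ∈ Ω, Regular g o p →
      xiVec g o p (X p) ≠ 0 → IsKillingAt g (fun q => killingVec g o q (X q)) p) := by
  refine ⟨fun p hp => hg.regular_iff hp, fun p hp h => ?_, fun p hp h => ?_,
    fun X hX p hp h hv => hg.isKillingAt_killingVec hX hp h hv⟩
  · have hG := hg.generic_of_regular hp h
    exact ⟨hg.invSigma_pos hp hG, hg.mass_eq hp hG, (hg.radicand_eq hp hG).symm ▸ sq_nonneg _,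
      hg.ang_eq hp hG⟩
  · have hG := hg.generic_of_regular hp h
    refine ⟨hg.exists_xiVec_ne_zero hp hG, fun v hv => ⟨?_, hg.killingVec_eq hp hG hv⟩⟩
    have h1 := hg.invSigma_pos hp hG
    have h2 := (hg.xiVec_ne_zero_iff hp hG v).1 hv
    rw [hg.xiQuad_eq hp hG]
    positivity
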